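/- Let $\Omega\subset\mathbb C$ be either a discrete set without accumulation points, with $\mu$ the counting measure, or a finite union of pairwise disjoint oriented simple (rectifiable) contours, each closed or extending to infinity in both directions, with $d\mu=dz$. Let $|\mu|$ be the counting measure, respectively arc length, and let integral operators act on $L^2(\Omega,|\mu|)$ by $(H\varphi)(u)=\int_\Omega H(u,v)\varphi(v)\,d\mu(v)$. Let $m\ge 1$, let $U\subset\mathbb R^{3m}$ be an open set of parameters $(x,y,t)=(x_1,\dots,x_m,y_1,\dots,y_m,t_1,\dots,t_m)$, put $m_j(z)=e^{t_jz^3+y_jz^2+x_jz}$ and $\Delta(z)=\operatorname{diag}(m_1(z),\dots,m_m(z),1)$, and let $E_i$ be the $(m+1)\times(m+1)$ matrix whose $(i,i)$ entry is $1$ and whose other entries are $0$. For $(x,y,t)\in U$ let $H=H(x,y,t)$ be a cubic integrable operator: a bounded integral operator with kernel $$H(u,v)=\frac{f(u)^Tg(v)}{u-v}\quad(u\ne v),\qquad H(u,u)=0,\qquad f=c\,\Delta\,F,\quad g=c^{-1}\Delta^{-1}G,$$ where $F,G:\Omega\to\mathbb C^{m+1}$ are measurable, do not depend on $(x,y,t)$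 and satisfy $F(u)^TE_iG(u)=0$ for all $u\in\Omega$ and $1\le i\le m+1$; $c$ is a non-vanishing measurable scalar function on $\Omega$, which may depend on $(x,y,t)$; and $f,g\in L^2(\Omega,|\mu|)\cap L^\infty(\Omega,|\mu|)$. Assume that for all $(x,y,t)\in U$ the operator $H$ is trace class and $I-H$ is invertible, and moreover that, for all $1\le i\le m$, * the functions $u^2f_i(u)$ and $u^2g_i(u)$ belong to $L^2(\Omega,|\mu|)$; * the partial derivatives with respect to $y_i$ and $t_i$ of $c(u)$, for each $u\in\Omega$, and of $H$, in the trace norm, exist. (If $c$ does not depend on the parameters, these last two assumptions hold automatically.) Define the $(m+1)\times(m+1)$ matrices $$Y_n=\int_\Omega u^{n-1}\,\big((I-H)^{-1}f\big)(u)\,g(u)^T\,d\mu(u),\qquad n=1,2,3.$$ Then, at every point of $U$ and for every $i\in\{1,\dots,m\}$: the integrals for all entries of $Y_1$, for the entries of $Y_2$ in row $i$ or column $i$, and for the $(i,i)$ entry of $Y_3$ (these are the only entries that the formulas below involve) converge absolutely; the Fredholm determinant $\det(I-H)$ is nonzero and has partial derivatives with respect to $y_i$ and $t_i$; and its logarithmic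 derivatives $\partial\log\det(I-H)=\partial\det(I-H)/\det(I-H)$ are $$\partial_{y_i}\log\det(I-H)=\operatorname{Tr}\big[(Y_1^2-2Y_2)E_i\big],$$ $$\partial_{t_i}\log\det(I-H)=\operatorname{Tr}\big[(-Y_1^3+2Y_1Y_2+Y_2Y_1-3Y_3)E_i\big].$$ -/

import Mathlib

open MeasureTheory Filter Topology
open scoped ENNReal Matrix

noncomputable section

namespace CubicIntegrable

/-! ## Trace class operators and Fredholm determinants on a Hilbert space -/

section TraceClass

variable {E : Type*} [NormedAddCommGroup E] [InnerProductSpace ℂ E]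

/-- The trace norm, in its nuclear form: the infimum of `∑ ‖aₙ‖ ‖bₙ‖` over all expansions
`A φ = ∑ ⟪aₙ, φ⟫ bₙ`; it is `∞` if there is no expansion with a finite sum. -/
def traceNorm (A : E →L[ℂ] E) : ℝ≥0∞ :=
  ⨅ (a : ℕ → E) (b : ℕ → E)
    (_ : ∀ φ : E, HasSum (fun n => inner ℂ (a n) φ • b n) (A φ)),
    ∑' n, ‖a n‖ₑ * ‖b n‖ₑ

/-- Trace class operators: those of finite trace norm. -/
def IsTraceClass (A : E →L[ℂ] E) : Prop := traceNorm A < ∞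

/-- A curve of operators that is differentiable at `s₀` with respect to the trace norm. -/
def TraceNormDifferentiableAt (A : ℝ → E →L[ℂ] E) (s₀ : ℝ) : Prop :=
  ∃ A' : E →L[ℂ] E,
    Tendsto (fun h : ℝ => traceNorm ((h : ℂ)⁻¹ • (A (s₀ + h) - A s₀) - A')) (𝓝[≠] 0) (𝓝 0)

variable [CompleteSpace E]

variable (E) in
/-- The index set of a fixed Hilbert (orthonormal) basis of `E`. -/
def basisIndex : Set E := (exists_hilbertBasis ℂ E).choose

variable (E) in
/-- A fixed Hilbert (orthonormal) basis of `E`. -/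
def basis : HilbertBasis (basisIndex E) ℂ E := (exists_hilbertBasis ℂ E).choose_spec.choose

open Classical in
/-- The Fredholm determinant `det (1 - A)` of a trace class operator `A`: the limit, over the finite
subsets `S` of an orthonormal basis `e`, of the determinants of `(δᵢⱼ - ⟪eᵢ, A eⱼ⟫)` with
`i, j ∈ S`. For a trace class operator the limit exists and does not depend on the basis. -/
def fredholmDet (A : E →L[ℂ] E) : ℂ :=
  limUnder atTop fun S : Finset (basisIndex E) =>
    Matrix.det ((1 : Matrix S S ℂ) - Matrix.of fun i j : S =>
      inner ℂ (basis E i.1) (A (basis E j.1)))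

end TraceClass

/-! ## The set `Ω`, the space `L²(Ω)` and integration over `Ω` -/

/-- An oriented simple rectifiable contour without finite end points, parametrized by arc length:
either it extends to infinity in both directions or it is closed. -/
structure Contour where
  /-- the arc length parametrization -/
  γ : ℝ → ℂ
  /-- a set of parameters that runs through the contour once -/
  dom : Set ℝ
  lipschitz : LipschitzWith 1 γ
  unit_speed : ∀ᵐ s : ℝ, ‖deriv γ s‖ = 1
  simple :
    (dom = Set.univ ∧ Function.Injective γ ∧ Tendsto γ (cocompact ℝ) (cocompact ℂ)) ∨
    (∃ L : ℝ, 0 < L ∧ dom = Set.Ico 0 L ∧ Function.Periodic γ L ∧ Set.InjOn γ (Set.Ico 0 L))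

/-- The set `Ω ⊆ ℂ`: a discrete set without accumulation points or a finite union of pairwise
disjoint contours. -/
inductive Domain where
  | discrete (S : Set ℂ) (hS : ∀ z : ℂ, ¬ AccPt z (𝓟 S)) : Domain
  | contours (n : ℕ) (C : Fin n → Contour)
      (hC : Pairwise fun k l => Disjoint (Set.range (C k).γ) (Set.range (C l).γ)) : Domain

namespace Domain

/-- The underlying set of points. -/
def carrier : Domain → Set ℂ
  | discrete S _ => S
  | contours _ C _ => ⋃ k, Set.range (C k).γ

/-- The positive measure `|dμ|`: the counting measure of `Ω`, respectively arc length. -/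
def absMeasure : Domain → Measure ℂ
  | discrete S _ => Measure.count.restrict S
  | contours _ C _ => Measure.sum fun k => (volume.restrict (C k).dom).map (C k).γ

open Classical in
/-- The density of `dμ` with respect to `|dμ|`: it is `1` in the discrete case, and the unit tangent
`γ'(s)` at the point `γ(s)` in the case of contours, so that `dμ = dz`. -/
def phase : Domain → ℂ → ℂ
  | discrete _ _, _ => 1
  | contours n C _, z =>
      if h : ∃ p : Fin n × ℝ, p.2 ∈ (C p.1).dom ∧ (C p.1).γ p.2 = z
      then deriv (C h.choose.1).γ h.choose.2 else 0

/-- The Hilbert space `ℓ²(Ω)`, respectively `L²(Ω, |dz|)`. -/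
abbrev Hilb (Ω : Domain) : Type := Lp ℂ 2 Ω.absMeasure

/-- The integral `∫_Ω h dμ`. -/
def integral (Ω : Domain) (h : ℂ → ℂ) : ℂ := ∫ u, h u * Ω.phase u ∂Ω.absMeasure

/-- Absolute convergence of `∫_Ω h dμ`. -/
def IntegrableOver (Ω : Domain) (h : ℂ → ℂ) : Prop :=
  Integrable (fun u => h u * Ω.phase u) Ω.absMeasure

/-- `A` is the integral operator `(A φ)(u) = ∫_Ω K(u, v) φ(v) dμ(v)`. -/
def HasKernel (Ω : Domain) (A : Ω.Hilb →L[ℂ] Ω.Hilb) (K : ℂ → ℂ → ℂ) : Prop :=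
  ∀ φ : Ω.Hilb, ∀ᵐ u ∂Ω.absMeasure,
    Ω.IntegrableOver (fun v => K u v * φ v) ∧ A φ u = Ω.integral fun v => K u v * φ v

end Domain

/-! ## Cubic integrable operators -/

/-- The parameters `(x, y, t) ∈ ℝᵐ × ℝᵐ × ℝᵐ`. -/
abbrev Params (m : ℕ) : Type := (Fin m → ℝ) × (Fin m → ℝ) × (Fin m → ℝ)

namespace Params

variable {m : ℕ}

/-- The parameters `x`. -/
def x (θ : Params m) : Fin m → ℝ := θ.1

/-- The parameters `y`. -/
def y (θ : Params m) : Fin m → ℝ := θ.2.1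

/-- The parameters `t`. -/
def t (θ : Params m) : Fin m → ℝ := θ.2.2

/-- Replace `yᵢ` by `s`. -/
def setY (θ : Params m) (i : Fin m) (s : ℝ) : Params m := (θ.x, Function.update θ.y i s, θ.t)

/-- Replace `tᵢ` by `s`. -/
def setT (θ : Params m) (i : Fin m) (s : ℝ) : Params m := (θ.x, θ.y, Function.update θ.t i s)

end Params

/-- The diagonal of `Δ(z) = diag(m₁(z), …, mₘ(z), 1)`, `mⱼ(z) = exp(tⱼ z³ + yⱼ z² + xⱼ z)`. -/
def deltaDiag {m : ℕ} (θ : Params m) (z : ℂ) : Fin (m + 1) → ℂ :=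
  Fin.snoc (fun j : Fin m =>
    Complex.exp ((θ.t j : ℂ) * z ^ 3 + (θ.y j : ℂ) * z ^ 2 + (θ.x j : ℂ) * z)) 1

/-- The diagonal matrix `Δ(z)`. -/
def Delta {m : ℕ} (θ : Params m) (z : ℂ) : Matrix (Fin (m + 1)) (Fin (m + 1)) ℂ :=
  Matrix.diagonal (deltaDiag θ z)

/-- The matrix `Eᵢ` whose `(i, i)` entry is `1` and whose other entries are `0`. -/
def Emat {m : ℕ} (i : Fin (m + 1)) : Matrix (Fin (m + 1)) (Fin (m + 1)) ℂ :=
  Matrix.single i i 1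

/-- `f(u) = c(u) Δ(u) F(u)`. -/
def fVec {m : ℕ} (F : ℂ → Fin (m + 1) → ℂ) (c : Params m → ℂ → ℂ) (θ : Params m) (u : ℂ) :
    Fin (m + 1) → ℂ :=
  c θ u • (Delta θ u *ᵥ F u)

/-- `g(u) = c(u)⁻¹ Δ(u)⁻¹ G(u)`. -/
def gVec {m : ℕ} (G : ℂ → Fin (m + 1) → ℂ) (c : Params m → ℂ → ℂ) (θ : Params m) (u : ℂ) :
    Fin (m + 1) → ℂ :=
  (c θ u)⁻¹ • ((Delta θ u)⁻¹ *ᵥ G u)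

open Classical in
/-- The kernel `f(u)ᵀ g(v) / (u - v)` for `u ≠ v`, and `0` for `u = v`. -/
def integrableKernel {m : ℕ} (f g : ℂ → Fin (m + 1) → ℂ) (u v : ℂ) : ℂ :=
  if u = v then 0 else (f u ⬝ᵥ g v) / (u - v)

/-- A family `H(θ)`, `θ = (x, y, t) ∈ U`, of cubic integrable operators on `L²(Ω)`. The vector
functions `F, G` do not depend on `θ`, while the scalar function `c` may do so. -/
structure CubicFamily (Ω : Domain) (m : ℕ) (U : Set (Params m)) where
  F : ℂ → Fin (m + 1) → ℂ
  G : ℂ → Fin (m + 1) → ℂ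
  c : Params m → ℂ → ℂ
  H : Params m → Ω.Hilb →L[ℂ] Ω.Hilb
  measurable_F : ∀ j, AEStronglyMeasurable (fun u => F u j) Ω.absMeasure
  measurable_G : ∀ j, AEStronglyMeasurable (fun u => G u j) Ω.absMeasure
  measurable_c : ∀ θ ∈ U, AEStronglyMeasurable (c θ) Ω.absMeasure
  c_ne_zero : ∀ θ ∈ U, ∀ u ∈ Ω.carrier, c θ u ≠ 0
  orthogonal : ∀ u ∈ Ω.carrier, ∀ i : Fin (m + 1), F u ⬝ᵥ (Emat i *ᵥ G u) = 0
  f_memL2 : ∀ θ ∈ U, ∀ j, MemLp (fun u => fVec F c θ u j) 2 Ω.absMeasure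
  g_memL2 : ∀ θ ∈ U, ∀ j, MemLp (fun u => gVec G c θ u j) 2 Ω.absMeasure
  f_memLinfty : ∀ θ ∈ U, ∀ j, MemLp (fun u => fVec F c θ u j) ∞ Ω.absMeasure
  g_memLinfty : ∀ θ ∈ U, ∀ j, MemLp (fun u => gVec G c θ u j) ∞ Ω.absMeasure
  kernel : ∀ θ ∈ U, Ω.HasKernel (H θ) (integrableKernel (fVec F c θ) (gVec G c θ))

namespace CubicFamily

variable {Ω : Domain} {m : ℕ} {U : Set (Params m)} (𝓗 : CubicFamily Ω m U)

/-- The vector function `f`. -/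
def f (θ : Params m) (u : ℂ) : Fin (m + 1) → ℂ := fVec 𝓗.F 𝓗.c θ u

/-- The vector function `g`. -/
def g (θ : Params m) (u : ℂ) : Fin (m + 1) → ℂ := gVec 𝓗.G 𝓗.c θ u

/-- The `j`-th component of `(1 - H)⁻¹ f`. -/
def resolventF (θ : Params m) (hθ : θ ∈ U) (j : Fin (m + 1)) : Ω.Hilb :=
  Ring.inverse (1 - 𝓗.H θ) (𝓗.f_memL2 θ hθ j).toLp

/-- The integrand `uⁿ⁻¹ ((1 - H)⁻¹ f)ⱼ(u) gₖ(u)` of the entry `(j, k)` of `Yₙ`. -/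
def momentIntegrand (n : ℕ) (θ : Params m) (hθ : θ ∈ U) (j k : Fin (m + 1)) (u : ℂ) : ℂ :=
  u ^ (n - 1) * (𝓗.resolventF θ hθ j u * 𝓗.g θ u k)

/-- The matrix `Yₙ = ∫_Ω uⁿ⁻¹ ((1 - H)⁻¹ f)(u) g(u)ᵀ dμ(u)`, for `n ≥ 1`. -/
def Y (n : ℕ) (θ : Params m) (hθ : θ ∈ U) : Matrix (Fin (m + 1)) (Fin (m + 1)) ℂ :=
  Matrix.of fun j k => Ω.integral (𝓗.momentIntegrand n θ hθ j k)

/-- The Fredholm determinant `det (1 - H)` as a function of the parameters. -/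
def det (θ : Params m) : ℂ := fredholmDet (𝓗.H θ)

/-- The components of `u² f(u)` and `u² g(u)` with indices `1, …, m` are square integrable. -/
def HasMoments : Prop :=
  ∀ θ ∈ U, ∀ i : Fin m,
    MemLp (fun u => u ^ 2 * 𝓗.f θ u i.castSucc) 2 Ω.absMeasure ∧
    MemLp (fun u => u ^ 2 * 𝓗.g θ u i.castSucc) 2 Ω.absMeasure

/-- The partial derivatives of `c` (pointwise) and of `H` (in trace norm) with respect to the
parameters `yᵢ` and `tᵢ` exist. -/
def IsDifferentiable : Prop :=
  ∀ θ ∈ U, ∀ i : Fin m,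
    (∀ u ∈ Ω.carrier,
      DifferentiableAt ℝ (fun s : ℝ => 𝓗.c (θ.setY i s) u) (θ.y i) ∧
      DifferentiableAt ℝ (fun s : ℝ => 𝓗.c (θ.setT i s) u) (θ.t i)) ∧
    TraceNormDifferentiableAt (fun s : ℝ => 𝓗.H (θ.setY i s)) (θ.y i) ∧
    TraceNormDifferentiableAt (fun s : ℝ => 𝓗.H (θ.setT i s)) (θ.t i)

end CubicFamily

end CubicIntegrable

end

noncomputable section

namespace CubicIntegrable

/-! ## The trace norm -/

section TraceNorm

variable {E : Type*} [NormedAddCommGroup E] [InnerProductSpace ℂ E]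

/-! Jacobi's formula ∂ log det(1 - H) = -Tr((1 - H)⁻¹ ∂H) (`hasDerivAt_fredholmDet`) reduces the
theorem to a trace. Put d = 2 for yᵢ and d = 3 for tᵢ. Formally, the exponentials contribute (uᵈ -
vᵈ)/(u - v) · fᵢ(u) gᵢ(v) to ∂H, the kernel of the finite rank operator L given by `powerOp`, and
the scalar c contributes the commutator [a, H] with multiplication by a = ∂ log c. Since (1 - H)⁻¹
commutes with H, cyclicity of the trace removes the commutator and leaves -Tr((1 - H)⁻¹ L).

The function a need not be bounded, so the formal identity is proved only after compression to sets
Sₙ on which the difference quotients of c are uniformly bounded (`exists_truncated_commutator`).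
These sets exhaust Ω, their projections Pₙ tend strongly to 1, and Pₙ X Pₙ → X in trace norm for
trace class X. Hence the resolvents and the traces pass to the limit
(`trace_eq_of_truncated_commutator`, `trace_derivative`).

With R = (1 - H)⁻¹, Tr(R L) is a sum of integrals ∫ uᵈ⁻¹⁻ˡ gᵢ R(uˡ fᵢ) dμ. As fₖ gₖ = 0, the
commutator [u, H] is the finite rank operator Σ fₖ ⊗ gₖ, so that u R w = R(u w) + Σₖ (∫ gₖ R w) R fₖ
(`id_mul_resolvent`). Pulling the powers of u out of R in this way produces the entries of the Yₙ
and their products. That u R w is square integrable at all comes from Lipschitz cut-offs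
(`memLp_id_mul`).

The determinant is a limit of finite sections, so its theory rests on a bound that is uniform in the
section: |det(1 + M)| ≤ exp(|tr M| + ‖M‖²/2) with the Frobenius norm. The Schwarz lemma turns it
into a uniform Lipschitz estimate in trace norm, and approximation by finite rank operators then
yields existence of the limit and the derivative at the identity. -/

/-- The operator `A` is represented by the series `∑ ⟪aₙ, ·⟫ bₙ`. -/
def Represents (a b : ℕ → E) (A : E →L[ℂ] E) : Prop :=
  ∀ φ : E, HasSum (fun n => inner ℂ (a n) φ • b n) (A φ)

theorem Represents.traceNorm_le {A : E →L[ℂ] E} {a b : ℕ → E} (h : Represents a b A) :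
    traceNorm A ≤ ∑' n, ‖a n‖ₑ * ‖b n‖ₑ :=
  iInf₂_le_of_le a b (iInf_le _ h)

theorem exists_represents_of_traceNorm_lt {A : E →L[ℂ] E} {r : ℝ≥0∞} (h : traceNorm A < r) :
    ∃ a b : ℕ → E, Represents a b A ∧ ∑' n, ‖a n‖ₑ * ‖b n‖ₑ < r := by
  simp only [traceNorm, iInf_lt_iff] at h
  obtain ⟨a, b, h, h'⟩ := h
  exact ⟨a, b, h, h'⟩

theorem le_traceNorm {A : E →L[ℂ] E} {r : ℝ≥0∞}
    (h : ∀ a b : ℕ → E, Represents a b A → r ≤ ∑' n, ‖a n‖ₑ * ‖b n‖ₑ) : r ≤ traceNorm A :=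
  le_iInf fun a => le_iInf fun b => le_iInf fun hab => h a b hab

omit [InnerProductSpace ℂ E] in
theorem summable_of_tsum_enorm_lt_top {a b : ℕ → E} (h : ∑' n, ‖a n‖ₑ * ‖b n‖ₑ < ∞) :
    Summable fun n => ‖a n‖ * ‖b n‖ := by
  have h1 : ∀ n, ‖a n‖ₑ * ‖b n‖ₑ = ENNReal.ofReal (‖a n‖ * ‖b n‖) := fun n => by
    rw [ENNReal.ofReal_mul (norm_nonneg _), ofReal_norm, ofReal_norm]
  have h2 := ENNReal.summable_toReal h.ne
  refine h2.congr fun n => ?_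
  rw [h1, ENNReal.toReal_ofReal (by positivity)]

omit [InnerProductSpace ℂ E] in
theorem ofReal_tsum_norm {a b : ℕ → E} (h : Summable fun n => ‖a n‖ * ‖b n‖) :
    ENNReal.ofReal (∑' n, ‖a n‖ * ‖b n‖) = ∑' n, ‖a n‖ₑ * ‖b n‖ₑ := by
  rw [ENNReal.ofReal_tsum_of_nonneg (fun n => by positivity) h]
  refine tsum_congr fun n => ?_
  rw [ENNReal.ofReal_mul (norm_nonneg _), ofReal_norm, ofReal_norm]

theorem enorm_le_traceNorm (A : E →L[ℂ] E) : ‖A‖ₑ ≤ traceNorm A := by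
  refine le_traceNorm fun a b h => ?_
  by_cases hs : ∑' n, ‖a n‖ₑ * ‖b n‖ₑ = ∞
  · simp [hs]
  have hs' := summable_of_tsum_enorm_lt_top (lt_top_iff_ne_top.2 hs)
  rw [← ofReal_tsum_norm hs', ← ofReal_norm]
  refine ENNReal.ofReal_le_ofReal (A.opNorm_le_bound (tsum_nonneg fun n => by positivity) ?_)
  intro φ
  rw [← (h φ).tsum_eq, ← tsum_mul_right]
  refine tsum_of_norm_bounded (hs'.mul_right _).hasSum fun n => ?_
  rw [norm_smul]
  calc ‖inner ℂ (a n) φ‖ * ‖b n‖ ≤ (‖a n‖ * ‖φ‖) * ‖b n‖ := by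
        gcongr; exact norm_inner_le_norm _ _
    _ = _ := by ring

/-- Nearly optimal expansions of the two operators, each within ε/2, are interleaved along even and
odd indices. -/
theorem traceNorm_add_le (A B : E →L[ℂ] E) :
    traceNorm (A + B) ≤ traceNorm A + traceNorm B := by
  refine ENNReal.le_of_forall_pos_le_add fun ε hε hlt => ?_
  have hA : traceNorm A < ∞ := lt_of_le_of_lt le_self_add hlt
  have hB : traceNorm B < ∞ := lt_of_le_of_lt le_add_self hlt
  have hε' : ((ε / 2 : NNReal) : ℝ≥0∞) ≠ 0 := by
    simpa using hε.ne'
  obtain ⟨a, b, h, hs⟩ := exists_represents_of_traceNorm_lt (ENNReal.lt_add_right hA.ne hε')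
  obtain ⟨a', b', h', hs'⟩ := exists_represents_of_traceNorm_lt (ENNReal.lt_add_right hB.ne hε')
  let α : ℕ → E := fun n => if Even n then a (n / 2) else a' (n / 2)
  let β : ℕ → E := fun n => if Even n then b (n / 2) else b' (n / 2)
  have e1 : ∀ k, α (2 * k) = a k := fun k => by simp [α]
  have e2 : ∀ k, α (2 * k + 1) = a' k := fun k => by
    simp only [α, Nat.not_even_two_mul_add_one, if_false]; congr 1; omega
  have e3 : ∀ k, β (2 * k) = b k := fun k => by simp [β]
  have e4 : ∀ k, β (2 * k + 1) = b' k := fun k => by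
    simp only [β, Nat.not_even_two_mul_add_one, if_false]; congr 1; omega
  have hr : Represents α β (A + B) := by
    intro φ
    refine HasSum.even_add_odd ?_ ?_
    · simp only [e1, e3]; exact h φ
    · simp only [e2, e4]; exact h' φ
  refine hr.traceNorm_le.trans ?_
  rw [← tsum_even_add_odd ENNReal.summable ENNReal.summable]
  simp only [e1, e2, e3, e4]
  refine (add_le_add hs.le hs'.le).trans (le_of_eq ?_)
  have : (ε : ℝ≥0∞) = ((ε / 2 : NNReal) : ℝ≥0∞) + ((ε / 2 : NNReal) : ℝ≥0∞) := by
    rw [← ENNReal.coe_add, add_halves]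
  rw [this]; ring

@[simp] theorem traceNorm_zero : traceNorm (0 : E →L[ℂ] E) = 0 := by
  have h : Represents (0 : ℕ → E) 0 (0 : E →L[ℂ] E) := fun φ => by simp [hasSum_zero]
  simpa using h.traceNorm_le

theorem traceNorm_comp_le (B A : E →L[ℂ] E) :
    traceNorm (B ∘L A) ≤ ‖B‖ₑ * traceNorm A := by
  by_cases hA : traceNorm A = ∞
  -- The convention `0 * ∞ = 0` makes B = 0 a separate case here.
  · by_cases hB : B = 0
    · simp [hB]
    · have hB' : ‖B‖ₑ ≠ 0 := by
        rw [← ofReal_norm]; exact (ENNReal.ofReal_pos.2 (norm_pos_iff.2 hB)).ne'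
      rw [hA, ENNReal.mul_top hB']; exact le_top
  refine le_of_forall_gt fun r hr => ?_
  obtain ⟨s, hs, hsr⟩ : ∃ s, traceNorm A < s ∧ ‖B‖ₑ * s < r := by
    have hc : ContinuousAt (fun s : ℝ≥0∞ => ‖B‖ₑ * s) (traceNorm A) :=
      (ENNReal.continuous_const_mul (by simp)).continuousAt
    have h1 := hc.eventually (gt_mem_nhds hr)
    have h2 : ∀ᶠ s in 𝓝[>] (traceNorm A), ‖B‖ₑ * s < r := nhdsWithin_le_nhds h1
    have : (𝓝[>] (traceNorm A)).NeBot := by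
      have : traceNorm A < ∞ := lt_top_iff_ne_top.2 hA
      exact nhdsGT_neBot_of_exists_gt ⟨_, this⟩
    obtain ⟨s, hs, hs'⟩ := (h2.and self_mem_nhdsWithin).exists
    exact ⟨s, hs', hs⟩
  obtain ⟨a, b, h, hlt⟩ := exists_represents_of_traceNorm_lt hs
  have hr' : Represents a (fun n => B (b n)) (B ∘L A) := fun φ => by
    simpa using (h φ).mapL B
  refine lt_of_le_of_lt (hr'.traceNorm_le.trans ?_) hsr
  calc ∑' n, ‖a n‖ₑ * ‖B (b n)‖ₑ ≤ ∑' n, ‖B‖ₑ * (‖a n‖ₑ * ‖b n‖ₑ) := by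
        refine ENNReal.tsum_le_tsum fun n => ?_
        calc ‖a n‖ₑ * ‖B (b n)‖ₑ ≤ ‖a n‖ₑ * (‖B‖ₑ * ‖b n‖ₑ) := by
              gcongr; exact B.le_opENorm _
          _ = _ := by ring
    _ = ‖B‖ₑ * ∑' n, ‖a n‖ₑ * ‖b n‖ₑ := ENNReal.tsum_mul_left
    _ ≤ ‖B‖ₑ * s := by gcongr

theorem traceNorm_smul_le (c : ℂ) (A : E →L[ℂ] E) :
    traceNorm (c • A) ≤ ‖c‖ₑ * traceNorm A := by
  have h := traceNorm_comp_le (c • ContinuousLinearMap.id ℂ E) A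
  rw [ContinuousLinearMap.smul_comp, ContinuousLinearMap.id_comp] at h
  refine h.trans ?_
  gcongr
  rw [enorm_smul]
  refine mul_le_of_le_one_right zero_le ?_
  rw [← ofReal_norm, ← ENNReal.ofReal_one]
  exact ENNReal.ofReal_le_ofReal ContinuousLinearMap.norm_id_le

theorem traceNorm_neg (A : E →L[ℂ] E) : traceNorm (-A) = traceNorm A := by
  have h : ∀ B : E →L[ℂ] E, traceNorm (-B) ≤ traceNorm B := fun B => by
    simpa using traceNorm_smul_le (-1) B
  exact le_antisymm (h A) (by simpa using h (-A))

theorem traceNorm_sub_le (A B : E →L[ℂ] E) :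
    traceNorm (A - B) ≤ traceNorm A + traceNorm B := by
  rw [sub_eq_add_neg, ← traceNorm_neg B]; exact traceNorm_add_le _ _

theorem traceNorm_rankOne_le (a b : E) :
    traceNorm (InnerProductSpace.rankOne ℂ b a) ≤ ‖a‖ₑ * ‖b‖ₑ := by
  have hr : Represents (fun n => if n = 0 then a else 0) (fun n => if n = 0 then b else 0)
      (InnerProductSpace.rankOne ℂ b a) := fun φ => by
    rw [InnerProductSpace.rankOne_apply]
    convert hasSum_single (f := fun n : ℕ => inner ℂ (if n = 0 then a else 0) φ •
      (if n = 0 then b else (0 : E))) 0 (fun n hn => by simp [hn]) using 1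
    simp
  refine hr.traceNorm_le.trans ?_
  rw [tsum_eq_single 0 (fun n hn => by simp [hn])]
  simp

theorem isTraceClass_rankOne (a b : E) : IsTraceClass (InnerProductSpace.rankOne ℂ b a) :=
  (traceNorm_rankOne_le a b).trans_lt (by simp [ENNReal.mul_lt_top])

theorem IsTraceClass.zero : IsTraceClass (0 : E →L[ℂ] E) := by simp [IsTraceClass]

theorem IsTraceClass.add {A B : E →L[ℂ] E} (hA : IsTraceClass A) (hB : IsTraceClass B) :
    IsTraceClass (A + B) :=
  (traceNorm_add_le A B).trans_lt (ENNReal.add_lt_top.2 ⟨hA, hB⟩)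

theorem IsTraceClass.sub {A B : E →L[ℂ] E} (hA : IsTraceClass A) (hB : IsTraceClass B) :
    IsTraceClass (A - B) :=
  (traceNorm_sub_le A B).trans_lt (ENNReal.add_lt_top.2 ⟨hA, hB⟩)

theorem IsTraceClass.smul {A : E →L[ℂ] E} (hA : IsTraceClass A) (c : ℂ) :
    IsTraceClass (c • A) :=
  (traceNorm_smul_le c A).trans_lt (ENNReal.mul_lt_top (by simp) hA)

theorem IsTraceClass.sum {ι : Type*} {s : Finset ι} {A : ι → E →L[ℂ] E}
    (hA : ∀ i ∈ s, IsTraceClass (A i)) : IsTraceClass (∑ i ∈ s, A i) := by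
  classical
  induction s using Finset.induction_on with
  | empty => simpa using IsTraceClass.zero
  | insert i s hi ih =>
    rw [Finset.sum_insert hi]
    exact (hA i (by simp)).add (ih fun j hj => hA j (by simp [hj]))

theorem IsTraceClass.comp_left {A : E →L[ℂ] E} (hA : IsTraceClass A) (B : E →L[ℂ] E) :
    IsTraceClass (B ∘L A) :=
  (traceNorm_comp_le B A).trans_lt (ENNReal.mul_lt_top (by simp) hA)

theorem IsTraceClass.exists_represents {A : E →L[ℂ] E} (hA : IsTraceClass A) :
    ∃ a b : ℕ → E, Represents a b A ∧ Summable fun n => ‖a n‖ * ‖b n‖ := by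
  obtain ⟨a, b, h, hlt⟩ := exists_represents_of_traceNorm_lt hA
  exact ⟨a, b, h, summable_of_tsum_enorm_lt_top hlt⟩

/-- Multiplying a trace class operator from the left by operators that tend to `0` strongly. -/
theorem IsTraceClass.tendsto_traceNorm_comp {ι : Type*} {l : Filter ι} {A : E →L[ℂ] E}
    (hA : IsTraceClass A) {T : ι → E →L[ℂ] E} {C : ℝ} (hC : ∀ᶠ j in l, ‖T j‖ ≤ C)
    (hT : ∀ φ, Tendsto (fun j => T j φ) l (𝓝 0)) :
    Tendsto (fun j => traceNorm (T j ∘L A)) l (𝓝 0) := by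
  obtain ⟨a, b, h, hs⟩ := hA.exists_represents
  -- Dominated convergence in n: each term tends to 0 by strong convergence and is at most C ‖aₙ‖
  -- ‖bₙ‖.
  have key : Tendsto (fun j => ∑' n, ‖a n‖ * ‖T j (b n)‖) l (𝓝 (∑' n : ℕ, (0 : ℝ))) := by
    refine tendsto_tsum_of_dominated_convergence (bound := fun n => C * (‖a n‖ * ‖b n‖))
      (hs.mul_left C) (fun n => ?_) ?_
    · simpa using ((hT (b n)).norm).const_mul ‖a n‖
    · filter_upwards [hC] with j hj n
      rw [Real.norm_of_nonneg (by positivity)]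
      calc ‖a n‖ * ‖T j (b n)‖ ≤ ‖a n‖ * (C * ‖b n‖) := by
            gcongr
            exact (T j).le_of_opNorm_le hj _
        _ = _ := by ring
  rw [tsum_zero] at key
  have key' := ENNReal.tendsto_ofReal key
  rw [ENNReal.ofReal_zero] at key'
  refine tendsto_of_tendsto_of_tendsto_of_le_of_le' tendsto_const_nhds key'
    (Eventually.of_forall fun _ => zero_le) ?_
  filter_upwards [hC] with j hj
  have hr' : Represents a (fun n => T j (b n)) (T j ∘L A) := fun φ => by
    simpa using (h φ).mapL (T j)
  rw [ofReal_tsum_norm]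
  · exact hr'.traceNorm_le
  · refine Summable.of_nonneg_of_le (fun n => by positivity) (fun n => ?_) (hs.mul_left C)
    calc ‖a n‖ * ‖T j (b n)‖ ≤ ‖a n‖ * (C * ‖b n‖) := by
          gcongr
          exact (T j).le_of_opNorm_le hj _
      _ = _ := by ring

section Complete

variable [CompleteSpace E]

open ContinuousLinearMap in
-- Summability makes the adjoint series converge in norm; convergence of the original series alone
-- would only give it weakly.
theorem Represents.adjoint {A : E →L[ℂ] E} {a b : ℕ → E} (h : Represents a b A)
    (hs : Summable fun n => ‖a n‖ * ‖b n‖) :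
    Represents b a (adjoint A) := fun φ => by
  have hsum : Summable fun n => inner ℂ (b n) φ • a n := by
    refine Summable.of_norm_bounded (hs.mul_right ‖φ‖) fun n => ?_
    rw [norm_smul]
    calc ‖inner ℂ (b n) φ‖ * ‖a n‖ ≤ (‖b n‖ * ‖φ‖) * ‖a n‖ := by
          gcongr; exact norm_inner_le_norm _ _
      _ = _ := by ring
  convert hsum.hasSum using 1
  refine ext_inner_left ℂ fun ψ => ?_
  rw [adjoint_inner_right]
  have h1 := (hsum.hasSum.mapL (innerSL ℂ ψ)).tsum_eq
  have h2 := ((h ψ).mapL (innerSL ℂ φ)).tsum_eq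
  simp only [innerSL_apply_apply] at h1 h2
  rw [← h1, ← inner_conj_symm, ← h2, Complex.conj_tsum]
  refine tsum_congr fun n => ?_
  simp [inner_smul_right, mul_comm]

open ContinuousLinearMap in
theorem traceNorm_adjoint_le (A : E →L[ℂ] E) : traceNorm (adjoint A) ≤ traceNorm A := by
  refine le_traceNorm fun a b h => ?_
  by_cases hs : ∑' n, ‖a n‖ₑ * ‖b n‖ₑ = ∞
  · simp [hs]
  have hs' := summable_of_tsum_enorm_lt_top (lt_top_iff_ne_top.2 hs)
  refine (h.adjoint hs').traceNorm_le.trans (le_of_eq ?_)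
  exact tsum_congr fun n => mul_comm _ _

open ContinuousLinearMap in
theorem traceNorm_adjoint (A : E →L[ℂ] E) : traceNorm (adjoint A) = traceNorm A :=
  le_antisymm (traceNorm_adjoint_le A) (by simpa using traceNorm_adjoint_le (adjoint A))

open ContinuousLinearMap in
theorem traceNorm_comp_le' (A B : E →L[ℂ] E) :
    traceNorm (A ∘L B) ≤ traceNorm A * ‖B‖ₑ := by
  have h := traceNorm_comp_le (adjoint B) (adjoint A)
  rw [← adjoint_comp, traceNorm_adjoint, traceNorm_adjoint] at h
  rw [mul_comm]
  refine h.trans (le_of_eq ?_)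
  congr 1
  rw [← ofReal_norm, ← ofReal_norm, LinearIsometryEquiv.norm_map]

theorem IsTraceClass.comp_right {A : E →L[ℂ] E} (hA : IsTraceClass A) (B : E →L[ℂ] E) :
    IsTraceClass (A ∘L B) :=
  (traceNorm_comp_le' A B).trans_lt (ENNReal.mul_lt_top hA (by simp))

open ContinuousLinearMap in
/-- Multiplying a trace class operator from the right by operators whose adjoints tend to `0`
strongly. -/
theorem IsTraceClass.tendsto_traceNorm_comp' {ι : Type*} {l : Filter ι} {A : E →L[ℂ] E}
    (hA : IsTraceClass A) {T : ι → E →L[ℂ] E} {C : ℝ} (hC : ∀ᶠ j in l, ‖T j‖ ≤ C)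
    (hT : ∀ φ, Tendsto (fun j => adjoint (T j) φ) l (𝓝 0)) :
    Tendsto (fun j => traceNorm (A ∘L T j)) l (𝓝 0) := by
  have hA' : IsTraceClass (adjoint A) := by rwa [IsTraceClass, traceNorm_adjoint]
  have := hA'.tendsto_traceNorm_comp (T := fun j => adjoint (T j)) (C := C)
    (by simpa using hC) hT
  refine this.congr fun j => ?_
  rw [← adjoint_comp, traceNorm_adjoint]

/-! ## The trace -/

/-- The trace of an operator, with respect to the fixed Hilbert basis. -/
def trace (A : E →L[ℂ] E) : ℂ := ∑' i, inner ℂ (basis E i) (A (basis E i))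

omit [CompleteSpace E] in
theorem sum_norm_inner_mul_inner_le {ι : Type*} {e : ι → E} (he : Orthonormal ℂ e)
    (s : Finset ι) (a b : E) :
    ∑ i ∈ s, ‖inner ℂ a (e i) * inner ℂ (e i) b‖ ≤ ‖a‖ * ‖b‖ := by
  calc ∑ i ∈ s, ‖inner ℂ a (e i) * inner ℂ (e i) b‖
      = ∑ i ∈ s, ‖inner ℂ (e i) a‖ * ‖inner ℂ (e i) b‖ := by
        refine Finset.sum_congr rfl fun i _ => ?_
        rw [norm_mul, norm_inner_symm]
    _ ≤ √(∑ i ∈ s, ‖inner ℂ (e i) a‖ ^ 2) * √(∑ i ∈ s, ‖inner ℂ (e i) b‖ ^ 2) :=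
        Real.sum_mul_le_sqrt_mul_sqrt _ _ _
    _ ≤ √(‖a‖ ^ 2) * √(‖b‖ ^ 2) := by
        gcongr
        · exact he.sum_inner_products_le a
        · exact he.sum_inner_products_le b
    _ = ‖a‖ * ‖b‖ := by rw [Real.sqrt_sq (norm_nonneg _), Real.sqrt_sq (norm_nonneg _)]

/-- The double series of ⟪aₙ, eᵢ⟫ ⟪eᵢ, bₙ⟫ converges absolutely by Bessel's inequality. Summing over
i first is Parseval's identity; summing over n first gives the diagonal entries of A. -/
theorem Represents.hasSum_trace {A : E →L[ℂ] E} {a b : ℕ → E} (h : Represents a b A)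
    (hs : Summable fun n => ‖a n‖ * ‖b n‖) :
    HasSum (fun i => inner ℂ (basis E i) (A (basis E i))) (∑' n, inner ℂ (a n) (b n)) := by
  let e := basis E
  let g : ℕ × basisIndex E → ℂ := fun p => inner ℂ (a p.1) (e p.2) * inner ℂ (e p.2) (b p.1)
  have hn : ∀ n, Summable fun i => ‖g (n, i)‖ := fun n =>
    summable_of_sum_le (fun i => norm_nonneg _)
      fun s => sum_norm_inner_mul_inner_le e.orthonormal s (a n) (b n)
  have hg : Summable g := by
    refine Summable.of_norm ((summable_prod_of_nonneg fun p => norm_nonneg _).2 ⟨hn, ?_⟩)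
    refine Summable.of_nonneg_of_le (fun n => tsum_nonneg fun i => norm_nonneg _) (fun n => ?_) hs
    exact (hn n).tsum_le_of_sum_le
      fun s => sum_norm_inner_mul_inner_le e.orthonormal s (a n) (b n)
  have h1 : ∑' p, g p = ∑' n, inner ℂ (a n) (b n) := by
    rw [hg.tsum_prod]
    exact tsum_congr fun n => (e.hasSum_inner_mul_inner (a n) (b n)).tsum_eq
  have hg' : HasSum (fun p : basisIndex E × ℕ => g p.swap) (∑' p, g p) :=
    (Equiv.prodComm _ _).hasSum_iff.2 hg.hasSum
  rw [← h1]
  refine hg'.prod_fiberwise fun i => ?_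
  have := (h (e i)).mapL (innerSL ℂ (e i))
  simpa [g, inner_smul_right] using this

theorem Represents.trace_eq {A : E →L[ℂ] E} {a b : ℕ → E} (h : Represents a b A)
    (hs : Summable fun n => ‖a n‖ * ‖b n‖) : trace A = ∑' n, inner ℂ (a n) (b n) :=
  (h.hasSum_trace hs).tsum_eq

theorem IsTraceClass.hasSum_trace {A : E →L[ℂ] E} (hA : IsTraceClass A) :
    HasSum (fun i => inner ℂ (basis E i) (A (basis E i))) (trace A) := by
  obtain ⟨a, b, h, hs⟩ := hA.exists_represents
  rw [h.trace_eq hs]; exact h.hasSum_trace hs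

theorem trace_add {A B : E →L[ℂ] E} (hA : IsTraceClass A) (hB : IsTraceClass B) :
    trace (A + B) = trace A + trace B := by
  rw [← (hA.hasSum_trace.add hB.hasSum_trace).tsum_eq]
  simp [trace]

theorem trace_sub {A B : E →L[ℂ] E} (hA : IsTraceClass A) (hB : IsTraceClass B) :
    trace (A - B) = trace A - trace B := by
  rw [← (hA.hasSum_trace.sub hB.hasSum_trace).tsum_eq]
  simp [trace]

theorem trace_sum {ι : Type*} {s : Finset ι} {A : ι → E →L[ℂ] E}
    (hA : ∀ i ∈ s, IsTraceClass (A i)) : trace (∑ i ∈ s, A i) = ∑ i ∈ s, trace (A i) := by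
  classical
  induction s using Finset.induction_on with
  | empty => simp [trace]
  | insert i s hi ih =>
    rw [Finset.sum_insert hi, Finset.sum_insert hi, trace_add (hA i (by simp))
      (IsTraceClass.sum fun j hj => hA j (by simp [hj])), ih fun j hj => hA j (by simp [hj])]

theorem enorm_trace_le (A : E →L[ℂ] E) : ‖trace A‖ₑ ≤ traceNorm A := by
  refine le_traceNorm fun a b h => ?_
  by_cases hs : ∑' n, ‖a n‖ₑ * ‖b n‖ₑ = ∞
  · simp [hs]
  have hs' := summable_of_tsum_enorm_lt_top (lt_top_iff_ne_top.2 hs)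
  rw [h.trace_eq hs', ← ofReal_tsum_norm hs', ← ofReal_norm]
  exact ENNReal.ofReal_le_ofReal
    (tsum_of_norm_bounded hs'.hasSum fun n => norm_inner_le_norm _ _)

open ContinuousLinearMap in
-- An expansion of A expands B A when B is applied to bₙ, and A B when the adjoint of B is applied
-- to aₙ; both traces are Σ ⟪aₙ, B bₙ⟫.
theorem trace_comp_comm {A : E →L[ℂ] E} (hA : IsTraceClass A) (B : E →L[ℂ] E) :
    trace (A ∘L B) = trace (B ∘L A) := by
  obtain ⟨a, b, h, hs⟩ := hA.exists_represents
  have h1 : Represents a (fun n => B (b n)) (B ∘L A) := fun φ => by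
    simpa using (h φ).mapL B
  have h2 : Represents (fun n => adjoint B (a n)) b (A ∘L B) := fun φ => by
    simpa [adjoint_inner_left] using h (B φ)
  have s1 : Summable fun n => ‖a n‖ * ‖B (b n)‖ := by
    refine Summable.of_nonneg_of_le (fun n => by positivity) (fun n => ?_) (hs.mul_left ‖B‖)
    calc ‖a n‖ * ‖B (b n)‖ ≤ ‖a n‖ * (‖B‖ * ‖b n‖) := by gcongr; exact B.le_opNorm _
      _ = _ := by ring
  have s2 : Summable fun n => ‖adjoint B (a n)‖ * ‖b n‖ := by
    refine Summable.of_nonneg_of_le (fun n => by positivity) (fun n => ?_) (hs.mul_left ‖B‖)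
    calc ‖adjoint B (a n)‖ * ‖b n‖ ≤ (‖B‖ * ‖a n‖) * ‖b n‖ := by
          gcongr; simpa using (adjoint B).le_opNorm (a n)
      _ = _ := by ring
  rw [h1.trace_eq s1, h2.trace_eq s2]
  exact tsum_congr fun n => adjoint_inner_left _ _ _

theorem trace_rankOne (a b : E) :
    trace (InnerProductSpace.rankOne ℂ b a) = inner ℂ a b := by
  rw [← (basis E).tsum_inner_mul_inner a b, trace]
  exact tsum_congr fun i => by simp

end Complete

end TraceNorm

/-! ## The Fredholm determinant -/

section FredholmDet

open scoped ComplexOrder in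
-- The square of |det(1 + M)| is the product of the eigenvalues λ ≥ 0 of (1 + M)ᴴ(1 + M), and λ ≤
-- exp(λ - 1). The sum of the λ - 1 is 2 Re tr M plus the squared Frobenius norm, and the size of
-- the matrix cancels out.
theorem norm_det_one_add_le {n : Type*} [Fintype n] [DecidableEq n] (M : Matrix n n ℂ) :
    ‖(1 + M).det‖ ≤ Real.exp (‖M.trace‖ + (∑ i, ∑ j, ‖M i j‖ ^ 2) / 2) := by
  have hP : ((1 + M)ᴴ * (1 + M)).PosSemidef := Matrix.posSemidef_conjTranspose_mul_self _
  have hdet := hP.isHermitian.det_eq_prod_eigenvalues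
  have htr := hP.isHermitian.trace_eq_sum_eigenvalues
  set ev := hP.isHermitian.eigenvalues
  have h1 : ‖(1 + M).det‖ ^ 2 = ∏ i, ev i := by
    rw [Matrix.det_mul, Matrix.det_conjTranspose] at hdet
    have : ((‖(1 + M).det‖ ^ 2 : ℝ) : ℂ) = ((∏ i, ev i : ℝ) : ℂ) := by
      push_cast
      rw [← Complex.conj_mul']
      exact hdet
    exact_mod_cast this
  have h2 : ∑ i, (ev i - 1) ≤ 2 * ‖M.trace‖ + ∑ i, ∑ j, ‖M i j‖ ^ 2 := by
    have h3 : Matrix.trace (Mᴴ * M) = ((∑ i, ∑ j, ‖M i j‖ ^ 2 : ℝ) : ℂ) := by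
      rw [Finset.sum_comm]
      simp only [Matrix.trace, Matrix.diag, Matrix.mul_apply, Matrix.conjTranspose_apply]
      push_cast
      exact Finset.sum_congr rfl fun i _ => Finset.sum_congr rfl fun j _ => Complex.conj_mul' _
    have h4 : ((1 + M)ᴴ * (1 + M)) = 1 + Mᴴ + M + Mᴴ * M := by
      rw [Matrix.conjTranspose_add, Matrix.conjTranspose_one]; noncomm_ring
    rw [h4, Matrix.trace_add, Matrix.trace_add, Matrix.trace_add, h3, Matrix.trace_one,
      Matrix.trace_conjTranspose] at htr
    have h5 := congrArg Complex.re htr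
    simp only [Complex.add_re, Complex.natCast_re, Complex.ofReal_re, Complex.re_sum,
      RCLike.star_def, Complex.conj_re, Complex.coe_algebraMap] at h5
    have h6 := (le_abs_self _).trans (Complex.abs_re_le_norm M.trace)
    have h7 : ∑ i, (ev i : ℂ).re = ∑ i, ev i := rfl
    simp only [Finset.sum_sub_distrib, Finset.sum_const, Finset.card_univ, nsmul_eq_mul, mul_one]
    erw [h7] at h5
    linarith
  have h8 : ‖(1 + M).det‖ ^ 2 ≤
      Real.exp (‖M.trace‖ + (∑ i, ∑ j, ‖M i j‖ ^ 2) / 2) ^ 2 := by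
    rw [h1, ← Real.exp_nat_mul]
    calc ∏ i, ev i ≤ ∏ i, Real.exp (ev i - 1) :=
          Finset.prod_le_prod (fun i _ => hP.eigenvalues_nonneg i) fun i _ => by
            simpa using Real.add_one_le_exp (ev i - 1)
      _ = Real.exp (∑ i, (ev i - 1)) := (Real.exp_sum _ _).symm
      _ ≤ _ := Real.exp_le_exp.2 (by push_cast; linarith)
  exact le_of_sq_le_sq h8 (Real.exp_pos _).le

variable {E : Type*} [NormedAddCommGroup E] [InnerProductSpace ℂ E] [CompleteSpace E]

/-! ### Estimates that are uniform in the finite section -/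

/-- The matrix of an operator on the span of finitely many vectors of the fixed Hilbert basis. -/
def finSection (S : Finset (basisIndex E)) (A : E →L[ℂ] E) : Matrix S S ℂ :=
  Matrix.of fun i j : S => inner ℂ (basis E i.1) (A (basis E j.1))

theorem finSection_apply (S : Finset (basisIndex E)) (A : E →L[ℂ] E) (i j : S) :
    finSection S A i j = inner ℂ (basis E i.1) (A (basis E j.1)) := rfl

open Classical in
/-- The determinant of the finite section of `1 - A`. -/
def finDet (S : Finset (basisIndex E)) (A : E →L[ℂ] E) : ℂ := (1 - finSection S A).det

theorem fredholmDet_eq (A : E →L[ℂ] E) :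
    fredholmDet A = limUnder atTop fun S => finDet S A := rfl

theorem enorm_trace_finSection_le (S : Finset (basisIndex E)) (A : E →L[ℂ] E) :
    ‖(finSection S A).trace‖ₑ ≤ traceNorm A := by
  refine le_traceNorm fun a b h => ?_
  by_cases hs : ∑' n, ‖a n‖ₑ * ‖b n‖ₑ = ∞
  · simp [hs]
  have hs' := summable_of_tsum_enorm_lt_top (lt_top_iff_ne_top.2 hs)
  have h1 : HasSum (fun n => ∑ i : S, inner ℂ (a n) (basis E i.1) * inner ℂ (basis E i.1) (b n))
      (finSection S A).trace := by
    refine hasSum_sum fun i _ => ?_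
    have := (h (basis E i.1)).mapL (innerSL ℂ (basis E i.1))
    simpa [finSection_apply, inner_smul_right] using this
  rw [← ofReal_tsum_norm hs', ← ofReal_norm, ← h1.tsum_eq]
  refine ENNReal.ofReal_le_ofReal (tsum_of_norm_bounded hs'.hasSum fun n => ?_)
  refine (norm_sum_le _ _).trans ?_
  exact sum_norm_inner_mul_inner_le
    ((basis E).orthonormal.comp (fun i : S => i.1) Subtype.val_injective) Finset.univ (a n) (b n)

/-- By Bessel's inequality the section of one rank one term has Frobenius norm at most ‖aₙ‖ ‖bₙ‖;
the triangle inequality in the Euclidean space of matrices adds these up. -/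
theorem frobenius_finSection_le (S : Finset (basisIndex E)) (A : E →L[ℂ] E) :
    ENNReal.ofReal √(∑ i, ∑ j, ‖finSection S A i j‖ ^ 2) ≤ traceNorm A := by
  refine le_traceNorm fun a b h => ?_
  by_cases hs : ∑' n, ‖a n‖ₑ * ‖b n‖ₑ = ∞
  · simp [hs]
  have hs' := summable_of_tsum_enorm_lt_top (lt_top_iff_ne_top.2 hs)
  let e : S → E := fun i => basis E i.1
  have he : Orthonormal ℂ e := (basis E).orthonormal.comp (fun i : S => i.1) Subtype.val_injective
  let v : ℕ → EuclideanSpace ℂ (S × S) := fun n =>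
    WithLp.toLp 2 fun p => inner ℂ (a n) (e p.2) * inner ℂ (e p.1) (b n)
  have hv : ∀ n, ‖v n‖ ≤ ‖a n‖ * ‖b n‖ := by
    intro n
    rw [EuclideanSpace.norm_eq, ← Real.sqrt_sq (mul_nonneg (norm_nonneg (a n)) (norm_nonneg (b n)))]
    refine Real.sqrt_le_sqrt ?_
    have h1 : ∑ p : S × S, ‖v n p‖ ^ 2 =
        (∑ i, ‖inner ℂ (e i) (b n)‖ ^ 2) * ∑ j, ‖inner ℂ (e j) (a n)‖ ^ 2 := by
      rw [Fintype.sum_prod_type, Finset.sum_mul_sum]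
      refine Finset.sum_congr rfl fun i _ => Finset.sum_congr rfl fun j _ => ?_
      simp only [v, norm_mul, mul_pow]
      rw [norm_inner_symm (a n), mul_comm]
    rw [h1, mul_pow, mul_comm]
    gcongr
    · exact he.sum_inner_products_le (a n)
    · exact he.sum_inner_products_le (b n)
  have hsum : Summable v := Summable.of_norm_bounded hs' hv
  have h2 : ∀ i j, finSection S A i j = (∑' n, v n) (i, j) := by
    intro i j
    have h3 := hsum.hasSum.mapL (EuclideanSpace.proj (i, j) : EuclideanSpace ℂ (S × S) →L[ℂ] ℂ)
    have h4 := (h (e j)).mapL (innerSL ℂ (e i))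
    simp only [innerSL_apply_apply, inner_smul_right] at h4
    exact h4.unique h3
  have h3 : √(∑ i, ∑ j, ‖finSection S A i j‖ ^ 2) = ‖∑' n, v n‖ := by
    rw [EuclideanSpace.norm_eq, Fintype.sum_prod_type]
    simp only [h2]
  rw [h3, ← ofReal_tsum_norm hs']
  exact ENNReal.ofReal_le_ofReal (tsum_of_norm_bounded hs'.hasSum hv)

theorem norm_finDet_le (S : Finset (basisIndex E)) {A : E →L[ℂ] E} {r : ℝ} (hr : 0 ≤ r)
    (hA : traceNorm A ≤ ENNReal.ofReal r) : ‖finDet S A‖ ≤ Real.exp (r + r ^ 2 / 2) := by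
  classical
  have h1 : ‖(-finSection S A).trace‖ ≤ r := by
    rw [Matrix.trace_neg, norm_neg]
    have := (enorm_trace_finSection_le S A).trans hA
    rwa [← ofReal_norm, ENNReal.ofReal_le_ofReal_iff hr] at this
  have h2 : ∑ i, ∑ j, ‖(-finSection S A) i j‖ ^ 2 ≤ r ^ 2 := by
    simp only [Matrix.neg_apply, norm_neg]
    have := (frobenius_finSection_le S A).trans hA
    rw [ENNReal.ofReal_le_ofReal_iff hr] at this
    exact (Real.sqrt_le_left hr).1 this
  have h3 := norm_det_one_add_le (-finSection S A)
  have h4 : finDet S A = (1 + -finSection S A).det := by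
    rw [← sub_eq_add_neg, finDet]
  rw [h4]
  exact h3.trans (Real.exp_le_exp.2 (by linarith))

/-- A Lipschitz constant of Fredholm determinants on the ball of radius `r`. -/
def detLip (r : ℝ) : ℝ := 2 * Real.exp (r + 1 + (r + 1) ^ 2 / 2) + 1

theorem detLip_pos (r : ℝ) : 0 < detLip r := by unfold detLip; positivity

/-- Schwarz lemma on the complex line A + z (B - A): for |z| < 1/ε the perturbation has trace norm
at most 1, so the polynomial z ↦ det is bounded on a disk of radius 1/ε, and the points 0 and 1 are
close relative to that radius. -/
theorem norm_finDet_sub_le (S : Finset (basisIndex E)) {A B : E →L[ℂ] E} {r ε : ℝ} (hr : 0 ≤ r)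
    (hε : 0 < ε) (hε1 : ε < 1) (hA : traceNorm A ≤ ENNReal.ofReal r)
    (hB : traceNorm (B - A) ≤ ENNReal.ofReal ε) :
    ‖finDet S B - finDet S A‖ ≤ detLip r * ε := by
  classical
  let f : ℂ → ℂ := fun z => finDet S (A + z • (B - A))
  have hf : ∀ z, f z = (1 - (finSection S A + z • finSection S (B - A))).det := by
    intro z
    simp only [f, finDet]
    congr 2
    · ext i j
      simp [finSection_apply]
  have hd : Differentiable ℂ f := by
    have : f = fun z => (1 - (finSection S A + z • finSection S (B - A))).det := funext hf
    rw [this]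
    simp only [Matrix.det_apply, Matrix.sub_apply, Matrix.add_apply, Matrix.smul_apply]
    fun_prop
  have hb : ∀ z ∈ Metric.ball (0 : ℂ) (1 / ε), ‖f z‖ ≤ Real.exp (r + 1 + (r + 1) ^ 2 / 2) := by
    intro z hz
    refine norm_finDet_le S (by linarith) ?_
    refine (traceNorm_add_le _ _).trans ?_
    rw [ENNReal.ofReal_add hr zero_le_one]
    refine add_le_add hA ((traceNorm_smul_le _ _).trans ?_)
    rw [mem_ball_zero_iff] at hz
    calc ‖z‖ₑ * traceNorm (B - A) ≤ ENNReal.ofReal (1 / ε) * ENNReal.ofReal ε := by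
          rw [← ofReal_norm]
          gcongr
      _ = ENNReal.ofReal 1 := by
          rw [← ENNReal.ofReal_mul (by positivity), one_div_mul_cancel hε.ne']
  have h0 : (0 : ℂ) ∈ Metric.ball (0 : ℂ) (1 / ε) := Metric.mem_ball_self (by positivity)
  have h1 : (1 : ℂ) ∈ Metric.ball (0 : ℂ) (1 / ε) := by
    rw [mem_ball_zero_iff, norm_one, lt_div_iff₀ hε]; linarith
  -- The factor 2 in `detLip` pays for f z and f 0, the summand 1 for the open ball.
  have hm : Set.MapsTo f (Metric.ball 0 (1 / ε)) (Metric.ball (f 0) (detLip r)) := by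
    intro z hz
    rw [mem_ball_iff_norm]
    have := (norm_sub_le (f z) (f 0)).trans (add_le_add (hb z hz) (hb 0 h0))
    unfold detLip; linarith
  have key := Complex.dist_le_div_mul_dist_of_mapsTo_ball hd.differentiableOn
    (hm.mono_right Metric.ball_subset_closedBall) h1
  have e0 : f 0 = finDet S A := by simp [f]
  have e1 : f 1 = finDet S B := by simp [f]
  rw [e0, e1, dist_eq_norm, dist_zero_right, norm_one, mul_one, div_div_eq_mul_div, div_one] at key
  exact key

/-! ### Finite rank operators and the limit of the finite sections -/

/-- A finite rank operator. -/
def finRank {N : ℕ} (a b : Fin N → E) : E →L[ℂ] E :=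
  ∑ n, InnerProductSpace.rankOne ℂ (b n) (a n)

omit [CompleteSpace E] in
theorem isTraceClass_finRank {N : ℕ} (a b : Fin N → E) : IsTraceClass (finRank a b) :=
  IsTraceClass.sum fun n _ => isTraceClass_rankOne (a n) (b n)

/-- The matrix whose entries are inner products. -/
def crossGram {N : ℕ} (a b : Fin N → E) : Matrix (Fin N) (Fin N) ℂ :=
  Matrix.of fun m n => inner ℂ (a m) (b n)

theorem trace_finRank {N : ℕ} (a b : Fin N → E) : trace (finRank a b) = (crossGram a b).trace := by
  rw [finRank, trace_sum fun n _ => isTraceClass_rankOne (a n) (b n)]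
  exact Finset.sum_congr rfl fun n _ => trace_rankOne (a n) (b n)

/-- By det(1 - X Y) = det(1 - Y X) the section determinant becomes one of fixed size N, whose
entries converge by Parseval's identity. -/
theorem tendsto_finDet_finRank {N : ℕ} (a b : Fin N → E) :
    Tendsto (fun S => finDet S (finRank a b)) atTop (𝓝 (1 - crossGram a b).det) := by
  classical
  let X : (S : Finset (basisIndex E)) → Matrix S (Fin N) ℂ := fun S =>
    Matrix.of fun i n => inner ℂ (basis E i.1) (b n)
  let Y : (S : Finset (basisIndex E)) → Matrix (Fin N) S ℂ := fun S =>
    Matrix.of fun n j => inner ℂ (a n) (basis E j.1)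
  have h1 : ∀ S, finDet S (finRank a b) = (1 - Y S * X S).det := by
    intro S
    rw [← Matrix.det_one_sub_mul_comm, finDet]
    congr 2
    · ext i j
      simp [finSection_apply, finRank, X, Y, Matrix.mul_apply, mul_comm]
  simp only [h1]
  have hc : Continuous fun M : Matrix (Fin N) (Fin N) ℂ => (1 - M).det :=
    (continuous_const.sub continuous_id).matrix_det
  refine (hc.tendsto _).comp ?_
  refine tendsto_pi_nhds.2 fun m => tendsto_pi_nhds.2 fun n => ?_
  have h2 : ∀ S, (Y S * X S) m n =
      ∑ i ∈ S, inner ℂ (a m) (basis E i) * inner ℂ (basis E i) (b n) := by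
    intro S
    rw [Matrix.mul_apply]
    exact Finset.sum_coe_sort S (fun i => inner ℂ (a m) (basis E i) * inner ℂ (basis E i) (b n))
  simp only [h2]
  exact (basis E).hasSum_inner_mul_inner (a m) (b n)

omit [CompleteSpace E] in
theorem Represents.sub_finRank {A : E →L[ℂ] E} {a b : ℕ → E} (h : Represents a b A) (N : ℕ) :
    Represents (fun n => a (n + N)) (fun n => b (n + N))
      (A - finRank (fun n : Fin N => a n.1) fun n : Fin N => b n.1) := by
  intro φ
  have h1 : (A - finRank (fun n : Fin N => a n.1) fun n : Fin N => b n.1) φ +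
      ∑ i ∈ Finset.range N, inner ℂ (a i) φ • b i = A φ := by
    rw [Finset.sum_range]
    simp [finRank]
  have h2 := (hasSum_nat_add_iff (f := fun n => inner ℂ (a n) φ • b n) N).2 (h1 ▸ h φ)
  exact h2

omit [CompleteSpace E] in
theorem IsTraceClass.exists_finRank {A : E →L[ℂ] E} (hA : IsTraceClass A) {ε : ℝ} (hε : 0 < ε) :
    ∃ (N : ℕ) (a b : Fin N → E), traceNorm (A - finRank a b) ≤ ENNReal.ofReal ε := by
  obtain ⟨a, b, h, hs⟩ := hA.exists_represents
  have ht := tendsto_sum_nat_add fun n => ‖a n‖ * ‖b n‖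
  obtain ⟨N, hN⟩ := (ht.eventually (gt_mem_nhds hε)).exists
  refine ⟨N, fun n => a n.1, fun n => b n.1, (h.sub_finRank N).traceNorm_le.trans ?_⟩
  have hs' : Summable fun n => ‖a (n + N)‖ * ‖b (n + N)‖ :=
    (summable_nat_add_iff (f := fun n => ‖a n‖ * ‖b n‖) N).2 hs
  have h3 := ofReal_tsum_norm (a := fun n => a (n + N)) (b := fun n => b (n + N)) hs'
  exact h3.symm.le.trans (ENNReal.ofReal_le_ofReal hN.le)

theorem IsTraceClass.tendsto_finDet {A : E →L[ℂ] E} (hA : IsTraceClass A) :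
    Tendsto (fun S => finDet S A) atTop (𝓝 (fredholmDet A)) := by
  classical
  rw [fredholmDet_eq]
  refine tendsto_nhds_limUnder (cauchySeq_tendsto_of_complete ?_)
  rw [Metric.cauchySeq_iff']
  intro ε hε
  set r := (traceNorm A).toReal
  have hr : traceNorm A ≤ ENNReal.ofReal r := (ENNReal.ofReal_toReal hA.ne).ge
  have hL := detLip_pos r
  set δ := min (1 / 2) (ε / (4 * detLip r))
  have hδ : 0 < δ := by positivity
  have hδ1 : δ < 1 := (min_le_left _ _).trans_lt (by norm_num)
  have hδ2 : detLip r * δ ≤ ε / 4 := by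
    calc detLip r * δ ≤ detLip r * (ε / (4 * detLip r)) := by gcongr; exact min_le_right _ _
      _ = ε / 4 := by field_simp
  obtain ⟨N, a, b, hF⟩ := hA.exists_finRank hδ
  have hF' : traceNorm (finRank a b - A) ≤ ENNReal.ofReal δ := by
    rwa [← traceNorm_neg, neg_sub]
  -- Since the Lipschitz constant does not depend on S, the Cauchy property passes from the finite
  -- rank approximation to A at a cost of ε/4 for each of S and S₀.
  have key : ∀ S, ‖finDet S (finRank a b) - finDet S A‖ ≤ ε / 4 := fun S =>
    (norm_finDet_sub_le S ENNReal.toReal_nonneg hδ hδ1 hr hF').trans hδ2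
  have hc := (tendsto_finDet_finRank a b).cauchySeq
  obtain ⟨S₀, hS₀⟩ := Metric.cauchySeq_iff'.1 hc (ε / 4) (by positivity)
  refine ⟨S₀, fun S hS => ?_⟩
  have h1 := hS₀ S hS
  have h2 := key S
  have h3 := key S₀
  rw [dist_eq_norm] at h1 ⊢
  calc ‖finDet S A - finDet S₀ A‖
      = ‖-(finDet S (finRank a b) - finDet S A) + (finDet S (finRank a b) -
          finDet S₀ (finRank a b)) + (finDet S₀ (finRank a b) - finDet S₀ A)‖ := by
        congr 1; ring
    _ ≤ ‖finDet S (finRank a b) - finDet S A‖ + ‖finDet S (finRank a b) -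
          finDet S₀ (finRank a b)‖ + ‖finDet S₀ (finRank a b) - finDet S₀ A‖ := by
        refine (norm_add_le _ _).trans (add_le_add_left ((norm_add_le _ _).trans ?_) _)
        rw [norm_neg]
    _ < ε := by linarith

theorem fredholmDet_finRank {N : ℕ} (a b : Fin N → E) :
    fredholmDet (finRank a b) = (1 - crossGram a b).det :=
  tendsto_nhds_unique (isTraceClass_finRank a b).tendsto_finDet (tendsto_finDet_finRank a b)

theorem fredholmDet_zero : fredholmDet (0 : E →L[ℂ] E) = 1 := by
  have := fredholmDet_finRank (E := E) (N := 0) Fin.elim0 Fin.elim0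
  simpa [finRank] using this

theorem norm_fredholmDet_sub_le {A B : E →L[ℂ] E} {r ε : ℝ} (hr : 0 ≤ r)
    (hε : 0 < ε) (hε1 : ε < 1) (hA : traceNorm A ≤ ENNReal.ofReal r)
    (hB : traceNorm (B - A) ≤ ENNReal.ofReal ε) :
    ‖fredholmDet B - fredholmDet A‖ ≤ detLip r * ε := by
  have hA' : IsTraceClass A := hA.trans_lt ENNReal.ofReal_lt_top
  have hB' : IsTraceClass B := by
    have h : IsTraceClass (B - A) := hB.trans_lt ENNReal.ofReal_lt_top
    simpa using h.add hA'
  exact le_of_tendsto (hB'.tendsto_finDet.sub hA'.tendsto_finDet).norm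
    (Eventually.of_forall fun S => norm_finDet_sub_le S hr hε hε1 hA hB)

/-! ### Multiplicativity and non-vanishing of the determinant -/

/-- The orthogonal projection onto the span of finitely many vectors of the fixed basis. -/
def basisProj (S : Finset (basisIndex E)) : E →L[ℂ] E :=
  ∑ i ∈ S, InnerProductSpace.rankOne ℂ (basis E i) (basis E i)

theorem basisProj_apply (S : Finset (basisIndex E)) (φ : E) :
    basisProj S φ = ∑ i ∈ S, inner ℂ (basis E i) φ • basis E i := by
  simp [basisProj]

theorem norm_basisProj_le (S : Finset (basisIndex E)) : ‖basisProj S‖ ≤ 1 := by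
  refine ContinuousLinearMap.opNorm_le_bound _ zero_le_one fun φ => ?_
  rw [one_mul, basisProj_apply]
  refine le_of_sq_le_sq ?_ (norm_nonneg φ)
  refine le_trans (le_of_eq ?_) ((basis E).orthonormal.sum_inner_products_le φ (s := S))
  have h := (basis E).orthonormal.inner_sum (fun i => inner ℂ (basis E i) φ)
    (fun i => inner ℂ (basis E i) φ) S
  rw [inner_self_eq_norm_sq_to_K] at h
  simp only [RCLike.conj_mul] at h
  exact_mod_cast h

theorem tendsto_basisProj (φ : E) : Tendsto (fun S => basisProj S φ) atTop (𝓝 φ) := by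
  simp only [basisProj_apply]
  simpa [HasSum, HilbertBasis.repr_apply_apply] using (basis E).hasSum_repr φ

/-- Inserting the projection makes the section of A P B exactly the product of the sections of A and
B; in `fredholmDet_mul` the projection disappears in the limit, in trace norm. -/
theorem finDet_mul (S : Finset (basisIndex E)) (A B : E →L[ℂ] E) :
    finDet S A * finDet S B = finDet S (A + B - A ∘L basisProj S ∘L B) := by
  classical
  have h : finSection S (A + B - A ∘L basisProj S ∘L B) =
      finSection S A + finSection S B - finSection S A * finSection S B := by
    ext i j
    simp only [finSection_apply, Matrix.sub_apply, Matrix.add_apply, Matrix.mul_apply,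
      sub_apply, add_apply, ContinuousLinearMap.comp_apply,
      basisProj_apply, map_sum, map_smul, inner_sub_right, inner_add_right, inner_sum,
      inner_smul_right]
    congr 1
    rw [← Finset.sum_coe_sort S]
    exact Finset.sum_congr rfl fun k _ => mul_comm _ _
  rw [finDet, finDet, finDet, ← Matrix.det_mul, h]
  congr 1
  noncomm_ring

theorem fredholmDet_mul {A B : E →L[ℂ] E} (hA : IsTraceClass A) (hB : IsTraceClass B) :
    fredholmDet A * fredholmDet B = fredholmDet (A + B - A ∘L B) := by
  have hC : IsTraceClass (A + B - A ∘L B) := (hA.add hB).sub (hA.comp_right B)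
  have h1 := hA.tendsto_finDet.mul hB.tendsto_finDet
  simp only [finDet_mul] at h1
  refine tendsto_nhds_unique h1 ?_
  have h2 : Tendsto (fun S => traceNorm ((A + B - A ∘L basisProj S ∘L B) - (A + B - A ∘L B)))
      atTop (𝓝 0) := by
    have h3 : ∀ S, (A + B - A ∘L basisProj S ∘L B) - (A + B - A ∘L B) =
        A ∘L ((ContinuousLinearMap.id ℂ E - basisProj S) ∘L B) := fun S => by
      ext φ; simp
    simp only [h3]
    have h4 := hB.tendsto_traceNorm_comp
      (T := fun S : Finset (basisIndex E) => ContinuousLinearMap.id ℂ E - basisProj S) (C := 2)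
      (l := atTop) (Eventually.of_forall fun S => (norm_sub_le _ _).trans (by
        have := ContinuousLinearMap.norm_id_le (𝕜 := ℂ) (E := E)
        have := norm_basisProj_le S
        linarith)) fun φ => by
        have := (tendsto_basisProj φ).const_sub φ
        simpa using this
    have h5 := ENNReal.Tendsto.const_mul h4 (Or.inr (enorm_ne_top : ‖A‖ₑ ≠ ∞))
    rw [mul_zero] at h5
    exact tendsto_of_tendsto_of_tendsto_of_le_of_le tendsto_const_nhds h5 (fun _ => zero_le)
      fun S => traceNorm_comp_le _ _
  set r := (traceNorm (A + B - A ∘L B)).toReal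
  have hr : traceNorm (A + B - A ∘L B) ≤ ENNReal.ofReal r := (ENNReal.ofReal_toReal hC.ne).ge
  have hL := detLip_pos r
  rw [← tendsto_sub_nhds_zero_iff]
  have h6 : Tendsto (fun S => finDet S (A + B - A ∘L basisProj S ∘L B) -
      finDet S (A + B - A ∘L B)) atTop (𝓝 0) := by
    rw [Metric.tendsto_nhds]
    intro ε hε
    have hδ : 0 < min (1 / 2) (ε / (2 * detLip r)) := by positivity
    filter_upwards [h2.eventually (gt_mem_nhds (ENNReal.ofReal_pos.2 hδ))] with S hS
    rw [dist_zero_right]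
    refine (norm_finDet_sub_le S ENNReal.toReal_nonneg hδ
      ((min_le_left _ _).trans_lt (by norm_num)) hr hS.le).trans_lt ?_
    calc detLip r * min (1 / 2) (ε / (2 * detLip r)) ≤ detLip r * (ε / (2 * detLip r)) := by
          gcongr; exact min_le_right _ _
      _ = ε / 2 := by field_simp
      _ < ε := by linarith
  have h7 := h6.add (hC.tendsto_finDet.sub_const (fredholmDet (A + B - A ∘L B)))
  simpa using h7

theorem fredholmDet_ne_zero {A : E →L[ℂ] E} (hA : IsTraceClass A) (hu : IsUnit (1 - A)) :
    fredholmDet A ≠ 0 := by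
  have h1 : (1 - A) * Ring.inverse (1 - A) = 1 := Ring.mul_inverse_cancel _ hu
  set R := Ring.inverse (1 - A)
  -- The inverse of 1 - A is 1 + A R, so -(A R) is the operator whose determinant is the reciprocal.
  have hB : IsTraceClass (-(A * R)) := by
    have : IsTraceClass ((-1 : ℂ) • (A ∘L R)) := (hA.comp_right R).smul _
    rwa [neg_one_smul] at this
  have h2 := fredholmDet_mul hA hB
  have h3 : A + -(A * R) - A ∘L (-(A * R)) = 0 := by
    change A + -(A * R) - A * (-(A * R)) = 0
    have : A * ((1 - A) * R) = A := by rw [h1, mul_one]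
    rw [← sub_eq_zero] at this
    rw [← neg_eq_zero, ← this]
    noncomm_ring
  rw [h3, fredholmDet_zero] at h2
  exact left_ne_zero_of_mul (h2 ▸ one_ne_zero)

/-! ### Derivative of the Fredholm determinant -/

theorem tendsto_fredholmDet_smul_finRank {N : ℕ} (a b : Fin N → E) :
    Tendsto (fun h : ℝ => (h : ℂ)⁻¹ * (fredholmDet ((h : ℂ) • finRank a b) - 1)) (𝓝[≠] 0)
      (𝓝 (-trace (finRank a b))) := by
  have h1 : ∀ h : ℝ, fredholmDet ((h : ℂ) • finRank a b) =
      (1 + (h : ℂ) • (-crossGram a b)).det := by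
    intro h
    have : (h : ℂ) • finRank a b = finRank a fun n => (h : ℂ) • b n := by
      ext φ
      simp only [finRank, smul_apply, sum_apply,
        InnerProductSpace.rankOne_apply, Finset.smul_sum]
      exact Finset.sum_congr rfl fun n _ => smul_comm _ _ _
    rw [this, fredholmDet_finRank, smul_neg, ← sub_eq_add_neg]
    congr 2
    ext m n
    simp [crossGram]
  simp_rw [h1]
  have h1' := fun h : ℝ => Matrix.det_one_add_smul (h : ℂ) (-crossGram a b)
  simp_rw [h1']
  clear h1 h1'
  rw [trace_finRank, ← Matrix.trace_neg]
  set M := -crossGram a b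
  -- The polynomial p is the remainder in det(1 + h M) = 1 + h tr M + h² p(h).
  set p := Polynomial.divX (Polynomial.divX (Matrix.det (1 + (Polynomial.X : Polynomial ℂ) •
    M.map Polynomial.C)))
  have h2 : Tendsto (fun h : ℝ => M.trace + p.eval (h : ℂ) * (h : ℂ)) (𝓝[≠] 0)
      (𝓝 (M.trace + p.eval ((0 : ℝ) : ℂ) * ((0 : ℝ) : ℂ))) := by
    refine (Continuous.tendsto ?_ (0 : ℝ)).mono_left nhdsWithin_le_nhds
    have := p.continuous
    fun_prop
  simp only [Complex.ofReal_zero, mul_zero, add_zero] at h2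
  refine h2.congr' ?_
  filter_upwards [self_mem_nhdsWithin] with h hh
  have : (h : ℂ) ≠ 0 := by exact_mod_cast hh
  field_simp
  ring

/-- The derivative of the Fredholm determinant at the identity. -/
theorem tendsto_fredholmDet_sub_one {B : ℝ → E →L[ℂ] E} {B' : E →L[ℂ] E}
    (hB' : IsTraceClass B')
    (h : Tendsto (fun h : ℝ => traceNorm ((h : ℂ)⁻¹ • B h - B')) (𝓝[≠] 0) (𝓝 0)) :
    Tendsto (fun h : ℝ => (h : ℂ)⁻¹ * (fredholmDet (B h) - 1)) (𝓝[≠] 0) (𝓝 (-trace B')) := by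
  rw [Metric.tendsto_nhds]
  intro ε hε
  have hL := detLip_pos 1
  -- With F of finite rank, the error is 2δ · `detLip 1` for replacing B h by h F, δ for the
  -- derivative at F and δ for the trace of B' - F; taking 3 rather than 2 makes the total strictly
  -- less than ε.
  set δ := ε / (2 * detLip 1 + 3)
  have hδ : 0 < δ := by positivity
  obtain ⟨N, a, b, hF⟩ := hB'.exists_finRank hδ
  have hFt := isTraceClass_finRank a b
  have htr : ‖trace B' - trace (finRank a b)‖ ≤ δ := by
    rw [← trace_sub hB' hFt]
    have := (enorm_trace_le (B' - finRank a b)).trans hF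
    rwa [← ofReal_norm, ENNReal.ofReal_le_ofReal_iff hδ.le] at this
  have e1 := (Metric.tendsto_nhds.1 (tendsto_fredholmDet_smul_finRank a b)) δ hδ
  have e2 := h.eventually (gt_mem_nhds (ENNReal.ofReal_pos.2 hδ))
  set ρ := (traceNorm (finRank a b)).toReal
  have hρ : traceNorm (finRank a b) = ENNReal.ofReal ρ := (ENNReal.ofReal_toReal hFt.ne).symm
  have hρ0 : 0 ≤ ρ := ENNReal.toReal_nonneg
  -- This keeps h F in the unit ball, where the Lipschitz constant is `detLip 1`, and makes the
  -- perturbation bound 2δ|h| less than 1.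
  have e3 : ∀ᶠ h : ℝ in 𝓝[≠] 0, |h| < 1 / (ρ + 2 * δ + 1) := by
    refine nhdsWithin_le_nhds ?_
    have := (continuous_abs : Continuous fun x : ℝ => |x|).tendsto 0
    rw [abs_zero] at this
    exact this.eventually (gt_mem_nhds (by positivity))
  filter_upwards [e1, e2, e3, self_mem_nhdsWithin] with t h1 h2 h3 ht
  have ht0 : (t : ℂ) ≠ 0 := by exact_mod_cast ht
  have htn : 0 < |t| := abs_pos.2 ht
  have h3' : |t| * (ρ + 2 * δ + 1) < 1 := by rwa [lt_div_iff₀ (by positivity)] at h3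
  have k1 : traceNorm ((t : ℂ) • finRank a b) ≤ ENNReal.ofReal 1 := by
    refine (traceNorm_smul_le _ _).trans ?_
    rw [hρ, ← ofReal_norm, ← ENNReal.ofReal_mul (norm_nonneg _), Complex.norm_real,
      Real.norm_eq_abs]
    refine ENNReal.ofReal_le_ofReal ?_
    nlinarith
  have k2 : traceNorm (B t - (t : ℂ) • finRank a b) ≤ ENNReal.ofReal (|t| * (2 * δ)) := by
    have : B t - (t : ℂ) • finRank a b =
        (t : ℂ) • (((t : ℂ)⁻¹ • B t - B') + (B' - finRank a b)) := by
      rw [sub_add_sub_cancel, smul_sub, smul_smul, mul_inv_cancel₀ ht0, one_smul]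
    rw [this]
    refine (traceNorm_smul_le _ _).trans ?_
    rw [ENNReal.ofReal_mul (abs_nonneg _), ← ofReal_norm, Complex.norm_real, Real.norm_eq_abs]
    gcongr
    rw [two_mul, ENNReal.ofReal_add hδ.le hδ.le]
    exact (traceNorm_add_le _ _).trans (add_le_add h2.le hF)
  have k3 := norm_fredholmDet_sub_le zero_le_one (by positivity) (by nlinarith) k1 k2
  rw [dist_eq_norm] at h1 ⊢
  have k4 : (t : ℂ)⁻¹ * (fredholmDet (B t) - 1) - -trace B' =
      (t : ℂ)⁻¹ * (fredholmDet (B t) - fredholmDet ((t : ℂ) • finRank a b)) +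
      ((t : ℂ)⁻¹ * (fredholmDet ((t : ℂ) • finRank a b) - 1) - -trace (finRank a b)) +
      (trace B' - trace (finRank a b)) := by ring
  rw [k4]
  have k5 : ‖(t : ℂ)⁻¹ * (fredholmDet (B t) - fredholmDet ((t : ℂ) • finRank a b))‖ ≤
      detLip 1 * (2 * δ) := by
    rw [norm_mul, norm_inv, Complex.norm_real, Real.norm_eq_abs, inv_mul_le_iff₀ htn]
    linarith
  calc _ ≤ detLip 1 * (2 * δ) + δ + δ :=
        (norm_add_le _ _).trans (add_le_add ((norm_add_le _ _).trans (add_le_add k5 h1.le)) htr)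
    _ < (2 * detLip 1 + 3) * δ := by nlinarith
    _ = ε := by simp only [δ]; field_simp

/-- Jacobi's formula for Fredholm determinants. -/
theorem hasDerivAt_fredholmDet {A : ℝ → E →L[ℂ] E} {A' : E →L[ℂ] E} {s₀ : ℝ}
    (hA : ∀ᶠ s in 𝓝 s₀, IsTraceClass (A s)) (hA' : IsTraceClass A') (hu : IsUnit (1 - A s₀))
    (h : Tendsto (fun h : ℝ => traceNorm ((h : ℂ)⁻¹ • (A (s₀ + h) - A s₀) - A')) (𝓝[≠] 0) (𝓝 0)) :
    HasDerivAt (fun s => fredholmDet (A s))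
      (fredholmDet (A s₀) * -trace (Ring.inverse (1 - A s₀) ∘L A')) s₀ := by
  have h1 : (1 - A s₀) * Ring.inverse (1 - A s₀) = 1 := Ring.mul_inverse_cancel _ hu
  set R := Ring.inverse (1 - A s₀)
  have h0 : IsTraceClass (A s₀) := hA.self_of_nhds
  have h2 : Tendsto (fun h : ℝ => traceNorm ((h : ℂ)⁻¹ • (R ∘L (A (s₀ + h) - A s₀)) - R ∘L A'))
      (𝓝[≠] 0) (𝓝 0) := by
    have h5 := ENNReal.Tendsto.const_mul h (Or.inr (enorm_ne_top : ‖R‖ₑ ≠ ∞))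
    rw [mul_zero] at h5
    refine tendsto_of_tendsto_of_tendsto_of_le_of_le tendsto_const_nhds h5 (fun _ => zero_le)
      fun t => ?_
    have : (t : ℂ)⁻¹ • (R ∘L (A (s₀ + t) - A s₀)) - R ∘L A' =
        R ∘L ((t : ℂ)⁻¹ • (A (s₀ + t) - A s₀) - A') := by
      ext φ; simp
    rw [this]
    exact traceNorm_comp_le _ _
  have h3 := tendsto_fredholmDet_sub_one (hA'.comp_left R) h2
  rw [hasDerivAt_iff_tendsto_slope_zero]
  refine (h3.const_mul (fredholmDet (A s₀))).congr' ?_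
  have h4 : ∀ᶠ t : ℝ in 𝓝[≠] 0, IsTraceClass (A (s₀ + t)) := by
    refine nhdsWithin_le_nhds ?_
    have : Tendsto (fun t : ℝ => s₀ + t) (𝓝 0) (𝓝 s₀) := by
      have h : Continuous fun t : ℝ => s₀ + t := by fun_prop
      simpa using h.tendsto 0
    exact this.eventually hA
  filter_upwards [h4] with t ht
  have h5 := fredholmDet_mul h0 ((ht.sub h0).comp_left R)
  -- This is the factorization 1 - A(s₀ + t) = (1 - A(s₀)) (1 - R (A(s₀ + t) - A(s₀))), which moves
  -- the base point to the identity.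
  have h6 : A s₀ + R ∘L (A (s₀ + t) - A s₀) - A s₀ ∘L (R ∘L (A (s₀ + t) - A s₀)) =
      A (s₀ + t) := by
    have : ((1 - A s₀) * R) * (A (s₀ + t) - A s₀) = A (s₀ + t) - A s₀ := by rw [h1, one_mul]
    change A s₀ + R * (A (s₀ + t) - A s₀) - A s₀ * (R * (A (s₀ + t) - A s₀)) = A (s₀ + t)
    calc _ = A s₀ + ((1 - A s₀) * R) * (A (s₀ + t) - A s₀) := by noncomm_ring
      _ = _ := by rw [this]; abel
  rw [h6] at h5
  rw [← h5, Complex.real_smul, Complex.ofReal_inv]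
  ring

end FredholmDet

/-! ## The measure and the phase of a domain -/

theorem Contour.measurableSet_dom (C : Contour) : MeasurableSet C.dom := by
  rcases C.simple with ⟨h, -, -⟩ | ⟨L, -, h, -, -⟩
  · rw [h]; exact MeasurableSet.univ
  · rw [h]; exact measurableSet_Ico

theorem Contour.injOn (C : Contour) : Set.InjOn C.γ C.dom := by
  rcases C.simple with ⟨-, h, -⟩ | ⟨L, -, h, -, h'⟩
  · exact h.injOn
  · rw [h]; exact h'

/-- Lusin–Souslin: an injective measurable map out of a standard Borel space. It transports almost
everywhere statements between Ω and the parameter line. -/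
theorem Contour.measurableEmbedding (C : Contour) :
    MeasurableEmbedding fun s : C.dom => C.γ s :=
  have := C.measurableSet_dom.standardBorel
  (C.lipschitz.continuous.measurable.comp measurable_subtype_coe).measurableEmbedding
    fun s t h => Subtype.ext (C.injOn s.2 t.2 h)

theorem Contour.map_eq (C : Contour) :
    (volume.restrict C.dom).map C.γ =
      (Measure.comap (Subtype.val : C.dom → ℝ) volume).map fun s : C.dom => C.γ s := by
  rw [← map_comap_subtype_coe C.measurableSet_dom,
    Measure.map_map C.lipschitz.continuous.measurable measurable_subtype_coe]
  rfl

namespace Domain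

/-- The choice made in `phase` is forced: disjointness determines the contour and injectivity on
`dom` the parameter. -/
theorem phase_contours {n : ℕ} {C : Fin n → Contour}
    {hC : Pairwise fun k l => Disjoint (Set.range (C k).γ) (Set.range (C l).γ)}
    {k : Fin n} {s : ℝ} (hs : s ∈ (C k).dom) :
    (contours n C hC).phase ((C k).γ s) = deriv (C k).γ s := by
  have h : ∃ p : Fin n × ℝ, p.2 ∈ (C p.1).dom ∧ (C p.1).γ p.2 = (C k).γ s := ⟨(k, s), hs, rfl⟩
  simp only [phase]
  rw [dif_pos h]
  obtain ⟨h1, h2⟩ := h.choose_spec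
  generalize h.choose = p at h1 h2
  obtain ⟨l, s'⟩ := p
  dsimp only at h1 h2
  have hl : l = k := by
    by_contra hne
    exact Set.disjoint_left.1 (hC hne) ⟨s', rfl⟩ ⟨s, h2.symm⟩
  subst hl
  rw [(C l).injOn h1 hs h2]

theorem ae_contours {n : ℕ} {C : Fin n → Contour}
    {hC : Pairwise fun k l => Disjoint (Set.range (C k).γ) (Set.range (C l).γ)} {p : ℂ → Prop}
    (h : ∀ k, ∀ᵐ s : ℝ, s ∈ (C k).dom → p ((C k).γ s)) :
    ∀ᵐ u ∂(contours n C hC).absMeasure, p u := by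
  rw [absMeasure, Measure.ae_sum_iff]
  intro k
  rw [(C k).map_eq, (C k).measurableEmbedding.ae_map_iff]
  have h1 := (ae_restrict_iff' (C k).measurableSet_dom).2 (h k)
  rw [← map_comap_subtype_coe (C k).measurableSet_dom,
    (MeasurableEmbedding.subtype_coe (C k).measurableSet_dom).ae_map_iff] at h1
  exact h1

theorem ae_mem_carrier (Ω : Domain) : ∀ᵐ u ∂Ω.absMeasure, u ∈ Ω.carrier := by
  cases Ω with
  | discrete S hS =>
    have : IsClosed S := isClosed_iff_accPt.2 fun z hz => (hS z hz).elim
    exact ae_restrict_mem this.measurableSet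
  | contours n C hC =>
    exact ae_contours fun k => Eventually.of_forall fun s _ => Set.mem_iUnion.2 ⟨k, s, rfl⟩

theorem norm_phase_le (Ω : Domain) : ∀ᵐ u ∂Ω.absMeasure, ‖Ω.phase u‖ ≤ 1 := by
  cases Ω with
  | discrete S hS => exact Eventually.of_forall fun u => by simp [phase]
  | contours n C hC =>
    refine ae_contours fun k => ?_
    filter_upwards [(C k).unit_speed] with s hs hs'
    rw [phase_contours hs', hs]

theorem aestronglyMeasurable_phase (Ω : Domain) : AEStronglyMeasurable Ω.phase Ω.absMeasure := by
  cases Ω with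
  | discrete S hS => exact aestronglyMeasurable_const (b := (1 : ℂ))
  | contours n C hC =>
    rw [absMeasure, aestronglyMeasurable_sum_measure_iff]
    intro k
    rw [(C k).map_eq, (C k).measurableEmbedding.aestronglyMeasurable_map_iff]
    have h : (contours n C hC).phase ∘ (fun s : (C k).dom => (C k).γ s) =
        fun s : (C k).dom => deriv (C k).γ s := funext fun s => phase_contours s.2
    rw [h]
    exact ((measurable_deriv _).comp measurable_subtype_coe).aestronglyMeasurable

end Domain

namespace Domain

variable (Ω : Domain)

/-! ## Multiplication operators and pairings -/

/-- Multiplication by an essentially bounded function. -/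
def mulOp (b : ℂ → ℂ) (hb : MemLp b ∞ Ω.absMeasure) : Ω.Hilb →L[ℂ] Ω.Hilb :=
  (ContinuousLinearMap.mul ℂ ℂ).holderL Ω.absMeasure ∞ 2 2 hb.toLp

variable {Ω}

theorem coeFn_mulOp {b : ℂ → ℂ} (hb : MemLp b ∞ Ω.absMeasure) (φ : Ω.Hilb) :
    Ω.mulOp b hb φ =ᵐ[Ω.absMeasure] fun u => b u * φ u := by
  filter_upwards [(ContinuousLinearMap.mul ℂ ℂ).coeFn_holder (r := 2) hb.toLp φ, hb.coeFn_toLp]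
    with u h1 h2
  change ((ContinuousLinearMap.mul ℂ ℂ).holder 2 hb.toLp φ) u = _
  rw [h1, h2]
  rfl

theorem norm_mulOp_le {b : ℂ → ℂ} (hb : MemLp b ∞ Ω.absMeasure) {C : ℝ} (hC : 0 ≤ C)
    (h : ∀ᵐ u ∂Ω.absMeasure, ‖b u‖ ≤ C) : ‖Ω.mulOp b hb‖ ≤ C := by
  refine ContinuousLinearMap.opNorm_le_bound _ hC fun φ => ?_
  refine Lp.norm_le_mul_norm_of_ae_le_mul ?_
  filter_upwards [h, coeFn_mulOp hb φ] with u h1 h2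
  rw [h2, norm_mul]
  gcongr

theorem mulOp_comm {a b : ℂ → ℂ} (ha : MemLp a ∞ Ω.absMeasure) (hb : MemLp b ∞ Ω.absMeasure) :
    Ω.mulOp a ha ∘L Ω.mulOp b hb = Ω.mulOp b hb ∘L Ω.mulOp a ha := by
  ext1 φ
  refine Lp.ext ?_
  filter_upwards [coeFn_mulOp ha (Ω.mulOp b hb φ), coeFn_mulOp hb φ, coeFn_mulOp ha φ,
    coeFn_mulOp hb (Ω.mulOp a ha φ)] with u h1 h2 h3 h4
  simp only [ContinuousLinearMap.comp_apply]
  rw [h1, h2, h4, h3]; ring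

theorem tendsto_Lp_of_dominated {φ : ℕ → Ω.Hilb} {φ' : Ω.Hilb} (B : Ω.Hilb)
    (hB : ∀ j, ∀ᵐ u ∂Ω.absMeasure, ‖φ j u - φ' u‖ ≤ ‖B u‖)
    (h : ∀ᵐ u ∂Ω.absMeasure, Tendsto (fun j => φ j u) atTop (𝓝 (φ' u))) :
    Tendsto φ atTop (𝓝 φ') := by
  have hsq : ∀ ψ : Ω.Hilb, ‖ψ‖ ^ 2 = ∫ u, ‖ψ u‖ ^ 2 ∂Ω.absMeasure := fun ψ => by
    have h1 : ((‖ψ‖ ^ 2 : ℝ) : ℂ) = ((∫ u, ‖ψ u‖ ^ 2 ∂Ω.absMeasure : ℝ) : ℂ) := by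
      have h2 := inner_self_eq_norm_sq_to_K (𝕜 := ℂ) ψ
      rw [L2.inner_def] at h2
      rw [← integral_complex_ofReal]
      push_cast

      refine h2.symm.trans ?_
      refine integral_congr_ae (Eventually.of_forall fun u => ?_)
      simp
    exact_mod_cast h1
  rw [tendsto_iff_norm_sub_tendsto_zero]
  have key : Tendsto (fun j => ‖φ j - φ'‖ ^ 2) atTop (𝓝 0) := by
    simp only [hsq]
    have h0 : (0 : ℝ) = ∫ u, (0 : ℝ) ∂Ω.absMeasure := by simp
    rw [h0]
    refine tendsto_integral_of_dominated_convergence (fun u => ‖B u‖ ^ 2)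
      (fun j => ?_) ?_ (fun j => ?_) ?_
    · exact ((Lp.aestronglyMeasurable _).norm.aemeasurable.pow_const 2).aestronglyMeasurable
    · exact (Lp.memLp B).integrable_norm_pow (by norm_num)
    · filter_upwards [hB j, Lp.coeFn_sub (φ j) φ'] with u h1 h2
      rw [h2, Pi.sub_apply, norm_pow, norm_norm]
      gcongr
    · have h2 : ∀ᵐ u ∂Ω.absMeasure, ∀ j, (φ j - φ') u = φ j u - φ' u :=
        ae_all_iff.2 fun j => Lp.coeFn_sub (φ j) φ'
      filter_upwards [h, h2] with u h1 h2
      simp only [h2]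
      have := ((h1.sub_const (φ' u)).norm).pow 2
      simpa using this
  have := key.sqrt
  simpa using this

theorem tendsto_mulOp {b : ℕ → ℂ → ℂ} {b' : ℂ → ℂ} (hb : ∀ j, MemLp (b j) ∞ Ω.absMeasure)
    (hb' : MemLp b' ∞ Ω.absMeasure) {C : ℝ} (hC : ∀ j, ∀ᵐ u ∂Ω.absMeasure, ‖b j u‖ ≤ C)
    (h : ∀ᵐ u ∂Ω.absMeasure, Tendsto (fun j => b j u) atTop (𝓝 (b' u))) (φ : Ω.Hilb) :
    Tendsto (fun j => Ω.mulOp (b j) (hb j) φ) atTop (𝓝 (Ω.mulOp b' hb' φ)) := by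
  refine tendsto_Lp_of_dominated (((2 * C : ℝ) : ℂ) • φ) (fun j => ?_) ?_
  · filter_upwards [ae_all_iff.2 hC, h, coeFn_mulOp (hb j) φ, coeFn_mulOp hb' φ,
      Lp.coeFn_smul ((2 * C : ℝ) : ℂ) φ] with u h1 h2 h3 h4 h5
    have h6 : ‖b' u‖ ≤ C := le_of_tendsto h2.norm (Eventually.of_forall h1)
    have hC0 : 0 ≤ C := (norm_nonneg _).trans h6
    rw [h3, h4, h5, Pi.smul_apply, smul_eq_mul, norm_mul, ← sub_mul, norm_mul, Complex.norm_real,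
      Real.norm_of_nonneg (by positivity)]
    gcongr
    linarith [norm_sub_le (b j u) (b' u), h1 j]
  · filter_upwards [h, ae_all_iff.2 fun j => coeFn_mulOp (hb j) φ, coeFn_mulOp hb' φ]
      with u h1 h2 h3
    simp only [h2, h3]
    exact h1.mul_const _

open ContinuousLinearMap in
theorem adjoint_mulOp {b : ℂ → ℂ} (hb : MemLp b ∞ Ω.absMeasure) (hreal : ∀ u, star (b u) = b u) :
    adjoint (Ω.mulOp b hb) = Ω.mulOp b hb := by
  symm
  rw [eq_adjoint_iff]
  intro φ ψ
  rw [L2.inner_def, L2.inner_def]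
  refine integral_congr_ae ?_
  filter_upwards [coeFn_mulOp hb φ, coeFn_mulOp hb ψ] with u h1 h2
  rw [h1, h2]
  have : (starRingEnd ℂ) (b u) = b u := hreal u
  simp only [RCLike.inner_apply, map_mul, this]
  ring

theorem memLp_mul_phase {g : ℂ → ℂ} (hg : MemLp g 2 Ω.absMeasure) :
    MemLp (fun u => star (g u * Ω.phase u)) 2 Ω.absMeasure := by
  refine MemLp.star (f := fun u => g u * Ω.phase u) ?_
  refine hg.mono (hg.1.mul Ω.aestronglyMeasurable_phase) ?_
  filter_upwards [Ω.norm_phase_le] with u hu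
  rw [norm_mul]
  exact mul_le_of_le_one_right (norm_nonneg _) hu

/-- The vector representing the functional `φ ↦ ∫_Ω g φ dμ`. -/
def dualVec {g : ℂ → ℂ} (hg : MemLp g 2 Ω.absMeasure) : Ω.Hilb := (memLp_mul_phase hg).toLp

/-- The conjugation in the definition of `dualVec` cancels that of the inner product, so the pairing
is bilinear. -/
theorem inner_dualVec {g : ℂ → ℂ} (hg : MemLp g 2 Ω.absMeasure) (φ : Ω.Hilb) :
    inner ℂ (dualVec hg) φ = Ω.integral fun u => g u * φ u := by
  rw [L2.inner_def, integral]
  refine integral_congr_ae ?_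
  filter_upwards [(memLp_mul_phase hg).coeFn_toLp] with u h1
  rw [dualVec, h1]
  simp only [RCLike.inner_apply, RCLike.star_def, Complex.conj_conj]
  ring

theorem integrableOver_mul {g h : ℂ → ℂ} (hg : MemLp g 2 Ω.absMeasure)
    (hh : MemLp h 2 Ω.absMeasure) : Ω.IntegrableOver fun u => g u * h u := by
  have h1 : MemLp (fun u => g u * Ω.phase u) 2 Ω.absMeasure := by
    have := (memLp_mul_phase hg).star
    refine this.congr_norm ?_ ?_
    · exact hg.1.mul Ω.aestronglyMeasurable_phase
    · exact Eventually.of_forall fun u => by simp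
  refine (h1.integrable_mul hh).congr (Eventually.of_forall fun u => ?_)
  simp only [Pi.mul_apply]
  ring

theorem integral_congr_ae {h h' : ℂ → ℂ} (e : ∀ᵐ u ∂Ω.absMeasure, h u = h' u) :
    Ω.integral h = Ω.integral h' := by
  refine MeasureTheory.integral_congr_ae ?_
  filter_upwards [e] with u hu
  rw [hu]

theorem IntegrableOver.congr {h h' : ℂ → ℂ} (hi : Ω.IntegrableOver h)
    (e : ∀ᵐ u ∂Ω.absMeasure, h u = h' u) : Ω.IntegrableOver h' := by
  refine Integrable.congr hi ?_
  filter_upwards [e] with u hu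
  rw [hu]

theorem integral_sub {h h' : ℂ → ℂ} (hi : Ω.IntegrableOver h) (hi' : Ω.IntegrableOver h') :
    Ω.integral (fun u => h u - h' u) = Ω.integral h - Ω.integral h' := by
  rw [integral, integral, integral, ← MeasureTheory.integral_sub hi hi']
  exact MeasureTheory.integral_congr_ae (Eventually.of_forall fun u => by ring)

theorem integral_mul_left (c : ℂ) (h : ℂ → ℂ) :
    Ω.integral (fun u => c * h u) = c * Ω.integral h := by
  rw [integral, integral, ← MeasureTheory.integral_const_mul]
  exact MeasureTheory.integral_congr_ae (Eventually.of_forall fun u => by ring)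

theorem integral_sum {ι : Type*} (s : Finset ι) {h : ι → ℂ → ℂ}
    (hi : ∀ k ∈ s, Ω.IntegrableOver (h k)) :
    Ω.integral (fun u => ∑ k ∈ s, h k u) = ∑ k ∈ s, Ω.integral (h k) := by
  simp only [integral]
  rw [← integral_finsetSum s hi]
  exact MeasureTheory.integral_congr_ae (Eventually.of_forall fun u => by
    simp only [Finset.sum_mul])

end Domain

/-! ## Integrable operators and their commutators with multiplications -/

/-- `H` is the integral operator with kernel `f(u)ᵀ g(v) / (u - v)`, where `fₖ gₖ = 0` for all
`k`. -/
structure IsIntegrableOp {Ω : Domain} {m : ℕ} (H : Ω.Hilb →L[ℂ] Ω.Hilb)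
    (f g : ℂ → Fin (m + 1) → ℂ) : Prop where
  memLp_f : ∀ k, MemLp (fun u => f u k) 2 Ω.absMeasure
  memLp_g : ∀ k, MemLp (fun u => g u k) 2 Ω.absMeasure
  orthogonal : ∀ᵐ u ∂Ω.absMeasure, ∀ k, f u k * g u k = 0
  kernel : Ω.HasKernel H (integrableKernel f g)

/-- The identity survives on the diagonal because orthogonality makes the right side vanish there,
so atoms of the measure cause no correction term. -/
theorem sub_mul_integrableKernel {m : ℕ} {f g : ℂ → Fin (m + 1) → ℂ} {u : ℂ}
    (h : ∀ k, f u k * g u k = 0) (v : ℂ) :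
    (u - v) * integrableKernel f g u v = ∑ k, f u k * g v k := by
  unfold integrableKernel
  split_ifs with huv
  · subst huv
    simp [h]
  · rw [mul_div_cancel₀ _ (sub_ne_zero.2 huv)]; rfl

namespace IsIntegrableOp

variable {Ω : Domain} {m : ℕ} {H : Ω.Hilb →L[ℂ] Ω.Hilb} {f g : ℂ → Fin (m + 1) → ℂ}

/-- Here ψ is the product τ φ, given as an element of L² since τ may be unbounded. -/
theorem commutator (hH : IsIntegrableOp H f g) {τ : ℂ → ℂ} {φ ψ : Ω.Hilb}
    (hψ : ∀ᵐ u ∂Ω.absMeasure, ψ u = τ u * φ u) :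
    ∀ᵐ u ∂Ω.absMeasure,
      τ u * H φ u - H ψ u =
        Ω.integral fun v => (τ u - τ v) * integrableKernel f g u v * φ v := by
  filter_upwards [hH.kernel φ, hH.kernel ψ] with u h1 h2
  have h3 : ∀ᵐ v ∂Ω.absMeasure, integrableKernel f g u v * ψ v =
      integrableKernel f g u v * (τ v * φ v) := by
    filter_upwards [hψ] with v hv
    rw [hv]
  have i1 : Ω.IntegrableOver fun v => τ u * (integrableKernel f g u v * φ v) := by
    have h4 := Integrable.const_mul h1.1 (τ u)
    refine h4.congr (Eventually.of_forall fun v => ?_)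
    dsimp only
    ring
  rw [h1.2, h2.2, ← Domain.integral_mul_left, ← Domain.integral_sub i1 h2.1]
  refine Domain.integral_congr_ae ?_
  filter_upwards [h3] with v hv
  rw [hv]; ring

theorem commutator_id (hH : IsIntegrableOp H f g) {φ ψ : Ω.Hilb}
    (hψ : ∀ᵐ u ∂Ω.absMeasure, ψ u = u * φ u) :
    ∀ᵐ u ∂Ω.absMeasure,
      u * H φ u - H ψ u = ∑ k, f u k * Ω.integral fun v => g v k * φ v := by
  filter_upwards [hH.commutator hψ, hH.orthogonal] with u h1 h2
  rw [h1]
  simp only [sub_mul_integrableKernel h2, Finset.sum_mul]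
  simp only [mul_assoc]
  rw [Domain.integral_sum]
  · simp only [Domain.integral_mul_left]
  · intro k _
    have h3 := Integrable.const_mul
      (Domain.integrableOver_mul (hH.memLp_g k) (Lp.memLp φ)) (f u k)
    refine h3.congr (Eventually.of_forall fun v => ?_)
    dsimp only
    ring

/-- A 1-Lipschitz multiplier absorbs the factor 1/(u - v), so the bound does not depend on τ; this
gives uniformity over the cut-offs of |u|. -/
theorem norm_commutator_le (hH : IsIntegrableOp H f g) {τ : ℂ → ℂ}
    (hτ : ∀ u v, ‖τ u - τ v‖ ≤ ‖u - v‖) {φ ψ : Ω.Hilb}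
    (hψ : ∀ᵐ u ∂Ω.absMeasure, ψ u = τ u * φ u) :
    ∀ᵐ u ∂Ω.absMeasure,
      ‖τ u * H φ u - H ψ u‖ ≤ ∑ k, ‖f u k‖ * ∫ v, ‖g v k‖ * ‖φ v‖ ∂Ω.absMeasure := by
  filter_upwards [hH.commutator hψ, hH.orthogonal] with u h1 h2
  have hi : ∀ k, Integrable (fun v => ‖g v k‖ * ‖φ v‖) Ω.absMeasure := fun k =>
    (hH.memLp_g k).norm.integrable_mul (Lp.memLp φ).norm
  have e1 : ∑ k, ‖f u k‖ * ∫ v, ‖g v k‖ * ‖φ v‖ ∂Ω.absMeasure =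
      ∫ v, ∑ k, ‖f u k‖ * (‖g v k‖ * ‖φ v‖) ∂Ω.absMeasure := by
    rw [integral_finsetSum _ fun k _ => (hi k).const_mul _]
    simp only [MeasureTheory.integral_const_mul]
  rw [h1, e1, Domain.integral]
  refine norm_integral_le_of_norm_le (integrable_finsetSum _ fun k _ => (hi k).const_mul _) ?_
  filter_upwards [Ω.norm_phase_le] with v hv
  have h3 : ‖(τ u - τ v) * integrableKernel f g u v‖ ≤ ∑ k, ‖f u k‖ * ‖g v k‖ := by
    rw [norm_mul]
    calc ‖τ u - τ v‖ * ‖integrableKernel f g u v‖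
        ≤ ‖u - v‖ * ‖integrableKernel f g u v‖ := by gcongr; exact hτ u v
      _ = ‖∑ k, f u k * g v k‖ := by rw [← norm_mul, sub_mul_integrableKernel h2]
      _ ≤ ∑ k, ‖f u k * g v k‖ := norm_sum_le _ _
      _ = _ := by simp only [norm_mul]
  calc ‖(τ u - τ v) * integrableKernel f g u v * φ v * Ω.phase v‖
      ≤ (∑ k, ‖f u k‖ * ‖g v k‖) * ‖φ v‖ * 1 := by
        rw [norm_mul, norm_mul]
        gcongr
    _ = _ := by
        rw [mul_one, Finset.sum_mul]
        exact Finset.sum_congr rfl fun k _ => by ring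

/-! ### Multiplication by u and the resolvent -/

/-- The cut-off function `min(|u|, N)`. -/
def cutoff (N : ℕ) (u : ℂ) : ℂ := ((min ‖u‖ N : ℝ) : ℂ)

theorem norm_cutoff (N : ℕ) (u : ℂ) : ‖cutoff N u‖ = min ‖u‖ N := by
  rw [cutoff, Complex.norm_real, Real.norm_of_nonneg (by positivity)]

theorem norm_cutoff_sub_le (N : ℕ) (u v : ℂ) : ‖cutoff N u - cutoff N v‖ ≤ ‖u - v‖ := by
  rw [cutoff, cutoff, ← Complex.ofReal_sub, Complex.norm_real, Real.norm_eq_abs]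
  exact (abs_min_sub_min_le_max _ _ _ _).trans (by simpa using abs_norm_sub_norm_le u v)

theorem memLp_cutoff (N : ℕ) : MemLp (cutoff N) ∞ Ω.absMeasure := by
  refine memLp_top_of_bound ?_ N (Eventually.of_forall fun u => ?_)
  · refine Continuous.aestronglyMeasurable ?_
    unfold cutoff
    fun_prop
  · rw [norm_cutoff]; exact min_le_right _ _

/-- If `w` and `u w` are square integrable, then so is `u (1 - H)⁻¹ w`. -/
theorem memLp_id_mul (hH : IsIntegrableOp H f g) {R : Ω.Hilb →L[ℂ] Ω.Hilb}
    (hR : R * (1 - H) = 1) (hR' : (1 - H) * R = 1) {w : Ω.Hilb}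
    (hw : MemLp (fun u => u * w u) 2 Ω.absMeasure) :
    MemLp (fun u => u * R w u) 2 Ω.absMeasure := by
  set φ := R w
  have hφ : φ - H φ = w := by
    have := congrArg (fun A => A w) hR'
    exact this
  let c : Fin (m + 1) → ℝ := fun k => ∫ v, ‖g v k‖ * ‖φ v‖ ∂Ω.absMeasure
  have hF : MemLp (fun u => ∑ k, ‖f u k‖ * c k) 2 Ω.absMeasure :=
    memLp_finsetSum _ fun k _ => (hH.memLp_f k).norm.mul_const (c k)
  let F : Ω.Hilb := (hF.ofReal (K := ℂ)).toLp
  let W : Ω.Hilb := hw.toLp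
  let T : ℕ → Ω.Hilb →L[ℂ] Ω.Hilb := fun N => Ω.mulOp (cutoff N) (memLp_cutoff N)
  have hT : ∀ N, ‖T N φ‖ ≤ ‖R‖ * (‖W‖ + ‖F‖) := by
    intro N
    -- R is applied to (1 - H) T_N φ = T_N w + [T_N, H] φ, whose right side is bounded independently
    -- of N; Fatou's lemma then removes the cut-off.
    have e1 : T N φ = R (T N w + (T N (H φ) - H (T N φ))) := by
      have h1 : T N φ - H (T N φ) = T N w + (T N (H φ) - H (T N φ)) := by
        rw [← hφ, map_sub]; abel
      rw [← h1]
      exact (congrArg (fun A => A (T N φ)) hR).symm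
    have e2 : ‖T N w‖ ≤ ‖W‖ := by
      refine Lp.norm_le_norm_of_ae_le ?_
      filter_upwards [Domain.coeFn_mulOp (memLp_cutoff N) w, hw.coeFn_toLp] with u h1 h2
      rw [h1, h2, norm_mul, norm_mul, norm_cutoff]
      gcongr
      exact min_le_left _ _
    have e3 : ‖T N (H φ) - H (T N φ)‖ ≤ ‖F‖ := by
      refine Lp.norm_le_norm_of_ae_le ?_
      filter_upwards [hH.norm_commutator_le (norm_cutoff_sub_le N)
        (Domain.coeFn_mulOp (memLp_cutoff N) φ), Lp.coeFn_sub (T N (H φ)) (H (T N φ)),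
        Domain.coeFn_mulOp (memLp_cutoff N) (H φ), (hF.ofReal (K := ℂ)).coeFn_toLp]
        with u h1 h2 h3 h4
      rw [h2, Pi.sub_apply, h3, h4]
      refine h1.trans ?_
      rw [RCLike.norm_ofReal]
      exact le_abs_self _
    rw [e1]
    refine (R.le_opNorm _).trans ?_
    gcongr
    exact (norm_add_le _ _).trans (add_le_add e2 e3)
  have hmeas : AEStronglyMeasurable (fun u => u * φ u) Ω.absMeasure :=
    aestronglyMeasurable_id.mul (Lp.aestronglyMeasurable φ)
  refine ⟨hmeas, ?_⟩
  have h1 : eLpNorm (fun u => (‖u‖ : ℂ) * φ u) 2 Ω.absMeasure ≤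
      liminf (fun N => eLpNorm (fun u => cutoff N u * φ u) 2 Ω.absMeasure) atTop := by
    refine Lp.eLpNorm_lim_le_liminf_eLpNorm
      (fun N => (memLp_cutoff N).1.mul (Lp.aestronglyMeasurable φ)) _
      (Eventually.of_forall fun u => ?_)
    refine Tendsto.mul_const _ ?_
    refine tendsto_const_nhds.congr' ?_
    obtain ⟨N, hN⟩ := exists_nat_ge ‖u‖
    filter_upwards [eventually_ge_atTop N] with n hn
    have : ‖u‖ ≤ n := hN.trans (by exact_mod_cast hn)
    rw [cutoff, min_eq_left this]
  have h2 : ∀ N, eLpNorm (fun u => cutoff N u * φ u) 2 Ω.absMeasure ≤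
      ENNReal.ofReal (‖R‖ * (‖W‖ + ‖F‖)) := by
    intro N
    rw [← eLpNorm_congr_ae (Domain.coeFn_mulOp (memLp_cutoff N) φ), ← Lp.enorm_def, ← ofReal_norm]
    exact ENNReal.ofReal_le_ofReal (hT N)
  have h3 : eLpNorm (fun u => u * φ u) 2 Ω.absMeasure =
      eLpNorm (fun u => (‖u‖ : ℂ) * φ u) 2 Ω.absMeasure :=
    eLpNorm_congr_norm_ae (Eventually.of_forall fun u => by simp)
  rw [h3]
  refine (h1.trans ?_).trans_lt (ENNReal.ofReal_lt_top (r := ‖R‖ * (‖W‖ + ‖F‖)))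
  exact (liminf_le_liminf (Eventually.of_forall h2)).trans (by simp)

/-- The commutator of the resolvent with the multiplication by `u`. -/
theorem id_mul_resolvent (hH : IsIntegrableOp H f g) {R : Ω.Hilb →L[ℂ] Ω.Hilb}
    (hR : R * (1 - H) = 1) (hR' : (1 - H) * R = 1) {w : Ω.Hilb}
    (hw : MemLp (fun u => u * w u) 2 Ω.absMeasure)
    (hRw : MemLp (fun u => u * R w u) 2 Ω.absMeasure) :
    hRw.toLp = R hw.toLp +
      ∑ k, (Ω.integral fun v => g v k * R w v) • R (hH.memLp_f k).toLp := by
  set φ := R w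
  have hφ : φ - H φ = w := congrArg (fun A => A w) hR'
  set ψ : Ω.Hilb := hRw.toLp
  have hψ : ψ =ᵐ[Ω.absMeasure] fun u => u * φ u := hRw.coeFn_toLp
  -- This is (1 - H)(u φ) = u (1 - H) φ + [u, H] φ with [u, H] = Σ fₖ ⊗ gₖ.
  have key : ψ - H ψ = hw.toLp +
      ∑ k, (Ω.integral fun v => g v k * φ v) • (hH.memLp_f k).toLp := by
    refine Lp.ext ?_
    have hs : ∀ᵐ u ∂Ω.absMeasure,
        (∑ k, (Ω.integral fun v => g v k * φ v) • (hH.memLp_f k).toLp : Ω.Hilb) u =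
          ∑ k, f u k * Ω.integral fun v => g v k * φ v := by
      have h1 := Lp.coeFn_finsetSum Finset.univ
        fun k => (Ω.integral fun v => g v k * φ v) • (hH.memLp_f k).toLp
      have h2 : ∀ᵐ u ∂Ω.absMeasure, ∀ k,
          ((Ω.integral fun v => g v k * φ v) • (hH.memLp_f k).toLp : Ω.Hilb) u =
            f u k * Ω.integral fun v => g v k * φ v := by
        refine ae_all_iff.2 fun k => ?_
        filter_upwards [Lp.coeFn_smul (Ω.integral fun v => g v k * φ v) (hH.memLp_f k).toLp,
          (hH.memLp_f k).coeFn_toLp] with u h3 h4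
        rw [h3, Pi.smul_apply, h4, smul_eq_mul, mul_comm]
      filter_upwards [h1, h2] with u h3 h4
      rw [h3, Finset.sum_apply]
      exact Finset.sum_congr rfl fun k _ => h4 k
    filter_upwards [hH.commutator_id hψ, hψ, hw.coeFn_toLp, hs, Lp.coeFn_sub ψ (H ψ),
      Lp.coeFn_add hw.toLp (∑ k, (Ω.integral fun v => g v k * φ v) • (hH.memLp_f k).toLp),
      Lp.coeFn_sub φ (H φ), Lp.ext_iff.1 hφ] with u h1 h2 h3 h4 h5 h6 h7 h8
    rw [h5, h6, Pi.sub_apply, Pi.add_apply, h3, h4, h2, ← h1, ← h8, h7, Pi.sub_apply]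
    ring
  calc ψ = R (ψ - H ψ) := (congrArg (fun A => A ψ) hR).symm
    _ = _ := by rw [key, map_add, map_sum]; simp only [map_smul]; rfl

end IsIntegrableOp

/-! ## The finite rank part of the derivative and its trace -/

namespace Domain

variable {Ω : Domain}

open Classical in
/-- The class of a square integrable function, and `0` for other functions. -/
def toHilb (Ω : Domain) (h : ℂ → ℂ) : Ω.Hilb :=
  if hh : MemLp h 2 Ω.absMeasure then hh.toLp else 0

theorem toHilb_eq {h : ℂ → ℂ} (hh : MemLp h 2 Ω.absMeasure) : Ω.toHilb h = hh.toLp := dif_pos hh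

theorem coeFn_toHilb {h : ℂ → ℂ} (hh : MemLp h 2 Ω.absMeasure) :
    ∀ᵐ u ∂Ω.absMeasure, Ω.toHilb h u = h u := by
  rw [toHilb_eq hh]; exact hh.coeFn_toLp

/-- The finite rank operator with kernel `∑ uˡ vᵈ⁻¹⁻ˡ a(u) b(v)`, where `l` runs from `0` to
`d - 1`. -/
def powerOp (Ω : Domain) (d : ℕ) (a b : ℂ → ℂ) : Ω.Hilb →L[ℂ] Ω.Hilb :=
  ∑ l ∈ Finset.range d, InnerProductSpace.rankOne ℂ (Ω.toHilb fun u => u ^ l * a u)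
    (Ω.toHilb fun v => star (v ^ (d - 1 - l) * b v * Ω.phase v))

theorem inner_toHilb {g : ℂ → ℂ} (hg : MemLp g 2 Ω.absMeasure) (φ : Ω.Hilb) :
    inner ℂ (Ω.toHilb fun v => star (g v * Ω.phase v)) φ = Ω.integral fun u => g u * φ u := by
  rw [toHilb_eq (memLp_mul_phase hg)]
  exact inner_dualVec hg φ

theorem isTraceClass_powerOp (d : ℕ) (a b : ℂ → ℂ) : IsTraceClass (Ω.powerOp d a b) :=
  IsTraceClass.sum fun _ _ => isTraceClass_rankOne _ _

theorem trace_comp_powerOp (R : Ω.Hilb →L[ℂ] Ω.Hilb) {d : ℕ} {a b : ℂ → ℂ}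
    (hb : ∀ l < d, MemLp (fun u => u ^ l * b u) 2 Ω.absMeasure) :
    trace (R ∘L Ω.powerOp d a b) = ∑ l ∈ Finset.range d,
      Ω.integral fun u => u ^ (d - 1 - l) * b u * R (Ω.toHilb fun u => u ^ l * a u) u := by
  have h : R ∘L Ω.powerOp d a b = ∑ l ∈ Finset.range d,
      InnerProductSpace.rankOne ℂ (R (Ω.toHilb fun u => u ^ l * a u))
        (Ω.toHilb fun v => star (v ^ (d - 1 - l) * b v * Ω.phase v)) := by
    ext1 φ
    simp [powerOp]
  rw [h, trace_sum fun _ _ => isTraceClass_rankOne _ _]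
  refine Finset.sum_congr rfl fun l hl => ?_
  rw [trace_rankOne, inner_toHilb (hb _ (by have := Finset.mem_range.1 hl; omega))]

end Domain

namespace IsIntegrableOp

variable {Ω : Domain} {m : ℕ} {H : Ω.Hilb →L[ℂ] Ω.Hilb} {f g : ℂ → Fin (m + 1) → ℂ}

theorem integral_mul_id_mul (hH : IsIntegrableOp H f g) {R : Ω.Hilb →L[ℂ] Ω.Hilb}
    (hR : R * (1 - H) = 1) (hR' : (1 - H) * R = 1) {w w' : Ω.Hilb}
    (hw : ∀ᵐ u ∂Ω.absMeasure, w' u = u * w u) {h : ℂ → ℂ} (hh : MemLp h 2 Ω.absMeasure) :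
    Ω.integral (fun u => h u * (u * R w u)) = Ω.integral (fun u => h u * R w' u) +
      ∑ q, Ω.integral (fun u => g u q * R w u) *
        Ω.integral fun u => h u * R (hH.memLp_f q).toLp u := by
  have hw1 : MemLp (fun u => u * w u) 2 Ω.absMeasure :=
    (memLp_congr_ae hw).1 (Lp.memLp w')
  have hw2 : hw1.toLp = w' := by
    refine Lp.ext ?_
    filter_upwards [hw, hw1.coeFn_toLp] with u h1 h2
    rw [h1, h2]
  have hRw := hH.memLp_id_mul hR hR' hw1
  have key := congrArg (fun φ => inner ℂ (Domain.dualVec hh) φ)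
    (hH.id_mul_resolvent hR hR' hw1 hRw)
  simp only [inner_add_right, inner_sum, inner_smul_right, Domain.inner_dualVec] at key
  rw [hw2] at key
  rw [← key]
  refine Domain.integral_congr_ae ?_
  filter_upwards [hRw.coeFn_toLp] with u h1
  rw [h1]

/-- The matrix `Yₙ` of an integrable operator. -/
def moment (_ : IsIntegrableOp H f g) (R : Ω.Hilb →L[ℂ] Ω.Hilb) (n : ℕ) :
    Matrix (Fin (m + 1)) (Fin (m + 1)) ℂ :=
  Matrix.of fun j k => Ω.integral fun u =>
    u ^ (n - 1) * (R (Ω.toHilb fun v => f v j) u * g u k)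

theorem trace_mul_Emat (M : Matrix (Fin (m + 1)) (Fin (m + 1)) ℂ) (i : Fin (m + 1)) :
    Matrix.trace (M * Emat i) = M i i := by
  rw [Emat, Matrix.trace_mul_single]
  simp

variable (hH : IsIntegrableOp H f g) {R : Ω.Hilb →L[ℂ] Ω.Hilb}
  (hR : R * (1 - H) = 1) (hR' : (1 - H) * R = 1) {i : Fin (m + 1)}
  (hf : ∀ l ≤ 2, MemLp (fun u => u ^ l * f u i) 2 Ω.absMeasure)
  (hg : ∀ l ≤ 2, MemLp (fun u => u ^ l * g u i) 2 Ω.absMeasure)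

include hH hR hR' hf

/-- One power of u is moved across the resolvent. The bound on l keeps uˡ⁺¹ fᵢ square integrable. -/
theorem integral_pow_succ {l : ℕ} (hl : l < 2) {h : ℂ → ℂ} (hh : MemLp h 2 Ω.absMeasure) :
    Ω.integral (fun u => h u * (u * R (Ω.toHilb fun u => u ^ l * f u i) u)) =
      Ω.integral (fun u => h u * R (Ω.toHilb fun u => u ^ (l + 1) * f u i) u) +
      ∑ q, Ω.integral (fun u => g u q * R (Ω.toHilb fun u => u ^ l * f u i) u) *
        Ω.integral fun u => h u * R (Ω.toHilb fun u => f u q) u := by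
  have hw : ∀ᵐ u ∂Ω.absMeasure, (Ω.toHilb fun u => u ^ (l + 1) * f u i) u =
      u * (Ω.toHilb fun u => u ^ l * f u i) u := by
    filter_upwards [Domain.coeFn_toHilb (hf l (by omega)),
      Domain.coeFn_toHilb (hf (l + 1) (by omega))] with u h1 h2
    rw [h1, h2]; ring
  rw [hH.integral_mul_id_mul hR hR' hw hh]
  simp only [Domain.toHilb_eq (hH.memLp_f _)]

theorem moment_two_row (k : Fin (m + 1)) :
    hH.moment R 2 i k =
      Ω.integral (fun u => g u k * R (Ω.toHilb fun u => u ^ 1 * f u i) u) +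
        (hH.moment R 1 ^ 2) i k := by
  have h := hH.integral_pow_succ hR hR' hf (l := 0) (by norm_num) (hH.memLp_g k)
  simp only [pow_zero, one_mul, zero_add] at h
  rw [pow_two, Matrix.mul_apply]
  simp only [moment, Matrix.of_apply, Nat.sub_self, pow_zero, one_mul, Nat.add_one_sub_one, pow_one]
  simp only [pow_one] at h
  convert h using 2
  · funext u; ring
  · refine Finset.sum_congr rfl fun q _ => ?_
    congr 2 <;> funext u <;> ring

include hg

/-- The two terms are ∫ u gᵢ R fᵢ = (Y₂)ᵢᵢ and ∫ gᵢ R(u fᵢ) = (Y₂ - Y₁²)ᵢᵢ, the latter by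
`moment_two_row`. -/
theorem trace_powerOp_two :
    -trace (R ∘L Ω.powerOp 2 (fun u => f u i) fun u => g u i) =
      Matrix.trace ((hH.moment R 1 ^ 2 - 2 • hH.moment R 2) * Emat i) := by
  rw [trace_mul_Emat, Domain.trace_comp_powerOp R fun l hl => hg l (by omega)]
  have h1 := hH.moment_two_row hR hR' hf i
  simp only [Finset.sum_range_succ, Finset.sum_range_zero, Matrix.sub_apply, Matrix.smul_apply,
    pow_zero, one_mul, zero_add, Nat.add_one_sub_one, Nat.sub_zero, Nat.sub_self] at h1 ⊢
  have h2 : Ω.integral (fun u => u ^ 1 * g u i * R (Ω.toHilb fun u => f u i) u) =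
      hH.moment R 2 i i := by
    simp only [moment, Matrix.of_apply]
    congr 1; funext u; ring
  rw [h2, two_smul]
  linear_combination h1

/-- The three terms are (Y₃)ᵢᵢ, ∫ u gᵢ R(u fᵢ) = (Y₃ - Y₁Y₂)ᵢᵢ, and ∫ gᵢ R(u² fᵢ) = (Y₃ - Y₁Y₂ -
Y₂Y₁ + Y₁³)ᵢᵢ. In the last one, the sum over q of (Y₂ - Y₁²)ᵢ_q (Y₁)_qᵢ is what makes the order of
the factors matter. -/
theorem trace_powerOp_three :
    -trace (R ∘L Ω.powerOp 3 (fun u => f u i) fun u => g u i) =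
      Matrix.trace ((-(hH.moment R 1 ^ 3) + 2 • (hH.moment R 1 * hH.moment R 2) +
        hH.moment R 2 * hH.moment R 1 - 3 • hH.moment R 3) * Emat i) := by
  rw [trace_mul_Emat, Domain.trace_comp_powerOp R fun l hl => hg l (by omega)]
  have h1 := hH.moment_two_row hR hR' hf
  have h2 := hH.integral_pow_succ hR hR' hf (l := 0) (by norm_num) (hg 1 (by norm_num))
  have h3 := hH.integral_pow_succ hR hR' hf (l := 1) (by norm_num) (hg 0 (by norm_num))
  set A1 := R (Ω.toHilb fun u => u ^ 1 * f u i)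
  set A2 := R (Ω.toHilb fun u => u ^ 2 * f u i)
  set M1 := hH.moment R 1
  set M2 := hH.moment R 2
  set M3 := hH.moment R 3
  have e1 : ∀ j k, Ω.integral (fun u => g u k * R (Ω.toHilb fun u => f u j) u) = M1 j k := by
    intro j k
    simp only [M1, moment, Matrix.of_apply]
    congr 1; funext u; simp; ring
  have e2 : ∀ j, Ω.integral (fun u => u ^ 1 * g u i * R (Ω.toHilb fun u => f u j) u) = M2 j i := by
    intro j
    simp only [M2, moment, Matrix.of_apply]
    congr 1; funext u; ring
  have e3 : Ω.integral (fun u => u ^ 1 * g u i * (u * R (Ω.toHilb fun u => f u i) u)) = M3 i i := by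
    simp only [M3, moment, Matrix.of_apply]
    congr 1; funext u; ring
  have e3' : Ω.integral (fun u => u ^ 2 * g u i * R (Ω.toHilb fun u => f u i) u) = M3 i i := by
    rw [← e3]
    congr 1; funext u; ring
  have e4 : Ω.integral (fun u => g u i * (u * A1 u)) =
      Ω.integral (fun u => u ^ 1 * g u i * A1 u) := by
    congr 1; funext u; ring
  simp only [pow_zero, one_mul, e1, e2, e3, e4] at h2 h3
  have h4 : ∑ q, M1 i q * M2 q i = (M1 * M2) i i := (Matrix.mul_apply ..).symm
  have h5 : ∑ q, Ω.integral (fun u => g u q * A1 u) * M1 q i =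
      (M2 * M1) i i - (M1 ^ 3) i i := by
    rw [pow_succ M1 2, Matrix.mul_apply, Matrix.mul_apply, ← Finset.sum_sub_distrib]
    refine Finset.sum_congr rfl fun q _ => ?_
    rw [h1 q]; ring
  rw [h4] at h2
  rw [h5] at h3
  simp only [Finset.sum_range_succ, Finset.sum_range_zero, Matrix.sub_apply, Matrix.add_apply,
    Matrix.neg_apply, Matrix.smul_apply, pow_zero, one_mul, zero_add, Nat.add_one_sub_one,
    Nat.sub_zero, Nat.sub_self]
  simp only [nsmul_eq_mul, Nat.cast_ofNat]
  change -(Ω.integral (fun u => u ^ 2 * g u i * R (Ω.toHilb fun u => f u i) u) +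
    Ω.integral (fun u => u ^ 1 * g u i * A1 u) + Ω.integral (fun u => g u i * A2 u)) = _
  rw [e3']
  linear_combination 2 * h2 + h3

end IsIntegrableOp

/-! ## Truncation and the trace of a commutator -/

section Truncation

variable {E : Type*} [NormedAddCommGroup E] [InnerProductSpace ℂ E] [CompleteSpace E]

open ContinuousLinearMap in
-- P X P - X = (P - 1) X + P X (P - 1). The second term requires strong convergence of adjoints,
-- supplied by self-adjointness of Pₙ.
theorem IsTraceClass.tendsto_truncation {X : E →L[ℂ] E} (hX : IsTraceClass X)
    {P : ℕ → E →L[ℂ] E} (hP : ∀ n, ‖P n‖ ≤ 1) (hPa : ∀ n, adjoint (P n) = P n)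
    (hPt : ∀ φ, Tendsto (fun n => P n φ) atTop (𝓝 φ)) :
    Tendsto (fun n => traceNorm (P n * X * P n - X)) atTop (𝓝 0) := by
  let Q : ℕ → E →L[ℂ] E := fun n => P n - 1
  have hQ : ∀ n, ‖Q n‖ ≤ 2 := fun n => by
    have h1 := norm_sub_le (P n) 1
    have h2 : ‖(1 : E →L[ℂ] E)‖ ≤ 1 := norm_id_le
    exact h1.trans (by linarith [hP n])
  have hQt : ∀ φ, Tendsto (fun n => Q n φ) atTop (𝓝 0) := fun φ => by
    simpa [Q] using (hPt φ).sub_const φ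
  have hQa : ∀ n, adjoint (Q n) = Q n := fun n => by
    have : adjoint (1 : E →L[ℂ] E) = 1 := by
      rw [← star_eq_adjoint, star_one]
    simp only [Q, map_sub, hPa, this]
  have h1 := hX.tendsto_traceNorm_comp (Eventually.of_forall hQ) hQt
  have h2 := hX.tendsto_traceNorm_comp' (T := Q) (l := atTop) (Eventually.of_forall hQ)
    fun φ => by simpa only [hQa] using hQt φ
  have h3 := h1.add h2
  rw [add_zero] at h3
  refine tendsto_of_tendsto_of_tendsto_of_le_of_le tendsto_const_nhds h3 (fun _ => zero_le)
    fun n => ?_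
  have h4 : P n * X * P n - X = Q n ∘L X + P n ∘L (X ∘L Q n) := by
    change _ = (P n - 1) * X + P n * (X * (P n - 1))
    noncomm_ring
  rw [h4]
  refine (traceNorm_add_le _ _).trans (add_le_add le_rfl ((traceNorm_comp_le _ _).trans ?_))
  refine mul_le_of_le_one_left zero_le ?_
  rw [← ofReal_norm, ← ENNReal.ofReal_one]
  exact ENNReal.ofReal_le_ofReal (hP n)

omit [CompleteSpace E] in
theorem tendsto_of_tendsto_traceNorm_sub {X : ℕ → E →L[ℂ] E} {Y : E →L[ℂ] E}
    (h : Tendsto (fun n => traceNorm (X n - Y)) atTop (𝓝 0)) : Tendsto X atTop (𝓝 Y) := by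
  rw [tendsto_iff_edist_tendsto_0]
  refine tendsto_of_tendsto_of_tendsto_of_le_of_le tendsto_const_nhds h (fun _ => zero_le)
    fun n => ?_
  simp only [edist_eq_enorm_sub]
  exact enorm_le_traceNorm _

theorem tendsto_trace_mul {R X : ℕ → E →L[ℂ] E} {R' X' : E →L[ℂ] E}
    (hX : ∀ n, IsTraceClass (X n)) (hX' : IsTraceClass X') (hR : Tendsto R atTop (𝓝 R'))
    (h : Tendsto (fun n => traceNorm (X n - X')) atTop (𝓝 0)) :
    Tendsto (fun n => trace (R n * X n)) atTop (𝓝 (trace (R' * X'))) := by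
  rw [tendsto_iff_edist_tendsto_0]
  have h1 : Tendsto (fun n => ‖R n‖ₑ * traceNorm (X n - X')) atTop (𝓝 0) := by
    have := ENNReal.Tendsto.mul (hR.enorm) (Or.inr ENNReal.zero_ne_top) h
      (Or.inr (enorm_ne_top : ‖R'‖ₑ ≠ ∞))
    simpa using this
  have h2 : Tendsto (fun n => ‖R n - R'‖ₑ * traceNorm X') atTop (𝓝 0) := by
    have h3 : Tendsto (fun n => ‖R n - R'‖ₑ) atTop (𝓝 0) := by
      rw [tendsto_iff_edist_tendsto_0] at hR
      simpa only [edist_eq_enorm_sub] using hR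
    have := ENNReal.Tendsto.mul_const h3 (Or.inr hX'.ne)
    simpa using this
  have h3 := h1.add h2
  rw [add_zero] at h3
  refine tendsto_of_tendsto_of_tendsto_of_le_of_le tendsto_const_nhds h3 (fun _ => zero_le)
    fun n => ?_
  simp only [edist_eq_enorm_sub]
  have e0 : trace (R n * X n) - trace (R' * X') = trace (R n * X n - R' * X') :=
    (trace_sub ((hX n).comp_left (R n)) (hX'.comp_left R')).symm
  rw [e0]
  refine (enorm_trace_le _).trans ?_
  have e1 : R n * X n - R' * X' = R n ∘L (X n - X') + (R n - R') ∘L X' := by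
    change _ = R n * (X n - X') + (R n - R') * X'
    noncomm_ring
  rw [e1]
  exact (traceNorm_add_le _ _).trans
    (add_le_add (traceNorm_comp_le _ _) (traceNorm_comp_le _ _))

/-- As R commutes with X, R (a X - X a) = (R a) X - X (R a), a commutator with a trace class
operator. -/
theorem trace_inverse_mul_commutator {X a : E →L[ℂ] E} (hX : IsTraceClass X)
    (hu : IsUnit (1 - X)) : trace (Ring.inverse (1 - X) * (a * X - X * a)) = 0 := by
  have h1 := Ring.mul_inverse_cancel _ hu
  have h2 := Ring.inverse_mul_cancel _ hu
  set R := Ring.inverse (1 - X)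
  have hc : X * R = R * X := by
    have e1 : X * R = R - 1 := by rw [sub_mul, one_mul] at h1; rw [← h1]; abel
    have e2 : R * X = R - 1 := by rw [mul_sub, mul_one] at h2; rw [← h2]; abel
    rw [e1, e2]
  have e1 : R * (a * X - X * a) = (R ∘L a) ∘L X - (R ∘L X) ∘L a := by
    change _ = R * a * X - R * X * a
    noncomm_ring
  have e2 : X ∘L (R ∘L a) = (R ∘L X) ∘L a := by
    change X * (R * a) = R * X * a
    rw [← hc, mul_assoc]
  rw [e1, trace_sub (hX.comp_left _) ((hX.comp_left R).comp_right a), ← trace_comp_comm hX, e2,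
    sub_self]

open ContinuousLinearMap in
/-- If `X'` agrees with `L` up to a formal commutator of `H` with an unbounded operator, then it has
the same trace against the resolvent of `H`. -/
theorem trace_eq_of_truncated_commutator {H X' L : E →L[ℂ] E} (hH : IsTraceClass H)
    (hX' : IsTraceClass X') (hL : IsTraceClass L) (hu : IsUnit (1 - H))
    {P a : ℕ → E →L[ℂ] E} (hP : ∀ n, ‖P n‖ ≤ 1) (hPa : ∀ n, adjoint (P n) = P n)
    (hPt : ∀ φ, Tendsto (fun n => P n φ) atTop (𝓝 φ))
    (h : ∀ n, P n * X' * P n =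
      a n * (P n * H * P n) - (P n * H * P n) * a n + P n * L * P n) :
    trace (Ring.inverse (1 - H) * X') = trace (Ring.inverse (1 - H) * L) := by
  have tc : ∀ {X : E →L[ℂ] E}, IsTraceClass X → ∀ n, IsTraceClass (P n * X * P n) :=
    fun hX n => (hX.comp_left (P n)).comp_right (P n)
  have tH := hH.tendsto_truncation hP hPa hPt
  -- Trace norm convergence implies norm convergence, so 1 - Pₙ H Pₙ is eventually invertible and
  -- its inverses converge.
  have tH' : Tendsto (fun n => 1 - P n * H * P n) atTop (𝓝 (1 - H)) :=
    (tendsto_of_tendsto_traceNorm_sub tH).const_sub 1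
  obtain ⟨U, hU⟩ := hu
  have tR : Tendsto (fun n => Ring.inverse (1 - P n * H * P n)) atTop
      (𝓝 (Ring.inverse (1 - H))) := by
    have := NormedRing.inverse_continuousAt U
    rw [hU] at this
    exact this.tendsto.comp tH'
  have hunit : ∀ᶠ n in atTop, IsUnit (1 - P n * H * P n) :=
    tH'.eventually (hU ▸ Units.nhds U)
  have t1 := tendsto_trace_mul (tc hX') hX' tR (hX'.tendsto_truncation hP hPa hPt)
  have t2 := tendsto_trace_mul (tc hL) hL tR (hL.tendsto_truncation hP hPa hPt)
  refine tendsto_nhds_unique t1 (t2.congr' ?_)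
  filter_upwards [hunit] with n hn
  rw [h n, mul_add, trace_add, trace_inverse_mul_commutator (tc hH n) hn, zero_add]
  · exact (((tc hH n).comp_left (a n)).sub ((tc hH n).comp_right (a n))).comp_left _
  · exact (tc hL n).comp_left _

end Truncation

/-! ## The derivative of a family of integrable operators -/

/-- A bound for `∑ uˡ vᵈ⁻¹⁻ˡ` on the disk of radius `N`. -/
def geomBound (d : ℕ) (N : ℝ) : ℝ := ∑ l ∈ Finset.range d, N ^ l * N ^ (d - 1 - l)

theorem geomBound_nonneg (d : ℕ) {N : ℝ} (hN : 0 ≤ N) : 0 ≤ geomBound d N :=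
  Finset.sum_nonneg fun _ _ => by positivity

theorem norm_geom_le {d : ℕ} {N : ℝ} {u v : ℂ} (hu : ‖u‖ ≤ N) (hv : ‖v‖ ≤ N) :
    ‖∑ l ∈ Finset.range d, u ^ l * v ^ (d - 1 - l)‖ ≤ geomBound d N := by
  refine (norm_sum_le _ _).trans (Finset.sum_le_sum fun l _ => ?_)
  have : 0 ≤ N := (norm_nonneg u).trans hu
  rw [norm_mul, norm_pow, norm_pow]
  gcongr

/-- With q the geometric sum and x = h q (u - v), the left side is |exp x - 1 - x| / |u - v| ≤ |x|²
/ |u - v| = |h|² |q|² |u - v|: one factor |u - v| survives the division, so there is no singularity.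
-/
theorem norm_exp_div_sub_le {d : ℕ} {N h : ℝ} {u v : ℂ} (hu : ‖u‖ ≤ N) (hv : ‖v‖ ≤ N)
    (huv : u ≠ v) (hh : |h| * (geomBound d N * (2 * N)) ≤ 1) :
    ‖(Complex.exp (h * u ^ d - h * v ^ d) - 1) / (u - v) -
      h * ∑ l ∈ Finset.range d, u ^ l * v ^ (d - 1 - l)‖ ≤
      |h| ^ 2 * (geomBound d N ^ 2 * (2 * N)) := by
  have hN : 0 ≤ N := (norm_nonneg u).trans hu
  set q := ∑ l ∈ Finset.range d, u ^ l * v ^ (d - 1 - l) with hq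
  have hqn : ‖q‖ ≤ geomBound d N := norm_geom_le hu hv
  have hQ := geomBound_nonneg d hN
  have hd : ‖u - v‖ ≤ 2 * N := (norm_sub_le u v).trans (by linarith)
  have hx : (h : ℂ) * u ^ d - h * v ^ d = h * q * (u - v) := by
    rw [mul_assoc, hq, (Commute.all u v).geom_sum₂_mul]; ring
  have hxn : ‖(h : ℂ) * q * (u - v)‖ = |h| * (‖q‖ * ‖u - v‖) := by
    rw [norm_mul, norm_mul, Complex.norm_real, Real.norm_eq_abs, mul_assoc]
  have hx1 : ‖(h : ℂ) * q * (u - v)‖ ≤ 1 := by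
    rw [hxn]; refine le_trans ?_ hh; gcongr
  have hne : u - v ≠ 0 := sub_ne_zero.2 huv
  have key := Complex.norm_exp_sub_one_sub_id_le hx1
  have e1 : (Complex.exp (h * q * (u - v)) - 1) / (u - v) - h * q =
      (Complex.exp (h * q * (u - v)) - 1 - h * q * (u - v)) / (u - v) := by
    field_simp
  rw [hx, e1, norm_div, div_le_iff₀ (norm_pos_iff.2 hne)]
  refine key.trans ?_
  rw [hxn]
  calc (|h| * (‖q‖ * ‖u - v‖)) ^ 2 = |h| ^ 2 * (‖q‖ ^ 2 * ‖u - v‖) * ‖u - v‖ := by ring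
    _ ≤ _ := by gcongr

/-- Apart from the common factor ρ σ, only the i-th summand of the numerator changes, by exp(x - y).
-/
theorem integrableKernel_conj {m : ℕ} {f g f₁ g₁ : ℂ → Fin (m + 1) → ℂ} {i : Fin (m + 1)}
    {u v ρ σ x y : ℂ}
    (hf : ∀ k, f₁ u k = ρ * ((if k = i then Complex.exp x else 1) * f u k))
    (hg : ∀ k, g₁ v k = σ * ((if k = i then Complex.exp (-y) else 1) * g v k)) :
    integrableKernel f₁ g₁ u v = ρ * σ * (integrableKernel f g u v +
      (Complex.exp (x - y) - 1) / (u - v) * (f u i * g v i)) := by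
  unfold integrableKernel
  split_ifs with huv
  · subst huv; simp
  have e1 : f₁ u ⬝ᵥ g₁ v = ρ * σ * (f u ⬝ᵥ g v + (Complex.exp (x - y) - 1) * (f u i * g v i)) := by
    have e2 : (Complex.exp (x - y) - 1) * (f u i * g v i) =
        ∑ k, if k = i then (Complex.exp (x - y) - 1) * (f u k * g v k) else 0 := by
      rw [Finset.sum_ite_eq' Finset.univ i]; simp
    rw [e2, dotProduct, dotProduct, ← Finset.sum_add_distrib, Finset.mul_sum]
    refine Finset.sum_congr rfl fun k _ => ?_
    rw [hf, hg]
    split_ifs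
    · rw [sub_eq_add_neg x y, Complex.exp_add]; ring
    · ring
  rw [e1]
  ring

namespace Domain

theorem powerOp_apply {Ω : Domain} {d : ℕ} {a b : ℂ → ℂ}
    (ha : ∀ l < d, MemLp (fun u => u ^ l * a u) 2 Ω.absMeasure)
    (hb : ∀ l < d, MemLp (fun u => u ^ l * b u) 2 Ω.absMeasure) (φ : Ω.Hilb) :
    ∀ᵐ u ∂Ω.absMeasure,
      Ω.IntegrableOver (fun v =>
        (∑ l ∈ Finset.range d, u ^ l * v ^ (d - 1 - l)) * (a u * b v) * φ v) ∧
      Ω.powerOp d a b φ u = Ω.integral fun v =>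
        (∑ l ∈ Finset.range d, u ^ l * v ^ (d - 1 - l)) * (a u * b v) * φ v := by
  have h1 : ∀ l ∈ Finset.range d, Ω.IntegrableOver fun v => v ^ (d - 1 - l) * b v * φ v :=
    fun l hl => integrableOver_mul (hb _ (by have := Finset.mem_range.1 hl; omega)) (Lp.memLp φ)
  have h2 : Ω.powerOp d a b φ = ∑ l ∈ Finset.range d,
      (Ω.integral fun v => v ^ (d - 1 - l) * b v * φ v) • Ω.toHilb fun u => u ^ l * a u := by
    simp only [powerOp, sum_apply, InnerProductSpace.rankOne_apply]
    refine Finset.sum_congr rfl fun l hl => ?_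
    rw [inner_toHilb (hb _ (by have := Finset.mem_range.1 hl; omega))]
  have h3 : ∀ᵐ u ∂Ω.absMeasure, ∀ l, l < d → ((Ω.integral fun v => v ^ (d - 1 - l) * b v * φ v) •
      Ω.toHilb fun u => u ^ l * a u) u =
        (Ω.integral fun v => v ^ (d - 1 - l) * b v * φ v) * (u ^ l * a u) := by
    refine ae_all_iff.2 fun l => ?_
    by_cases hl : l < d
    · filter_upwards [coeFn_toHilb (ha l hl),
        Lp.coeFn_smul (Ω.integral fun v => v ^ (d - 1 - l) * b v * φ v)
          (Ω.toHilb fun u => u ^ l * a u)] with u h4 h5 _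
      rw [h5, Pi.smul_apply, h4, smul_eq_mul]
    · exact Eventually.of_forall fun u h => absurd h hl
  filter_upwards [h3, Lp.coeFn_finsetSum (Finset.range d)
    (fun l => (Ω.integral fun v => v ^ (d - 1 - l) * b v * φ v) •
      Ω.toHilb fun u => u ^ l * a u)] with u h4 h5
  have e1 : (fun v => (∑ l ∈ Finset.range d, u ^ l * v ^ (d - 1 - l)) * (a u * b v) * φ v) =
      fun v => ∑ l ∈ Finset.range d, u ^ l * a u * (v ^ (d - 1 - l) * b v * φ v) := by
    funext v
    rw [Finset.sum_mul, Finset.sum_mul]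
    exact Finset.sum_congr rfl fun l _ => by ring
  have h6 : ∀ l ∈ Finset.range d,
      Ω.IntegrableOver fun v => u ^ l * a u * (v ^ (d - 1 - l) * b v * φ v) := fun l hl => by
    refine (Integrable.const_mul (h1 l hl) (u ^ l * a u)).congr (Eventually.of_forall fun v => ?_)
    dsimp only
    ring
  refine ⟨?_, ?_⟩
  · rw [e1]
    refine (integrable_finsetSum _ h6).congr (Eventually.of_forall fun v => ?_)
    simp only [Finset.sum_mul]
  · rw [e1, integral_sum _ h6, h2, h5, Finset.sum_apply]
    refine Finset.sum_congr rfl fun l hl => ?_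
    rw [h4 l (Finset.mem_range.1 hl), integral_mul_left, mul_comm]

end Domain

namespace IsIntegrableOp

variable {Ω : Domain} {m : ℕ} {H : Ω.Hilb →L[ℂ] Ω.Hilb} {f g : ℂ → Fin (m + 1) → ℂ}

/-- Two vector pairs `(f, g)` and `(f₁, g₁)` are conjugate by `r` and a power exponential in the
component `i`. -/
structure IsConj (Ω : Domain) (d : ℕ) (i : Fin (m + 1)) (r : ℂ → ℂ) (h : ℝ)
    (f g f₁ g₁ : ℂ → Fin (m + 1) → ℂ) : Prop where
  measurable : AEStronglyMeasurable r Ω.absMeasure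
  ne_zero : ∀ᵐ u ∂Ω.absMeasure, r u ≠ 0
  left : ∀ᵐ u ∂Ω.absMeasure, ∀ k,
    f₁ u k = r u * ((if k = i then Complex.exp (h * u ^ d) else 1) * f u k)
  right : ∀ᵐ v ∂Ω.absMeasure, ∀ k,
    g₁ v k = (r v)⁻¹ * ((if k = i then Complex.exp (-(h * v ^ d)) else 1) * g v k)

/-- First order expansion of the conjugated kernel, with an error quadratic in h on the disk of
radius N. The conjugation by r is undone exactly, not expanded. -/
theorem norm_conj_sub_le (hH : IsIntegrableOp H f g) {H₁ : Ω.Hilb →L[ℂ] Ω.Hilb}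
    {f₁ g₁ : ℂ → Fin (m + 1) → ℂ} (hH₁ : IsIntegrableOp H₁ f₁ g₁) {d : ℕ} {i : Fin (m + 1)}
    {r : ℂ → ℂ} {h : ℝ} (hc : IsConj Ω d i r h f g f₁ g₁)
    (hf : ∀ l < d, MemLp (fun u => u ^ l * f u i) 2 Ω.absMeasure)
    (hg : ∀ l < d, MemLp (fun u => u ^ l * g u i) 2 Ω.absMeasure)
    {N : ℝ} (hh : |h| * (geomBound d N * (2 * N)) ≤ 1) {φ η : Ω.Hilb}
    (hη : ∀ᵐ v ∂Ω.absMeasure, η v = (r v)⁻¹ * φ v)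
    (hφ : ∀ᵐ v ∂Ω.absMeasure, φ v ≠ 0 → ‖v‖ ≤ N) :
    ∀ᵐ u ∂Ω.absMeasure, ‖u‖ ≤ N →
      ‖(r u)⁻¹ * H₁ φ u - H η u -
          h * Ω.powerOp d (fun u => f u i) (fun u => g u i) η u‖ ≤
        |h| ^ 2 * (geomBound d N ^ 2 * (2 * N)) * ‖f u i‖ *
          ∫ v, ‖g v i‖ * ‖η v‖ ∂Ω.absMeasure := by
  filter_upwards [hH.kernel η, hH₁.kernel φ, Domain.powerOp_apply hf hg η, hc.left, hc.ne_zero,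
    hH.orthogonal] with u h1 h2 h3 h4 h5 h6 hu
  have hN : 0 ≤ N := (norm_nonneg u).trans hu
  have i2 : Ω.IntegrableOver fun v => (r u)⁻¹ * (integrableKernel f₁ g₁ u v * φ v) := by
    refine (Integrable.const_mul h2.1 (r u)⁻¹).congr (Eventually.of_forall fun v => ?_)
    dsimp only
    ring
  have i3 : Ω.IntegrableOver fun v => (h : ℂ) *
      ((∑ l ∈ Finset.range d, u ^ l * v ^ (d - 1 - l)) * (f u i * g v i) * η v) := by
    refine (Integrable.const_mul h3.1 (h : ℂ)).congr (Eventually.of_forall fun v => ?_)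
    dsimp only
    ring
  have i23 : Ω.IntegrableOver fun v => (r u)⁻¹ * (integrableKernel f₁ g₁ u v * φ v) -
      integrableKernel f g u v * η v := by
    refine (Integrable.sub i2 h1.1).congr (Eventually.of_forall fun v => ?_)
    simp only [Pi.sub_apply]
    ring
  rw [h1.2, h2.2, h3.2, ← Domain.integral_mul_left, ← Domain.integral_mul_left,
    ← Domain.integral_sub i2 h1.1, ← Domain.integral_sub i23 i3, Domain.integral,
    ← MeasureTheory.integral_const_mul]
  refine norm_integral_le_of_norm_le
    (((hH.memLp_g i).norm.integrable_mul (Lp.memLp η).norm).const_mul _) ?_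
  filter_upwards [hη, hφ, hc.right, hc.ne_zero, Ω.norm_phase_le] with v k1 k2 k3 k4 k5
  rw [norm_mul]
  refine (mul_le_of_le_one_right (norm_nonneg _) k5).trans ?_
  have e1 : (r u)⁻¹ * (integrableKernel f₁ g₁ u v * φ v) = (integrableKernel f g u v +
      (Complex.exp (h * u ^ d - h * v ^ d) - 1) / (u - v) * (f u i * g v i)) * η v := by
    rw [integrableKernel_conj h4 k3, k1]
    field_simp
  have e2 : (r u)⁻¹ * (integrableKernel f₁ g₁ u v * φ v) - integrableKernel f g u v * η v -
      (h : ℂ) * ((∑ l ∈ Finset.range d, u ^ l * v ^ (d - 1 - l)) * (f u i * g v i) * η v) =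
      ((Complex.exp (h * u ^ d - h * v ^ d) - 1) / (u - v) -
        h * ∑ l ∈ Finset.range d, u ^ l * v ^ (d - 1 - l)) * (f u i * g v i) * η v := by
    rw [e1]; ring
  rw [e2]
  by_cases hv : φ v = 0
  · rw [k1, hv]; simp
  -- The geometric sum need not vanish on the diagonal, but fᵢ gᵢ does.
  by_cases huv : u = v
  · subst huv
    rw [h6 i]
    simp only [mul_zero, zero_mul, norm_zero]
    have := geomBound_nonneg d hN
    positivity
  · have e3 := norm_exp_div_sub_le (d := d) hu (k2 hv) huv hh
    rw [norm_mul, norm_mul, norm_mul (f u i)]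
    calc _ ≤ |h| ^ 2 * (geomBound d N ^ 2 * (2 * N)) * (‖f u i‖ * ‖g v i‖) * ‖η v‖ := by gcongr
      _ = _ := by ring

end IsIntegrableOp

namespace Domain

variable {Ω : Domain}

theorem tendsto_mulOp_apply {b : ℕ → ℂ → ℂ} {b' : ℂ → ℂ} (hb : ∀ j, MemLp (b j) ∞ Ω.absMeasure)
    (hb' : MemLp b' ∞ Ω.absMeasure) {C : ℝ} (hC0 : 0 ≤ C) (hC : ∀ j u, ‖b j u‖ ≤ C)
    (h : ∀ᵐ u ∂Ω.absMeasure, Tendsto (fun j => b j u) atTop (𝓝 (b' u))) {φ : ℕ → Ω.Hilb}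
    {φ' : Ω.Hilb} (hφ : Tendsto φ atTop (𝓝 φ')) :
    Tendsto (fun j => Ω.mulOp (b j) (hb j) (φ j)) atTop (𝓝 (Ω.mulOp b' hb' φ')) := by
  have h1 := tendsto_mulOp hb hb' (fun j => Eventually.of_forall (hC j)) h φ'
  have h2 : Tendsto (fun j => Ω.mulOp (b j) (hb j) (φ j - φ')) atTop (𝓝 0) := by
    rw [tendsto_iff_norm_sub_tendsto_zero] at hφ
    refine squeeze_zero_norm (fun j => ?_) (by simpa using hφ.const_mul C)
    exact (Ω.mulOp (b j) (hb j)).le_of_opNorm_le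
      (norm_mulOp_le (hb j) hC0 (Eventually.of_forall (hC j))) _
  simpa using h2.add h1

theorem memLp_indicator {S : Set ℂ} (hS : NullMeasurableSet S Ω.absMeasure) {F : ℂ → ℂ}
    (hF : AEStronglyMeasurable F Ω.absMeasure) {C : ℝ} (h : ∀ u, ‖S.indicator F u‖ ≤ C) :
    MemLp (S.indicator F) ∞ Ω.absMeasure :=
  memLp_top_of_bound (hF.indicator₀ hS) C (Eventually.of_forall h)

theorem norm_indicator_le {S : Set ℂ} {F : ℂ → ℂ} {C : ℝ} (hC : 0 ≤ C) (h : ∀ u ∈ S, ‖F u‖ ≤ C)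
    (u : ℂ) : ‖S.indicator F u‖ ≤ C := by
  by_cases hu : u ∈ S
  · rw [Set.indicator_of_mem hu]; exact h u hu
  · rw [Set.indicator_of_notMem hu, norm_zero]; exact hC

theorem memLp_indicator_one {S : Set ℂ} (hS : NullMeasurableSet S Ω.absMeasure) :
    MemLp (S.indicator fun _ => (1 : ℂ)) ∞ Ω.absMeasure :=
  memLp_indicator hS aestronglyMeasurable_const
    (norm_indicator_le zero_le_one fun _ _ => norm_one.le)

/-- The projection onto the functions that are supported in `S`. -/
def proj {S : Set ℂ} (hS : NullMeasurableSet S Ω.absMeasure) : Ω.Hilb →L[ℂ] Ω.Hilb :=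
  Ω.mulOp _ (memLp_indicator_one hS)

end Domain

namespace IsIntegrableOp

variable {Ω : Domain} {m : ℕ} {H : Ω.Hilb →L[ℂ] Ω.Hilb} {f g : ℂ → Fin (m + 1) → ℂ}

/-- On S, Hⱼ is r (H + h L) r⁻¹ up to O(h²). Hence (Hⱼ - H)/h splits into ((r - 1)/h) H r⁻¹ - H (1 -
r⁻¹)/h + r L r⁻¹ plus an error O(h), and r → 1 while both quotients tend to the same function a. The
bounds on S allow dominated convergence for the multiplication operators. -/
theorem exists_truncated_commutator (hH : IsIntegrableOp H f g) {Hj : ℕ → Ω.Hilb →L[ℂ] Ω.Hilb}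
    {fj gj : ℕ → ℂ → Fin (m + 1) → ℂ} (hHj : ∀ j, IsIntegrableOp (Hj j) (fj j) (gj j)) {d : ℕ}
    {i : Fin (m + 1)} {r : ℕ → ℂ → ℂ} {h : ℕ → ℝ} (h0 : ∀ j, h j ≠ 0) (h1 : ∀ j, |h j| ≤ 1)
    (ht : Tendsto h atTop (𝓝 0))
    (hc : ∀ j, IsConj Ω d i (r j) (h j) f g (fj j) (gj j))
    (hrd : ∀ᵐ u ∂Ω.absMeasure, ∃ a, Tendsto (fun j => (r j u - 1) / h j) atTop (𝓝 a))
    (hf : ∀ l < d, MemLp (fun u => u ^ l * f u i) 2 Ω.absMeasure)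
    (hg : ∀ l < d, MemLp (fun u => u ^ l * g u i) 2 Ω.absMeasure)
    {H' : Ω.Hilb →L[ℂ] Ω.Hilb}
    (hH' : Tendsto (fun j => ((h j : ℝ) : ℂ)⁻¹ • (Hj j - H)) atTop (𝓝 H'))
    {S : Set ℂ} (hS : NullMeasurableSet S Ω.absMeasure) {N : ℝ} (hN : 0 ≤ N)
    (hSN : ∀ u ∈ S, ‖u‖ ≤ N)
    (hSr : ∀ u ∈ S, ∀ j, ‖r j u - 1‖ ≤ N * |h j| ∧ ‖(r j u)⁻¹ - 1‖ ≤ N * |h j|) :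
    ∃ a : Ω.Hilb →L[ℂ] Ω.Hilb,
      Domain.proj hS * H' * Domain.proj hS =
        a * (Domain.proj hS * H * Domain.proj hS) - (Domain.proj hS * H * Domain.proj hS) * a +
        Domain.proj hS * Ω.powerOp d (fun u => f u i) (fun u => g u i) * Domain.proj hS := by
  set P : Ω.Hilb →L[ℂ] Ω.Hilb := Domain.proj hS with hP
  set L := Ω.powerOp d (fun u => f u i) (fun u => g u i) with hL
  have hcn : ∀ j, ((h j : ℝ) : ℂ) ≠ 0 := fun j => by exact_mod_cast h0 j
  have hpos : ∀ j, 0 < |h j| := fun j => abs_pos.2 (h0 j)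
  have hnorm : ∀ j, ‖((h j : ℝ) : ℂ)‖ = |h j| := fun j => by
    rw [Complex.norm_real, Real.norm_eq_abs]
  let b : ℕ → ℂ → ℂ := fun j => S.indicator fun u => (r j u - 1) / h j
  let c : ℕ → ℂ → ℂ := fun j => S.indicator fun u => (1 - (r j u)⁻¹) / h j
  let ρ : ℕ → ℂ → ℂ := fun j => S.indicator fun u => r j u
  let σ : ℕ → ℂ → ℂ := fun j => S.indicator fun u => (r j u)⁻¹
  have hr1 : ∀ j, ∀ u ∈ S, ‖r j u‖ ≤ 1 + N := fun j u hu => by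
    have e1 := (hSr u hu j).1
    have e2 := norm_add_le (r j u - 1) 1
    rw [sub_add_cancel, norm_one] at e2
    nlinarith [h1 j]
  have hr2 : ∀ j, ∀ u ∈ S, ‖(r j u)⁻¹‖ ≤ 1 + N := fun j u hu => by
    have e1 := (hSr u hu j).2
    have e2 := norm_add_le ((r j u)⁻¹ - 1) 1
    rw [sub_add_cancel, norm_one] at e2
    nlinarith [h1 j]
  have bb : ∀ j u, ‖b j u‖ ≤ N := fun j => Domain.norm_indicator_le hN fun u hu => by
    rw [norm_div, hnorm, div_le_iff₀ (hpos j)]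
    exact (hSr u hu j).1
  have bc : ∀ j u, ‖c j u‖ ≤ N := fun j => Domain.norm_indicator_le hN fun u hu => by
    rw [norm_div, hnorm, div_le_iff₀ (hpos j), norm_sub_rev]
    exact (hSr u hu j).2
  have bρ : ∀ j u, ‖ρ j u‖ ≤ 1 + N := fun j => Domain.norm_indicator_le (by positivity) (hr1 j)
  have bσ : ∀ j u, ‖σ j u‖ ≤ 1 + N := fun j => Domain.norm_indicator_le (by positivity) (hr2 j)
  have minv : ∀ j, AEStronglyMeasurable (fun u => (r j u)⁻¹) Ω.absMeasure := fun j =>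
    (hc j).measurable.aemeasurable.inv.aestronglyMeasurable
  have mb : ∀ j, MemLp (b j) ∞ Ω.absMeasure := fun j => by
    refine Domain.memLp_indicator hS ?_ (bb j)
    simp only [div_eq_mul_inv]
    exact ((hc j).measurable.sub aestronglyMeasurable_const).mul_const _
  have mc : ∀ j, MemLp (c j) ∞ Ω.absMeasure := fun j => by
    refine Domain.memLp_indicator hS ?_ (bc j)
    simp only [div_eq_mul_inv]
    exact (aestronglyMeasurable_const.sub (minv j)).mul_const _
  have mρ : ∀ j, MemLp (ρ j) ∞ Ω.absMeasure := fun j =>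
    Domain.memLp_indicator hS (hc j).measurable (bρ j)
  have mσ : ∀ j, MemLp (σ j) ∞ Ω.absMeasure := fun j =>
    Domain.memLp_indicator hS (minv j) (bσ j)
  let a : ℂ → ℂ := S.indicator fun u => limUnder atTop fun j => (r j u - 1) / h j
  have hhab : Tendsto (fun j => N * |h j|) atTop (𝓝 0) := by
    have e := ht.abs.const_mul N
    simpa only [abs_zero, mul_zero] using e
  have tr1 : ∀ u ∈ S, Tendsto (fun j => r j u) atTop (𝓝 1) := fun u hu =>
    tendsto_iff_norm_sub_tendsto_zero.2
      (squeeze_zero (fun _ => norm_nonneg _) (fun j => (hSr u hu j).1) hhab)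
  have tr2 : ∀ u ∈ S, Tendsto (fun j => (r j u)⁻¹) atTop (𝓝 1) := fun u hu =>
    tendsto_iff_norm_sub_tendsto_zero.2
      (squeeze_zero (fun _ => norm_nonneg _) (fun j => (hSr u hu j).2) hhab)
  have tind : ∀ {F : ℕ → ℂ → ℂ} {F' : ℂ → ℂ} {u : ℂ},
      (u ∈ S → Tendsto (fun j => F j u) atTop (𝓝 (F' u))) →
      Tendsto (fun j => S.indicator (F j) u) atTop (𝓝 (S.indicator F' u)) := by
    intro F F' u hF
    by_cases hu : u ∈ S
    · simpa only [Set.indicator_of_mem hu] using hF hu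
    · simpa only [Set.indicator_of_notMem hu] using tendsto_const_nhds
  have tb : ∀ᵐ u ∂Ω.absMeasure, Tendsto (fun j => b j u) atTop (𝓝 (a u)) := by
    filter_upwards [hrd] with u hu
    exact tind fun _ => tendsto_nhds_limUnder hu
  -- Because (1 - r⁻¹)/h = ((r - 1)/h) r⁻¹ and r → 1, the quotients on the left and on the right of
  -- H have the same limit.
  have tc : ∀ᵐ u ∂Ω.absMeasure, Tendsto (fun j => c j u) atTop (𝓝 (a u)) := by
    filter_upwards [hrd, ae_all_iff.2 fun j => (hc j).ne_zero] with u hu hne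
    refine tind fun huS => ?_
    have e := (tendsto_nhds_limUnder hu).mul (tr2 u huS)
    rw [mul_one] at e
    refine e.congr fun j => ?_
    have := hne j
    have := hcn j
    field_simp
  have tρ : ∀ᵐ u ∂Ω.absMeasure,
      Tendsto (fun j => ρ j u) atTop (𝓝 (S.indicator (fun _ => (1 : ℂ)) u)) :=
    Eventually.of_forall fun u => tind (F' := fun _ => 1) (tr1 u)
  have tσ : ∀ᵐ u ∂Ω.absMeasure,
      Tendsto (fun j => σ j u) atTop (𝓝 (S.indicator (fun _ => (1 : ℂ)) u)) :=
    Eventually.of_forall fun u => tind (F' := fun _ => 1) (tr2 u)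
  have ma : MemLp a ∞ Ω.absMeasure := by
    refine memLp_top_of_bound (aestronglyMeasurable_of_tendsto_ae atTop (fun j => (mb j).1) tb) N ?_
    filter_upwards [tb] with u hu
    exact le_of_tendsto hu.norm (Eventually.of_forall fun j => bb j u)
  let A := Ω.mulOp a ma
  have hPc := fun φ => Domain.coeFn_mulOp (Domain.memLp_indicator_one hS) φ
  have hAP : A * P = A := by
    ext1 φ
    refine Lp.ext ?_
    filter_upwards [Domain.coeFn_mulOp ma (P φ), hPc φ, Domain.coeFn_mulOp ma φ] with u k1 k2 k3
    change (A (P φ)) u = (A φ) u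
    rw [k1, k3]
    change a u * (Domain.proj hS φ) u = _
    rw [Domain.proj, k2]
    by_cases hu : u ∈ S <;> simp [a, hu]
  have hPA : P * A = A := by
    have := Domain.mulOp_comm (Domain.memLp_indicator_one hS) ma
    change P * A = A * P at this
    rw [this, hAP]
  refine ⟨A, ?_⟩
  have e1 : A * (P * H * P) = A * H * P := by rw [← mul_assoc, ← mul_assoc, hAP]
  have e2 : P * H * P * A = P * H * A := by rw [mul_assoc, hPA]
  rw [e1, e2]
  ext1 φ
  change P (H' (P φ)) = A (H (P φ)) - P (H (A φ)) + P (L (P φ))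
  let η : ℕ → Ω.Hilb := fun j => Ω.mulOp (σ j) (mσ j) φ
  have tη : Tendsto η atTop (𝓝 (P φ)) :=
    Domain.tendsto_mulOp_apply mσ _ (by positivity) bσ tσ tendsto_const_nhds
  let x : ℕ → Ω.Hilb := fun j => P ((((h j : ℝ) : ℂ)⁻¹ • (Hj j - H)) (P φ))
  let y : ℕ → Ω.Hilb := fun j => Ω.mulOp (b j) (mb j) (H (η j)) - P (H (Ω.mulOp (c j) (mc j) φ)) +
    Ω.mulOp (ρ j) (mρ j) (L (η j))
  have tx : Tendsto x atTop (𝓝 (P (H' (P φ)))) := by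
    have e : Continuous fun T : Ω.Hilb →L[ℂ] Ω.Hilb => P (T (P φ)) := by fun_prop
    exact (e.tendsto H').comp hH'
  have ty : Tendsto y atTop (𝓝 (A (H (P φ)) - P (H (A φ)) + P (L (P φ)))) := by
    refine (Tendsto.sub ?_ ?_).add ?_
    · exact Domain.tendsto_mulOp_apply mb ma hN bb tb ((H.continuous.tendsto _).comp tη)
    · exact ((P * H).continuous.tendsto (A φ)).comp
        (Domain.tendsto_mulOp_apply mc ma hN bc tc tendsto_const_nhds)
    · exact Domain.tendsto_mulOp_apply mρ _ (by positivity) bρ tρ ((L.continuous.tendsto _).comp tη)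
  have txy : Tendsto (fun j => x j - y j) atTop (𝓝 0) := by
    set I := (1 + N) * ∫ v, ‖g v i‖ * ‖φ v‖ ∂Ω.absMeasure with hI
    -- One factor 1 + N bounds r and the one in I bounds r⁻¹; dividing the quadratic error by h
    -- leaves K |h|.
    set K := (1 + N) * (geomBound d N ^ 2 * (2 * N)) * I with hK
    let w : Ω.Hilb := (hH.memLp_f i).toLp
    have hlim : Tendsto (fun j => K * |h j| * ‖w‖) atTop (𝓝 0) := by
      have e := (ht.abs.const_mul K).mul_const ‖w‖
      simpa only [abs_zero, mul_zero, zero_mul] using e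
    refine squeeze_zero_norm' ?_ hlim
    have hsmall : ∀ᶠ j in atTop, |h j| * (geomBound d N * (2 * N)) ≤ 1 := by
      have e := ht.abs.mul_const (geomBound d N * (2 * N))
      rw [abs_zero, zero_mul] at e
      exact e.eventually (ge_mem_nhds zero_lt_one)
    filter_upwards [hsmall] with j hj
    have hIj : ∫ v, ‖g v i‖ * ‖η j v‖ ∂Ω.absMeasure ≤ I := by
      rw [hI, ← MeasureTheory.integral_const_mul]
      refine integral_mono_ae ((hH.memLp_g i).norm.integrable_mul (Lp.memLp (η j)).norm)
        (((hH.memLp_g i).norm.integrable_mul (Lp.memLp φ).norm).const_mul _) ?_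
      filter_upwards [Domain.coeFn_mulOp (mσ j) φ] with v hv
      rw [hv, norm_mul]
      calc ‖g v i‖ * (‖σ j v‖ * ‖φ v‖) ≤ ‖g v i‖ * ((1 + N) * ‖φ v‖) := by
            gcongr; exact bσ j v
        _ = _ := by ring
    have hηP : ∀ᵐ v ∂Ω.absMeasure, η j v = (r j v)⁻¹ * P φ v := by
      filter_upwards [Domain.coeFn_mulOp (mσ j) φ, hPc φ] with v k1 k2
      rw [k1, hP, Domain.proj, k2]
      by_cases hv : v ∈ S <;> simp [σ, hv]
    have hsupp : ∀ᵐ v ∂Ω.absMeasure, P φ v ≠ 0 → ‖v‖ ≤ N := by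
      filter_upwards [hPc φ] with v k1 k2
      rw [hP, Domain.proj, k1] at k2
      by_contra hv
      exact k2 (by rw [Set.indicator_of_notMem fun hvS => hv (hSN v hvS), zero_mul])
    have hcφ : Ω.mulOp (c j) (mc j) φ = ((h j : ℝ) : ℂ)⁻¹ • (P φ - η j) := by
      refine Lp.ext ?_
      filter_upwards [Domain.coeFn_mulOp (mc j) φ, Domain.coeFn_mulOp (mσ j) φ, hPc φ,
        Lp.coeFn_smul ((h j : ℝ) : ℂ)⁻¹ (P φ - η j), Lp.coeFn_sub (P φ) (η j)]
        with v k1 k2 k3 k4 k5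
      rw [k1, k4, Pi.smul_apply, k5, Pi.sub_apply, k2]
      change _ = _ • ((Domain.proj hS φ) v - _)
      rw [Domain.proj, k3, smul_eq_mul]
      by_cases hv : v ∈ S
      · simp only [c, σ, Set.indicator_of_mem hv]; ring
      · simp [c, σ, hv]
    have main := hH.norm_conj_sub_le (hHj j) (hc j) hf hg hj hηP hsupp
    refine Lp.norm_le_mul_norm_of_ae_le_mul ?_
    have hHc : H (Ω.mulOp (c j) (mc j) φ) = ((h j : ℝ) : ℂ)⁻¹ • (H (P φ) - H (η j)) := by
      rw [hcφ, map_smul, map_sub]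
    have hxj : x j = P (((h j : ℝ) : ℂ)⁻¹ • (Hj j (P φ) - H (P φ))) := rfl
    filter_upwards [main, (hH.memLp_f i).coeFn_toLp, Lp.coeFn_sub (x j) (y j),
      Lp.coeFn_add (Ω.mulOp (b j) (mb j) (H (η j)) - P (H (Ω.mulOp (c j) (mc j) φ)))
        (Ω.mulOp (ρ j) (mρ j) (L (η j))),
      Lp.coeFn_sub (Ω.mulOp (b j) (mb j) (H (η j))) (P (H (Ω.mulOp (c j) (mc j) φ))),
      Domain.coeFn_mulOp (mb j) (H (η j)), Domain.coeFn_mulOp (mρ j) (L (η j)),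
      hPc (H (Ω.mulOp (c j) (mc j) φ)),
      hPc (((h j : ℝ) : ℂ)⁻¹ • (Hj j (P φ) - H (P φ))),
      Lp.coeFn_smul ((h j : ℝ) : ℂ)⁻¹ (Hj j (P φ) - H (P φ)),
      Lp.coeFn_sub (Hj j (P φ)) (H (P φ)),
      Lp.coeFn_smul ((h j : ℝ) : ℂ)⁻¹ (H (P φ) - H (η j)),
      Lp.coeFn_sub (H (P φ)) (H (η j)), (hc j).ne_zero]
      with u k0 k1 k2 k3 k4 k5 k6 k7 k8 k9 k10 k11 k12 k13
    have ex : x j u = S.indicator (fun _ => (1 : ℂ)) u *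
        (((h j : ℝ) : ℂ)⁻¹ * (Hj j (P φ) u - H (P φ) u)) := by
      rw [hxj]
      change (Ω.mulOp _ _ _) u = _
      rw [k8, k9, Pi.smul_apply, k10, Pi.sub_apply, smul_eq_mul]
    have ey : y j u = b j u * H (η j) u - S.indicator (fun _ => (1 : ℂ)) u *
        (((h j : ℝ) : ℂ)⁻¹ * (H (P φ) u - H (η j) u)) + ρ j u * L (η j) u := by
      change (Ω.mulOp (b j) (mb j) (H (η j)) - P (H (Ω.mulOp (c j) (mc j) φ)) +
        Ω.mulOp (ρ j) (mρ j) (L (η j)) : Ω.Hilb) u = _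
      have k7' : P (H (Ω.mulOp (c j) (mc j) φ)) u =
          S.indicator (fun _ => (1 : ℂ)) u * H (Ω.mulOp (c j) (mc j) φ) u := k7
      rw [k3, Pi.add_apply, k4, Pi.sub_apply, k5, k6, k7', hHc, k11, Pi.smul_apply, k12,
        Pi.sub_apply, smul_eq_mul]
    rw [k2, Pi.sub_apply, ex, ey, k1]
    have hI0 : 0 ≤ I := by
      rw [hI]
      exact mul_nonneg (by positivity) (integral_nonneg fun v => by positivity)
    by_cases hu : u ∈ S
    · simp only [b, ρ, Set.indicator_of_mem hu]
      have e3 : 1 * (((h j : ℝ) : ℂ)⁻¹ * (Hj j (P φ) u - H (P φ) u)) -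
          ((r j u - 1) / h j * H (η j) u - 1 * (((h j : ℝ) : ℂ)⁻¹ * (H (P φ) u - H (η j) u)) +
            r j u * L (η j) u) = ((h j : ℝ) : ℂ)⁻¹ * r j u *
          ((r j u)⁻¹ * Hj j (P φ) u - H (η j) u - h j * L (η j) u) := by
        have := hcn j
        field_simp
        ring
      rw [e3, norm_mul, norm_mul, norm_inv, hnorm]
      have e4 : ‖(r j u)⁻¹ * Hj j (P φ) u - H (η j) u - h j * L (η j) u‖ ≤
          |h j| ^ 2 * (geomBound d N ^ 2 * (2 * N)) * ‖f u i‖ * I :=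
        (k0 (hSN u hu)).trans (by gcongr)
      calc |h j|⁻¹ * ‖r j u‖ * _ ≤ |h j|⁻¹ * (1 + N) *
            (|h j| ^ 2 * (geomBound d N ^ 2 * (2 * N)) * ‖f u i‖ * I) := by
            gcongr; exact hr1 j u hu
        _ = K * |h j| * ‖f u i‖ := by
            have := (hpos j).ne'
            rw [hK]; field_simp
    · have := geomBound_nonneg d hN
      simp only [b, ρ, Set.indicator_of_notMem hu, zero_mul, sub_zero, add_zero, norm_zero]
      have hK0 : 0 ≤ K := by positivity
      positivity
  have tfin : Tendsto (fun j => x j - y j) atTop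
      (𝓝 (P (H' (P φ)) - (A (H (P φ)) - P (H (A φ)) + P (L (P φ))))) := tx.sub ty
  exact sub_eq_zero.1 (tendsto_nhds_unique tfin txy)

end IsIntegrableOp

namespace IsIntegrableOp

variable {Ω : Domain} {m : ℕ} {H : Ω.Hilb →L[ℂ] Ω.Hilb} {f g : ℂ → Fin (m + 1) → ℂ}

open ContinuousLinearMap in
theorem trace_derivative (hH : IsIntegrableOp H f g) {Hj : ℕ → Ω.Hilb →L[ℂ] Ω.Hilb}
    {fj gj : ℕ → ℂ → Fin (m + 1) → ℂ} (hHj : ∀ j, IsIntegrableOp (Hj j) (fj j) (gj j)) {d : ℕ}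
    {i : Fin (m + 1)} {r : ℕ → ℂ → ℂ} {h : ℕ → ℝ} (h0 : ∀ j, h j ≠ 0) (h1 : ∀ j, |h j| ≤ 1)
    (ht : Tendsto h atTop (𝓝 0))
    (hc : ∀ j, IsConj Ω d i (r j) (h j) f g (fj j) (gj j))
    (hrd : ∀ᵐ u ∂Ω.absMeasure, ∃ a, Tendsto (fun j => (r j u - 1) / h j) atTop (𝓝 a))
    (hf : ∀ l < d, MemLp (fun u => u ^ l * f u i) 2 Ω.absMeasure)
    (hg : ∀ l < d, MemLp (fun u => u ^ l * g u i) 2 Ω.absMeasure)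
    {H' : Ω.Hilb →L[ℂ] Ω.Hilb}
    (hH' : Tendsto (fun j => ((h j : ℝ) : ℂ)⁻¹ • (Hj j - H)) atTop (𝓝 H'))
    (tH : IsTraceClass H) (tH' : IsTraceClass H') (hu : IsUnit (1 - H)) :
    trace (Ring.inverse (1 - H) * H') =
      trace (Ring.inverse (1 - H) * Ω.powerOp d (fun u => f u i) (fun u => g u i)) := by
  -- One index n serves as radius, as bound for the difference quotients of r and r⁻¹, and as the
  -- place in the sequence from which the bounds are required. The sets are only null measurable
  -- since r is only measurable almost everywhere.
  let S : ℕ → Set ℂ := fun n => {u | ‖u‖ ≤ n ∧ ∀ j, n ≤ j →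
    ‖r j u - 1‖ ≤ n * |h j| ∧ ‖(r j u)⁻¹ - 1‖ ≤ n * |h j|}
  have hS : ∀ n, NullMeasurableSet (S n) Ω.absMeasure := fun n => by
    have e : S n = {u | ‖u‖ ≤ n} ∩ ⋂ j, ⋂ (_ : n ≤ j),
        ({u | ‖r j u - 1‖ ≤ n * |h j|} ∩ {u | ‖(r j u)⁻¹ - 1‖ ≤ n * |h j|}) := by
      ext u; simp [S]
    rw [e]
    refine (nullMeasurableSet_le continuous_norm.aemeasurable aemeasurable_const).inter
      (NullMeasurableSet.iInter fun j => NullMeasurableSet.iInter fun _ => ?_)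
    have mr := (hc j).measurable.aemeasurable
    exact (nullMeasurableSet_le (mr.sub_const 1).norm aemeasurable_const).inter
      (nullMeasurableSet_le (mr.inv.sub_const 1).norm aemeasurable_const)
  have hSev : ∀ᵐ u ∂Ω.absMeasure, ∀ᶠ n in atTop, u ∈ S n := by
    filter_upwards [hrd, ae_all_iff.2 fun j => (hc j).ne_zero] with u ⟨a, ha⟩ hne
    have hcn : ∀ j, ((h j : ℝ) : ℂ) ≠ 0 := fun j => by exact_mod_cast h0 j
    have tr : Tendsto (fun j => r j u) atTop (𝓝 1) := by
      have e := (ha.mul ((Complex.continuous_ofReal.tendsto 0).comp ht)).add_const 1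
      simp only [Complex.ofReal_zero, mul_zero, zero_add] at e
      refine e.congr fun j => ?_
      simp only [Function.comp_apply]
      rw [div_mul_cancel₀ _ (hcn j), sub_add_cancel]
    have ha' := ha.mul (tr.inv₀ one_ne_zero)
    obtain ⟨B, hB⟩ := ha.norm.bddAbove_range
    obtain ⟨B', hB'⟩ := ha'.norm.bddAbove_range
    obtain ⟨n₀, hn₀⟩ := exists_nat_ge (max ‖u‖ (max B B'))
    filter_upwards [eventually_ge_atTop n₀] with n hn
    have hn' : max ‖u‖ (max B B') ≤ n := hn₀.trans (by exact_mod_cast hn)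
    have hn1 : ‖u‖ ≤ n := (le_max_left _ _).trans hn'
    have hn2 : B ≤ n := ((le_max_left _ _).trans (le_max_right _ _)).trans hn'
    have hn3 : B' ≤ n := ((le_max_right _ _).trans (le_max_right _ _)).trans hn'
    refine ⟨hn1, fun j _ => ?_⟩
    have hp : 0 < |h j| := abs_pos.2 (h0 j)
    have k1 : ‖(r j u - 1) / h j‖ ≤ n := (hB ⟨j, rfl⟩).trans hn2
    have k2 : ‖(r j u - 1) / h j * (r j u)⁻¹‖ ≤ n := (hB' ⟨j, rfl⟩).trans hn3
    have e2 : (r j u - 1) / h j * (r j u)⁻¹ = (1 - (r j u)⁻¹) / h j := by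
      have := hne j
      have := hcn j
      field_simp
    rw [e2] at k2
    rw [norm_div, Complex.norm_real, Real.norm_eq_abs, div_le_iff₀ hp] at k1 k2
    rw [norm_sub_rev] at k2
    exact ⟨k1, k2⟩
  let P : ℕ → Ω.Hilb →L[ℂ] Ω.Hilb := fun n => Domain.proj (hS n)
  have b1 : ∀ n u, ‖(S n).indicator (fun _ => (1 : ℂ)) u‖ ≤ 1 := fun n =>
    Domain.norm_indicator_le zero_le_one fun _ _ => norm_one.le
  have m1 : MemLp (fun _ : ℂ => (1 : ℂ)) ∞ Ω.absMeasure :=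
    memLp_top_of_bound aestronglyMeasurable_const 1 (Eventually.of_forall fun _ => norm_one.le)
  have hP : ∀ n, ‖P n‖ ≤ 1 := fun n =>
    Domain.norm_mulOp_le _ zero_le_one (Eventually.of_forall (b1 n))
  have hPa : ∀ n, adjoint (P n) = P n := fun n => by
    refine Domain.adjoint_mulOp _ fun u => ?_
    by_cases hu : u ∈ S n <;> simp [hu]
  have hPt : ∀ φ, Tendsto (fun n => P n φ) atTop (𝓝 φ) := fun φ => by
    have e : Ω.mulOp (fun _ => 1) m1 φ = φ := by
      refine Lp.ext ?_
      filter_upwards [Domain.coeFn_mulOp m1 φ] with u k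
      rw [k, one_mul]
    have t := Domain.tendsto_mulOp (fun n => Domain.memLp_indicator_one (hS n)) m1
      (fun n => Eventually.of_forall (b1 n)) (by
        filter_upwards [hSev] with u k
        refine tendsto_const_nhds.congr' ?_
        filter_upwards [k] with n hn
        rw [Set.indicator_of_mem hn]) φ
    rw [e] at t
    exact t
  have hex : ∀ n, ∃ a : Ω.Hilb →L[ℂ] Ω.Hilb,
      P n * H' * P n = a * (P n * H * P n) - (P n * H * P n) * a +
        P n * Ω.powerOp d (fun u => f u i) (fun u => g u i) * P n := by
    intro n
    -- Discarding the first n members of the sequence makes the bounds defining Sₙ hold for every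
    -- index.
    have tn : Tendsto (fun j => j + n) atTop atTop := tendsto_add_atTop_nat n
    refine hH.exists_truncated_commutator (fun j => hHj (j + n)) (r := fun j => r (j + n))
      (h := fun j => h (j + n)) (fun j => h0 _) (fun j => h1 _) (ht.comp tn) (fun j => hc _) ?_
      hf hg (hH'.comp tn) (hS n) (N := n) (Nat.cast_nonneg n) (fun u hu => hu.1)
      fun u hu j => hu.2 _ (Nat.le_add_left n j)
    filter_upwards [hrd] with u ⟨a, ha⟩
    exact ⟨a, ha.comp tn⟩
  choose a ha using hex
  exact trace_eq_of_truncated_commutator tH tH' (Domain.isTraceClass_powerOp d _ _) hu hP hPa hPt ha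

end IsIntegrableOp

/-! ## Families of cubic integrable operators -/

theorem deltaDiag_ne_zero {m : ℕ} (θ : Params m) (z : ℂ) (k : Fin (m + 1)) :
    deltaDiag θ z k ≠ 0 := by
  unfold deltaDiag
  refine Fin.lastCases ?_ (fun j => ?_) k
  · simp
  · simp [Complex.exp_ne_zero]

theorem fVec_apply {m : ℕ} (F : ℂ → Fin (m + 1) → ℂ) (c : Params m → ℂ → ℂ) (θ : Params m) (u : ℂ)
    (k : Fin (m + 1)) : fVec F c θ u k = c θ u * (deltaDiag θ u k * F u k) := by
  simp [fVec, Delta, Matrix.mulVec_diagonal]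

theorem gVec_apply {m : ℕ} (G : ℂ → Fin (m + 1) → ℂ) (c : Params m → ℂ → ℂ) (θ : Params m) (u : ℂ)
    (k : Fin (m + 1)) : gVec G c θ u k = (c θ u)⁻¹ * ((deltaDiag θ u k)⁻¹ * G u k) := by
  have h : (Delta θ u)⁻¹ = Matrix.diagonal fun k => (deltaDiag θ u k)⁻¹ := by
    refine Matrix.inv_eq_right_inv ?_
    rw [Delta, Matrix.diagonal_mul_diagonal, ← Matrix.diagonal_one]
    congr 1
    funext k
    exact mul_inv_cancel₀ (deltaDiag_ne_zero θ u k)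
  simp [gVec, h, Matrix.mulVec_diagonal]

namespace CubicFamily

variable {Ω : Domain} {m : ℕ} {U : Set (Params m)} (𝓗 : CubicFamily Ω m U)

theorem isIntegrableOp {θ : Params m} (hθ : θ ∈ U) :
    IsIntegrableOp (𝓗.H θ) (𝓗.f θ) (𝓗.g θ) where
  memLp_f := 𝓗.f_memL2 θ hθ
  memLp_g := 𝓗.g_memL2 θ hθ
  orthogonal := by
    filter_upwards [Ω.ae_mem_carrier] with u hu k
    have h := 𝓗.orthogonal u hu k
    have e : 𝓗.F u ⬝ᵥ (Emat k *ᵥ 𝓗.G u) = 𝓗.F u k * 𝓗.G u k := by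
      rw [Emat, Matrix.single_mulVec]
      change 𝓗.F u ⬝ᵥ Pi.single k (1 * 𝓗.G u k) = _
      rw [dotProduct_single, one_mul]
    rw [e] at h
    rw [f, g, fVec_apply, gVec_apply]
    linear_combination (𝓗.c θ u * deltaDiag θ u k * (𝓗.c θ u)⁻¹ * (deltaDiag θ u k)⁻¹) * h
  kernel := 𝓗.kernel θ hθ

/-- Intermediate powers are dominated through |u|ˡ ≤ 1 + |u|². -/
theorem memLp_pow_mul {a : ℂ → ℂ} (h0 : MemLp a 2 Ω.absMeasure)
    (h2 : MemLp (fun u => u ^ 2 * a u) 2 Ω.absMeasure) {l : ℕ} (hl : l ≤ 2) :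
    MemLp (fun u => u ^ l * a u) 2 Ω.absMeasure := by
  refine (h0.norm.add h2.norm).mono (((continuous_pow l).aestronglyMeasurable).mul h0.1)
    (Eventually.of_forall fun u => ?_)
  simp only [Pi.add_apply, norm_mul, norm_pow]
  rw [Real.norm_of_nonneg (by positivity), ← one_add_mul]
  gcongr
  interval_cases l <;> nlinarith [norm_nonneg u, sq_nonneg (‖u‖ - 1)]

/-- Along a curve of parameters that multiplies the `i`-th component of `Δ` by `exp (s uᵈ)`, the
logarithmic derivative of the determinant is the trace of a finite rank operator. -/
theorem hasDerivAt_det (hU : IsOpen U) (htrace : ∀ θ ∈ U, IsTraceClass (𝓗.H θ))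
    (hinv : ∀ θ ∈ U, IsUnit (1 - 𝓗.H θ)) {p : ℝ → Params m} (hp : Continuous p) {s₀ : ℝ}
    (hθ : p s₀ ∈ U) {d : ℕ} {i : Fin (m + 1)}
    (hΔ : ∀ s u k, deltaDiag (p s) u k =
      (if k = i then Complex.exp (((s - s₀ : ℝ) : ℂ) * u ^ d) else 1) * deltaDiag (p s₀) u k)
    (hf : ∀ l < d, MemLp (fun u => u ^ l * 𝓗.f (p s₀) u i) 2 Ω.absMeasure)
    (hg : ∀ l < d, MemLp (fun u => u ^ l * 𝓗.g (p s₀) u i) 2 Ω.absMeasure)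
    (hcd : ∀ u ∈ Ω.carrier, DifferentiableAt ℝ (fun s => 𝓗.c (p s) u) s₀)
    (hHd : TraceNormDifferentiableAt (fun s => 𝓗.H (p s)) s₀) :
    HasDerivAt (fun s => 𝓗.det (p s)) (𝓗.det (p s₀) *
      -trace (Ring.inverse (1 - 𝓗.H (p s₀)) ∘L
        Ω.powerOp d (fun u => 𝓗.f (p s₀) u i) (fun u => 𝓗.g (p s₀) u i))) s₀ := by
  obtain ⟨H', hH'⟩ := hHd
  have hUev : ∀ᶠ s in 𝓝 s₀, p s ∈ U := hp.continuousAt.eventually (hU.mem_nhds hθ)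
  obtain ⟨δ, hδ, hδU⟩ := Metric.eventually_nhds_iff.1 hUev
  -- Steps below δ stay in U, and steps at most 1 meet the hypothesis of `trace_derivative`.
  let h : ℕ → ℝ := fun j => min (δ / 2) 1 / (j + 1)
  have hε : 0 < min (δ / 2) 1 := by positivity
  have hpos : ∀ j, 0 < h j := fun j => by positivity
  have hle : ∀ j, h j ≤ min (δ / 2) 1 := fun j => div_le_self hε.le (by
    have : (0 : ℝ) ≤ j := Nat.cast_nonneg j
    linarith)
  have ht : Tendsto h atTop (𝓝 0) := by
    have e := (tendsto_one_div_add_atTop_nhds_zero_nat (𝕜 := ℝ)).const_mul (min (δ / 2) 1)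
    rw [mul_zero] at e
    refine e.congr fun j => ?_
    rw [mul_one_div]
  have ht' : Tendsto h atTop (𝓝[≠] 0) :=
    tendsto_nhdsWithin_iff.2 ⟨ht, Eventually.of_forall fun j => (hpos j).ne'⟩
  have hmem : ∀ j, p (s₀ + h j) ∈ U := fun j => hδU (by
    rw [dist_eq_norm, add_sub_cancel_left, Real.norm_of_nonneg (hpos j).le]
    have := (hle j).trans (min_le_left _ _)
    linarith)
  -- The derivative differs from some trace class difference quotient by an operator of finite trace
  -- norm.
  have tH' : IsTraceClass H' := by
    obtain ⟨j, hj⟩ := ((hH'.comp ht').eventually (gt_mem_nhds ENNReal.zero_lt_top)).exists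
    have e1 : IsTraceClass (((h j : ℝ) : ℂ)⁻¹ • (𝓗.H (p (s₀ + h j)) - 𝓗.H (p s₀))) :=
      ((htrace _ (hmem j)).sub (htrace _ hθ)).smul _
    have e2 : IsTraceClass (((h j : ℝ) : ℂ)⁻¹ • (𝓗.H (p (s₀ + h j)) - 𝓗.H (p s₀)) - H') := hj
    simpa using e1.sub e2
  have main := hasDerivAt_fredholmDet (A := fun s => 𝓗.H (p s)) (A' := H') (s₀ := s₀)
    (hUev.mono fun s hs => htrace _ hs) tH' (hinv _ hθ) hH'
  have key := (𝓗.isIntegrableOp hθ).trace_derivative (fun j => 𝓗.isIntegrableOp (hmem j))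
    (r := fun j u => 𝓗.c (p (s₀ + h j)) u / 𝓗.c (p s₀) u) (h := h) (d := d) (i := i)
    (fun j => (hpos j).ne') (fun j => by
      rw [abs_of_pos (hpos j)]; exact (hle j).trans (min_le_right _ _)) ht
    (fun j => ?_) ?_ hf hg (H' := H') ?_ (htrace _ hθ) tH' (hinv _ hθ)
  · change trace (Ring.inverse (1 - 𝓗.H (p s₀)) ∘L H') = _ at key
    rw [key] at main
    exact main
  · refine ⟨?_, ?_, ?_, ?_⟩
    · have e := ((𝓗.measurable_c _ (hmem j)).aemeasurable.div
        (𝓗.measurable_c _ hθ).aemeasurable).aestronglyMeasurable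
      exact e
    · filter_upwards [Ω.ae_mem_carrier] with u hu
      exact div_ne_zero (𝓗.c_ne_zero _ (hmem j) u hu) (𝓗.c_ne_zero _ hθ u hu)
    · filter_upwards [Ω.ae_mem_carrier] with u hu k
      have hc0 := 𝓗.c_ne_zero _ hθ u hu
      rw [f, f, fVec_apply, fVec_apply, hΔ (s₀ + h j), add_sub_cancel_left]
      field_simp
    · filter_upwards [Ω.ae_mem_carrier] with u hu k
      have hc0 := 𝓗.c_ne_zero _ hθ u hu
      rw [g, g, gVec_apply, gVec_apply, hΔ (s₀ + h j), add_sub_cancel_left, inv_div, mul_inv,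
        Complex.exp_neg, div_mul_eq_mul_div]
      split_ifs
      · field_simp
      · field_simp
  · filter_upwards [Ω.ae_mem_carrier] with u hu
    have hc0 := 𝓗.c_ne_zero _ hθ u hu
    have e := ((hcd u hu).hasDerivAt.tendsto_slope_zero.comp ht').mul_const (𝓗.c (p s₀) u)⁻¹
    refine ⟨_, e.congr fun j => ?_⟩
    have : ((h j : ℝ) : ℂ) ≠ 0 := by exact_mod_cast (hpos j).ne'
    simp only [Function.comp_apply, Complex.real_smul, Complex.ofReal_inv]
    field_simp
  · exact tendsto_of_tendsto_traceNorm_sub (hH'.comp ht')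

end CubicFamily

theorem deltaDiag_setY {m : ℕ} (θ : Params m) (i : Fin m) (s : ℝ) (u : ℂ) (k : Fin (m + 1)) :
    deltaDiag (θ.setY i s) u k = (if k = i.castSucc then
      Complex.exp (((s - θ.y i : ℝ) : ℂ) * u ^ 2) else 1) * deltaDiag θ u k := by
  refine Fin.lastCases ?_ (fun j => ?_) k
  · have : Fin.last m ≠ i.castSucc := (Fin.castSucc_lt_last i).ne'
    simp [deltaDiag, this]
  · simp only [deltaDiag, Fin.snoc_castSucc, Fin.castSucc_inj]
    by_cases hj : j = i
    · subst hj
      simp only [if_true, ← Complex.exp_add]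
      congr 1
      simp [Params.setY, Params.x, Params.y, Params.t]
      ring
    · simp [hj, Params.setY, Params.x, Params.y, Params.t]

theorem deltaDiag_setT {m : ℕ} (θ : Params m) (i : Fin m) (s : ℝ) (u : ℂ) (k : Fin (m + 1)) :
    deltaDiag (θ.setT i s) u k = (if k = i.castSucc then
      Complex.exp (((s - θ.t i : ℝ) : ℂ) * u ^ 3) else 1) * deltaDiag θ u k := by
  refine Fin.lastCases ?_ (fun j => ?_) k
  · have : Fin.last m ≠ i.castSucc := (Fin.castSucc_lt_last i).ne'
    simp [deltaDiag, this]
  · simp only [deltaDiag, Fin.snoc_castSucc, Fin.castSucc_inj]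
    by_cases hj : j = i
    · subst hj
      simp only [if_true, ← Complex.exp_add]
      congr 1
      simp [Params.setT, Params.x, Params.y, Params.t]
      ring
    · simp [hj, Params.setT, Params.x, Params.y, Params.t]

theorem Params.setY_self {m : ℕ} (θ : Params m) (i : Fin m) : θ.setY i (θ.y i) = θ := by
  simp [Params.setY, Params.x, Params.y, Params.t]

theorem Params.setT_self {m : ℕ} (θ : Params m) (i : Fin m) : θ.setT i (θ.t i) = θ := by
  simp [Params.setT, Params.x, Params.y, Params.t]

theorem Params.continuous_setY {m : ℕ} (θ : Params m) (i : Fin m) : Continuous (θ.setY i) := by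
  have h : Continuous fun s : ℝ => Function.update θ.y i s :=
    continuous_const.update i continuous_id
  exact continuous_const.prodMk (h.prodMk continuous_const)

theorem Params.continuous_setT {m : ℕ} (θ : Params m) (i : Fin m) : Continuous (θ.setT i) := by
  have h : Continuous fun s : ℝ => Function.update θ.t i s :=
    continuous_const.update i continuous_id
  exact continuous_const.prodMk (continuous_const.prodMk h)

end CubicIntegrable

end

/-! ### The logarithmic derivatives of the determinant -/

theorem mainTheorem8 (Ω : CubicIntegrable.Domain) (m : ℕ) (hm : 1 ≤ m)
    (U : Set (CubicIntegrable.Params m)) (hU : IsOpen U)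
    (𝓗 : CubicIntegrable.CubicFamily Ω m U)
    (htrace : ∀ θ ∈ U, CubicIntegrable.IsTraceClass (𝓗.H θ))
    (hinv : ∀ θ ∈ U, IsUnit (1 - 𝓗.H θ))
    (hmom : 𝓗.HasMoments) (hdiff : 𝓗.IsDifferentiable)
    (θ : CubicIntegrable.Params m) (hθ : θ ∈ U) (i : Fin m) :
    -- the integrals for the entries of the matrices used below converge absolutely
    ((∀ j k, Ω.IntegrableOver (𝓗.momentIntegrand 1 θ hθ j k)) ∧
      (∀ k, Ω.IntegrableOver (𝓗.momentIntegrand 2 θ hθ i.castSucc k) ∧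
        Ω.IntegrableOver (𝓗.momentIntegrand 2 θ hθ k i.castSucc)) ∧
      Ω.IntegrableOver (𝓗.momentIntegrand 3 θ hθ i.castSucc i.castSucc)) ∧
    𝓗.det θ ≠ 0 ∧
    (DifferentiableAt ℝ (fun s : ℝ => 𝓗.det (θ.setY i s)) (θ.y i) ∧
      logDeriv (fun s : ℝ => 𝓗.det (θ.setY i s)) (θ.y i) =
        Matrix.trace ((𝓗.Y 1 θ hθ ^ 2 - 2 • 𝓗.Y 2 θ hθ) *
          CubicIntegrable.Emat i.castSucc)) ∧
    (DifferentiableAt ℝ (fun s : ℝ => 𝓗.det (θ.setT i s)) (θ.t i) ∧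
      logDeriv (fun s : ℝ => 𝓗.det (θ.setT i s)) (θ.t i) =
        Matrix.trace ((-(𝓗.Y 1 θ hθ ^ 3) + 2 • (𝓗.Y 1 θ hθ * 𝓗.Y 2 θ hθ) +
          𝓗.Y 2 θ hθ * 𝓗.Y 1 θ hθ - 3 • 𝓗.Y 3 θ hθ) *
          CubicIntegrable.Emat i.castSucc)) := by
  have hH := 𝓗.isIntegrableOp hθ
  have hR' : (1 - 𝓗.H θ) * Ring.inverse (1 - 𝓗.H θ) = 1 := Ring.mul_inverse_cancel _ (hinv θ hθ)
  have hR : Ring.inverse (1 - 𝓗.H θ) * (1 - 𝓗.H θ) = 1 := Ring.inverse_mul_cancel _ (hinv θ hθ)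
  have hf : ∀ l ≤ 2, MemLp (fun u => u ^ l * 𝓗.f θ u i.castSucc) 2 Ω.absMeasure := fun l hl =>
    CubicIntegrable.CubicFamily.memLp_pow_mul (hH.memLp_f i.castSucc) (hmom θ hθ i).1 hl
  have hg : ∀ l ≤ 2, MemLp (fun u => u ^ l * 𝓗.g θ u i.castSucc) 2 Ω.absMeasure := fun l hl =>
    CubicIntegrable.CubicFamily.memLp_pow_mul (hH.memLp_g i.castSucc) (hmom θ hθ i).2 hl
  have hY : ∀ n, 𝓗.Y n θ hθ = hH.moment (Ring.inverse (1 - 𝓗.H θ)) n := by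
    intro n
    ext j k
    simp only [CubicIntegrable.CubicFamily.Y, CubicIntegrable.IsIntegrableOp.moment,
      Matrix.of_apply, CubicIntegrable.Domain.toHilb_eq (hH.memLp_f j)]
    rfl
  have hdet : 𝓗.det θ ≠ 0 := CubicIntegrable.fredholmDet_ne_zero (htrace θ hθ) (hinv θ hθ)
  obtain ⟨hcd, hyd, htd⟩ := hdiff θ hθ i
  refine ⟨⟨fun j k => ?_, fun k => ⟨?_, ?_⟩, ?_⟩, hdet, ?_, ?_⟩
  · refine (CubicIntegrable.Domain.integrableOver_mul (hH.memLp_g k)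
      (Lp.memLp (𝓗.resolventF θ hθ j))).congr (Eventually.of_forall fun u => ?_)
    simp only [CubicIntegrable.CubicFamily.momentIntegrand]
    ring
  -- In row i no decay of u gₖ is available for general k, so the weight u goes to R fᵢ, where
  -- `memLp_id_mul` applies; the column and the entry of Y₃ put the weight on gᵢ.
  · have hw : MemLp (fun u => u * ((hH.memLp_f i.castSucc).toLp _ : Ω.Hilb) u) 2 Ω.absMeasure := by
      refine (memLp_congr_ae ?_).1 (hf 1 (by norm_num))
      filter_upwards [(hH.memLp_f i.castSucc).coeFn_toLp] with u hu
      rw [hu, pow_one]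
    refine (CubicIntegrable.Domain.integrableOver_mul (hH.memLp_g k)
      (hH.memLp_id_mul hR hR' hw)).congr (Eventually.of_forall fun u => ?_)
    change _ = u ^ (2 - 1) * (Ring.inverse (1 - 𝓗.H θ) (hH.memLp_f i.castSucc).toLp u * _)
    ring
  · refine (CubicIntegrable.Domain.integrableOver_mul (hg 1 (by norm_num))
      (Lp.memLp (𝓗.resolventF θ hθ k))).congr (Eventually.of_forall fun u => ?_)
    simp only [CubicIntegrable.CubicFamily.momentIntegrand]
    ring
  · refine (CubicIntegrable.Domain.integrableOver_mul (hg 2 le_rfl)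
      (Lp.memLp (𝓗.resolventF θ hθ i.castSucc))).congr (Eventually.of_forall fun u => ?_)
    simp only [CubicIntegrable.CubicFamily.momentIntegrand]
    ring
  · have e := θ.setY_self i
    have hd := 𝓗.hasDerivAt_det hU htrace hinv (θ.continuous_setY i) (s₀ := θ.y i) (d := 2)
      (i := i.castSucc) (by rwa [e])
      (fun s u k => by rw [e]; exact CubicIntegrable.deltaDiag_setY θ i s u k)
      (fun l hl => by rw [e]; exact hf l (by omega)) (fun l hl => by rw [e]; exact hg l (by omega))
      (fun u hu => (hcd u hu).1) hyd
    rw [e, hH.trace_powerOp_two hR hR' hf hg, ← hY, ← hY] at hd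
    refine ⟨hd.differentiableAt, ?_⟩
    rw [logDeriv_apply, hd.deriv, e, mul_div_cancel_left₀ _ hdet]
  · have e := θ.setT_self i
    have hd := 𝓗.hasDerivAt_det hU htrace hinv (θ.continuous_setT i) (s₀ := θ.t i) (d := 3)
      (i := i.castSucc) (by rwa [e])
      (fun s u k => by rw [e]; exact CubicIntegrable.deltaDiag_setT θ i s u k)
      (fun l hl => by rw [e]; exact hf l (by omega)) (fun l hl => by rw [e]; exact hg l (by omega))
      (fun u hu => (hcd u hu).2) htd
    rw [e, hH.trace_powerOp_three hR hR' hf hg, ← hY, ← hY, ← hY] at hd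
    refine ⟨hd.differentiableAt, ?_⟩
    rw [logDeriv_apply, hd.deriv, e, mul_div_cancel_left₀ _ hdet]
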